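/- **Setting.** Let $\mathcal V=\{1,\dots,N\}$ be agents with states $x_i\in\mathbb R^{n_i}$, inputs $u_i\in\mathbb R^{m_i}$ and a directed coupling graph $\mathcal E$; write $\mathcal N_i^\leftarrow=\{j\ne i:(j,i)\in\mathcal E\}$, $\mathcal N_i^\rightarrow=\{j\neq i:(i,j)\in\mathcal E\}$, $\mathcal N_i=\mathcal N_i^\leftarrow\cup\mathcal N_i^\rightarrow$. The dynamics are $\dot x_i=f_i(x_i,u_i,x_{\mathcal N_i^\leftarrow})=f_{ii}(x_i,u_i)+\sum_{j\in\mathcal N_i^\leftarrow}f_{ij}(x_i,x_j)$, the stage costs $l_i=l_{ii}(x_i,u_i)+\sum_{j\in\mathcal N_i^\leftarrow}l_{ij}(x_i,x_j)$, the terminal costs $V_i(x_i)$; $l_{ii},l_i,V_i\ge0$. All these functions are $C^2$, $f_i(0,0,0)=0$, and $u_i(t)\in\mathbb U_i$ with $\mathbb U_i$ compact, convex, $0\in\operatorname{int}\mathbb U_i$. In stacked form: $\dot x=f(x,u)$, $l=\sum_i l_i$, $V=\sum_i V_i$, $\mathbb U=\prod_i\mathbb U_i$, with $m_l(\|x\|^2+\|u\|^2)\le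 l\le M_l(\|x\|^2+\|u\|^2)$ and $m_V\|x\|^2\le V\le M_V\|x\|^2$, $0<m_l\le M_l$, $0<m_V\le M_V$. All norms are Euclidean, and $\|q\|_{L_\infty}=\max_{[0,T]}\|q(\tau)\|$. For a horizon $T>0$ the central problem at $\bar x$ is to minimize $J=V(x(T))+\int_0^Tl(x,u)\,d\tau$ over measurable $\mathbb U$-valued $u$, where $\dot x=f(x,u)$, $x(0)=\bar x$; $J^*(\bar x)$ is its optimal cost. Every initial state and admissible input have a trajectory on $[0,T]$. $\Gamma\ni0$ is an open set on which the minimizer $(u^*(\cdot;\bar x),x^*(\cdot;\bar x))$ exists and is unique. With $\beta>0$ from Assumption 2, $\Gamma_a=\{x\in\Gamma:J^*(x)\le a\}$, $\alpha=\beta(1+\frac{m_l}{m_V}T)$, and $\Gamma_\alpha$ is compact. **Algorithm.** Given the previous iterate $(x^{q-1},\lambda^{q-1})$, set $g_{ji}=\partial_{x_i}l_{ji}(x_j^{q-1},x_i^{q-1})+\partial_{x_i}f_{ji}(x_j^{q-1},x_i^{q-1})^{T}\lambda_j^{q-1}$. Agent $i$ computes a minimizer $(u_i^q,x_i^q)$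 of $$V_i(x_i(T))+\int_0^T l_i(x_i,u_i,x^{q-1}_{\mathcal N_i^\leftarrow})+\sum_{j\in\mathcal N_i^\rightarrow}g_{ji}^T(x_i-x_i^{q-1})\,d\tau$$ subject to $\dot x_i=f_i(x_i,u_i,x^{q-1}_{\mathcal N_i^\leftarrow})$, $x_i(0)=\bar x_i$, $u_i(\tau)\in\mathbb U_i$, and the adjoint $\lambda_i^q$ given by $\dot\lambda_i=-\partial_{x_i}H_i$, $\lambda_i(T)=\partial_{x_i}V_i(x_i(T))$, with $H_i$ the local Hamiltonian. It quits in the first iteration $q\geq 1$ in which $\|(x_i^q-x_i^{q-1},\lambda_i^q-\lambda_i^{q-1})\|_{L_\infty}\le d\|\bar x_i\|$ for all $i$. *Closed loop.* With sampling time $\Delta t\in(0,T)$ and system state $\bar x_k$ at time $k\Delta t$, the algorithm at $\bar x_k$ quits in an iteration $q_k$; the actual trajectory $x_c^{q_k}(\cdot;\bar x_k)$ solves $\dot x_c=f(x_c,u^{q_k})$, $x_c(0)=\bar x_k$ on $[0,T]$; $\bar x_{k+1}=x_c^{q_k}(\Delta t;\bar x_k)$, and the closed-loop state is $x(k\Delta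 t+\tau)=x_c^{q_k}(\tau;\bar x_k)$ for $\tau\in[0,\Delta t)$. The error is $\Delta x_c^{q_k}=x_c^{q_k}-x^*$. For given $r_x,r_\lambda>0$ a pair $(\xi,\mu)$ of continuous trajectories on $[0,T]$ is called appropriate if $\xi(\tau)\in\Gamma_\alpha^{r_x}$ and $\mu(\tau)\in\{\nabla V(x):x\in\Gamma_\alpha^{r_x}\}^{r_\lambda}$ for all $\tau$, where $S^r$ is the union of the closed $r$-balls around the points of $S$. The algorithm is initialized with an appropriate pair at $k=0$ (e.g. the constants $\bar x_0,\nabla V(\bar x_0)$) and warm-started with $(x^{q_k},\lambda^{q_k})$ of the preceding step afterwards. **Assumptions.** (1–2) $\Omega_\beta=\{x\in\Gamma:V(x)\le\beta\}$ is compact, and there is a structured feedback $r(x)=[r_i(x_i,x_{\mathcal N_i})]_i\in\mathbb U$ with $\nabla V(x)^Tf(x,r(x))+l(x,r(x))\le0$ on $\Omega_\beta$. (3) $J^*$ is $C^2$ on $\Gamma$; $u^*(\tau;\bar x)=\kappa^*(\tau,x^*(\tau;\bar x);\bar x)$ a.e. with a law $\kappa^*$ that is locally Lipschitz in the state and in $\bar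 x\in\Gamma$, uniformly in $\tau\in[0,T]$, and $\kappa^*(\tau,0;\bar x)=0$; and $u^q(\tau)=\kappa(\tau,x^q(\tau);x^{q-1},\lambda^{q-1},\bar x)$ a.e. with a law $\kappa$ that generates in this way the solutions of the local problems and, more generally, all triples $(u,x,\lambda)$ satisfying their first-order (Pontryagin) conditions, and that for $\bar x\in\Gamma_\alpha$, states in $\Gamma_\alpha^{r_x}$ and appropriate $(x^{q-1},\lambda^{q-1})$ is Lipschitz with a constant $L$ in the state and, in the $L_\infty$-norm, in $x^{q-1}$ and $\lambda^{q-1}$. **Theorem.** There is $T_{\max}>0$, depending only on the network data, on $r_x,r_\lambda$, on $L$ and on a bound for $\Gamma_\alpha$, such that for $0<T<T_{\max}$, under Assumptions 1–3: (i) There is $p\in(0,1)$ such that for $\bar x\in\Gamma_\alpha$ each iteration of the algorithm from an appropriate pair gives an appropriate pair and satisfies $\|(x^*-x^q,\lambda^*-\lambda^q)\|_{L_\infty}\le p\|(x^*-x^{q-1},\lambda^*-\lambda^{q-1})\|_{L_\infty}$, where $\lambda^*$ is the adjoint of the central problem. (ii) There are constants $m_J,M_J,D,b,c>0$, $a\in(0,1]$,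 independent of $d$, and for each $d>0$ some $\bar\alpha\in(0,\alpha)$, such that (A) $m_J\|x\|^2\le J^*(x)\le M_J\|x\|^2$ on $\Gamma_\alpha$; (B) $\|\Delta x_c^{q}(\cdot;\bar x)\|_{L_\infty}\le Dd\|\bar x\|$ for $\bar x\in\Gamma_\alpha$; (C) for $\bar x\in\Gamma_{\bar\alpha}$: $x_c^{q}(\Delta t;\bar x)\in\Gamma_\alpha$ and $J^*(x_c^{q}(\Delta t;\bar x))\le(1-a)J^*(\bar x)+b\sqrt{J^*(\bar x)}\,\|\Delta x_c^{q}(\cdot;\bar x)\|_{L_\infty}+c\|\Delta x_c^{q}(\cdot;\bar x)\|_{L_\infty}^2$, where in (B) and (C) the algorithm starts from any appropriate pair and quits, with the constant $d$, in iteration $q$. (iii) For any such constants and any $d>0$, $\bar\alpha\in(0,\alpha)$ satisfying (A)–(C) and $$d<\frac{\sqrt{m_J}}{2cD}\Big(\sqrt{b^2+4ac}-b\Big),$$ the number $p_J=(1-a)+\frac{bDd}{\sqrt{m_J}}+\frac{cD^2d^2}{m_J}$ is in $(0,1)$, $\Gamma_{\bar\alpha}$ is a neighborhood of $0$, and every closed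 loop with $\bar x_0\in\Gamma_{\bar\alpha}$ satisfies, for all $k$, $\bar x_k\in\Gamma_{\bar\alpha}$, $$J^*(\bar x_k)\le p_J^k\,J^*(\bar x_0),\qquad \|\Delta x_c^{q_k}(\cdot;\bar x_k)\|_{L_\infty}\le\frac{Dd}{\sqrt{m_J}}\sqrt{p_J^k\,J^*(\bar x_0)};$$ moreover the origin of the closed loop is exponentially stable: there are $\gamma_1,\gamma_2>0$ with $\|x(t)\|\le\gamma_1e^{-\gamma_2t}\|\bar x_0\|$ for all $t\ge0$ and all closed loops with $\bar x_0\in\Gamma_{\bar\alpha}$. -/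

import Mathlib

open MeasureTheory Set Filter Topology

noncomputable section

/-- A network of `N` agents: state and input dimensions, directed coupling graph, neighbor-affine
dynamics `f_ii`, `f_ij`, neighbor-affine stage costs `l_ii`, `l_ij`, terminal costs `V_i`, and
input constraint sets `U_i`. -/
structure AgentNetwork (N : ℕ) where
  n : Fin N → ℕ
  m : Fin N → ℕ
  edge : Fin N → Fin N → Prop
  fLoc : (i : Fin N) → EuclideanSpace ℝ (Fin (n i)) → EuclideanSpace ℝ (Fin (m i)) →
    EuclideanSpace ℝ (Fin (n i))
  fCpl : (i j : Fin N) → EuclideanSpace ℝ (Fin (n i)) → EuclideanSpace ℝ (Fin (n j)) →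
    EuclideanSpace ℝ (Fin (n i))
  lLoc : (i : Fin N) → EuclideanSpace ℝ (Fin (n i)) → EuclideanSpace ℝ (Fin (m i)) → ℝ
  lCpl : (i j : Fin N) → EuclideanSpace ℝ (Fin (n i)) → EuclideanSpace ℝ (Fin (n j)) → ℝ
  VLoc : (i : Fin N) → EuclideanSpace ℝ (Fin (n i)) → ℝ
  U : (i : Fin N) → Set (EuclideanSpace ℝ (Fin (m i)))

/-- The `L_∞`-norm `max_{τ ∈ [0,T]} ‖q τ‖` (of functions that are continuous on `[0,T]`). -/
def Linf {E : Type*} [Norm E] (T : ℝ) (q : ℝ → E) : ℝ :=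
  sSup ((fun τ => ‖q τ‖) '' Icc 0 T)

/-- `x` solves `x' = F(τ, x)`, `x(0) = x₀` on `[0,T]` (integral form). -/
def SolvesForward {E : Type*} [NormedAddCommGroup E] [NormedSpace ℝ E]
    (T : ℝ) (F : ℝ → E → E) (x₀ : E) (x : ℝ → E) : Prop :=
  ContinuousOn x (Icc 0 T) ∧ ∀ τ ∈ Icc (0 : ℝ) T, x τ = x₀ + ∫ s in (0 : ℝ)..τ, F s (x s)

/-- `y` solves `y' = -G(τ, y)`, `y(T) = y_T` on `[0,T]` (integral form). -/
def SolvesBackward {E : Type*} [NormedAddCommGroup E] [NormedSpace ℝ E]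
    (T : ℝ) (G : ℝ → E → E) (yT : E) (y : ℝ → E) : Prop :=
  ContinuousOn y (Icc 0 T) ∧ ∀ τ ∈ Icc (0 : ℝ) T, y τ = yT + ∫ s in τ..T, G s (y s)

/-- The `r`-neighborhood of a set: the union of the closed `r`-balls around its points. -/
def nbhdSet {E : Type*} [PseudoMetricSpace E] (S : Set E) (r : ℝ) : Set E :=
  ⋃ s ∈ S, Metric.closedBall s r

namespace AgentNetwork

variable {N : ℕ} (P : AgentNetwork N)

/-- State space of agent `i`. -/
abbrev AState (i : Fin N) := EuclideanSpace ℝ (Fin (P.n i))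
/-- Input space of agent `i`. -/
abbrev AInput (i : Fin N) := EuclideanSpace ℝ (Fin (P.m i))
/-- Stacked state space, with the Euclidean norm. -/
abbrev State := PiLp 2 (fun i : Fin N => EuclideanSpace ℝ (Fin (P.n i)))
/-- Stacked input space, with the Euclidean norm. -/
abbrev Input := PiLp 2 (fun i : Fin N => EuclideanSpace ℝ (Fin (P.m i)))

open Classical in
/-- Sending neighbors: the agents that influence agent `i`. -/
def sending (i : Fin N) : Finset (Fin N) :=
  Finset.univ.filter (fun j => P.edge j i ∧ j ≠ i)

open Classical in
/-- Receiving neighbors: the agents influenced by agent `i`. -/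
def receiving (i : Fin N) : Finset (Fin N) :=
  Finset.univ.filter (fun j => P.edge i j ∧ i ≠ j)

/-- Dynamics of agent `i`; of `z` only the components of the sending neighbors enter. -/
def fAgent (i : Fin N) (xi : P.AState i) (ui : P.AInput i) (z : P.State) : P.AState i :=
  P.fLoc i xi ui + ∑ j ∈ P.sending i, P.fCpl i j xi (z j)

/-- Stage cost of agent `i`; of `z` only the components of the sending neighbors enter. -/
def lAgent (i : Fin N) (xi : P.AState i) (ui : P.AInput i) (z : P.State) : ℝ :=
  P.lLoc i xi ui + ∑ j ∈ P.sending i, P.lCpl i j xi (z j)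

/-- Central dynamics. -/
def f (x : P.State) (u : P.Input) : P.State :=
  WithLp.toLp 2 (fun i => P.fAgent i (x i) (u i) x)

/-- Central stage cost. -/
def l (x : P.State) (u : P.Input) : ℝ := ∑ i, P.lAgent i (x i) (u i) x

/-- Central (separable) terminal cost. -/
def V (x : P.State) : ℝ := ∑ i, P.VLoc i (x i)

/-- Standing assumptions on the dynamics, the costs and the input constraints. -/
structure IsRegular (ml Ml mV MV : ℝ) : Prop where
  fLoc_smooth : ∀ i, ContDiff ℝ 2 (fun z : P.AState i × P.AInput i => P.fLoc i z.1 z.2)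
  fCpl_smooth : ∀ i, ∀ j ∈ P.sending i,
    ContDiff ℝ 2 (fun z : P.AState i × P.AState j => P.fCpl i j z.1 z.2)
  lLoc_smooth : ∀ i, ContDiff ℝ 2 (fun z : P.AState i × P.AInput i => P.lLoc i z.1 z.2)
  lCpl_smooth : ∀ i, ∀ j ∈ P.sending i,
    ContDiff ℝ 2 (fun z : P.AState i × P.AState j => P.lCpl i j z.1 z.2)
  VLoc_smooth : ∀ i, ContDiff ℝ 2 (P.VLoc i)
  f_zero : ∀ i, P.fAgent i 0 0 0 = 0
  VLoc_nonneg : ∀ i z, 0 ≤ P.VLoc i z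
  lLoc_nonneg : ∀ i z v, 0 ≤ P.lLoc i z v
  lAgent_nonneg : ∀ i z v y, 0 ≤ P.lAgent i z v y
  U_compact : ∀ i, IsCompact (P.U i)
  U_convex : ∀ i, Convex ℝ (P.U i)
  U_zero : ∀ i, (0 : P.AInput i) ∈ interior (P.U i)
  ml_pos : 0 < ml
  ml_le : ml ≤ Ml
  mV_pos : 0 < mV
  mV_le : mV ≤ MV
  l_lower : ∀ x u, ml * (‖x‖ ^ 2 + ‖u‖ ^ 2) ≤ P.l x u
  l_upper : ∀ x u, P.l x u ≤ Ml * (‖x‖ ^ 2 + ‖u‖ ^ 2)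
  V_lower : ∀ x, mV * ‖x‖ ^ 2 ≤ P.V x
  V_upper : ∀ x, P.V x ≤ MV * ‖x‖ ^ 2

/-! ### The central optimal control problem -/

/-- Admissible inputs: measurable with values in the product of the sets `U_i` on `[0,T]`. -/
def Admissible (T : ℝ) (u : ℝ → P.Input) : Prop :=
  Measurable u ∧ ∀ τ ∈ Icc (0 : ℝ) T, ∀ i, u τ i ∈ P.U i

/-- `x` is the trajectory of the central system for the input `u` and initial state `x₀`. -/
def IsTraj (T : ℝ) (x₀ : P.State) (u : ℝ → P.Input) (x : ℝ → P.State) : Prop :=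
  SolvesForward T (fun s y => P.f y (u s)) x₀ x

/-- Central cost. -/
def cost (T : ℝ) (u : ℝ → P.Input) (x : ℝ → P.State) : ℝ :=
  P.V (x T) + ∫ τ in (0 : ℝ)..T, P.l (x τ) (u τ)

/-- `(u, x)` solves the central optimal control problem with initial state `x₀`. -/
def IsOptimal (T : ℝ) (x₀ : P.State) (u : ℝ → P.Input) (x : ℝ → P.State) : Prop :=
  P.Admissible T u ∧ P.IsTraj T x₀ u x ∧
    ∀ v y, P.Admissible T v → P.IsTraj T x₀ v y → P.cost T u x ≤ P.cost T v y

/-- Optimal cost `J*`: the least cost (attained wherever a minimizer exists). -/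
def optCost (T : ℝ) (x₀ : P.State) : ℝ :=
  sInf {r | ∃ u x, P.Admissible T u ∧ P.IsTraj T x₀ u x ∧ r = P.cost T u x}

/-- The sublevel set `Γ_a = {x ∈ Γ : J*(x) ≤ a}`. -/
def level (T : ℝ) (Γ : Set P.State) (a : ℝ) : Set P.State := {x | x ∈ Γ ∧ P.optCost T x ≤ a}

/-- Central Hamiltonian. -/
def centralH (x : P.State) (u : P.Input) (lam : P.State) : ℝ :=
  P.l x u + inner ℝ lam (P.f x u)

/-- `lam` is the central adjoint trajectory along `(u, x)`. -/
def IsCentralAdjoint (T : ℝ) (u : ℝ → P.Input) (x lam : ℝ → P.State) : Prop :=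
  SolvesBackward T (fun s y => gradient (fun z => P.centralH z (u s) y) (x s))
    (gradient P.V (x T)) lam

/-- Standing assumptions on the central problem with horizon `T`: every initial state and
admissible input have a trajectory on `[0,T]`; `Γ` is an open neighborhood of the origin on which
the optimal solution exists and is unique; and the level set `Γ_α` is compact. -/
structure CentralWellPosed (T : ℝ) (Γ : Set P.State) (α : ℝ) : Prop where
  complete : ∀ x₀ u, P.Admissible T u → ∃ x, P.IsTraj T x₀ u x
  isOpen : IsOpen Γ
  zero_mem : (0 : P.State) ∈ Γ
  exists_opt : ∀ x₀ ∈ Γ, ∃ u x, P.IsOptimal T x₀ u x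
  unique_opt : ∀ x₀ ∈ Γ, ∀ u x v y, P.IsOptimal T x₀ u x → P.IsOptimal T x₀ v y →
    (∀ᵐ τ, τ ∈ Icc (0 : ℝ) T → u τ = v τ) ∧ EqOn x y (Icc 0 T)
  compact_level : IsCompact (P.level T Γ α)

/-- The set `Ω_β = {x ∈ Γ : V(x) ≤ β}` is compact, and there is a structured terminal feedback
`r_i(x_i, x_{N_i})` with values in the input sets for which the separable terminal cost `V`
satisfies the control-Lyapunov inequality on `Ω_β`. -/
def StructuredCLF (Γ : Set P.State) (β : ℝ) : Prop :=
  0 < β ∧ IsCompact {x | x ∈ Γ ∧ P.V x ≤ β} ∧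
  ∃ r : P.State → P.Input,
    (∀ i, ∀ x y : P.State, x i = y i → (∀ j ∈ P.sending i ∪ P.receiving i, x j = y j) →
      r x i = r y i) ∧
    ∀ x ∈ Γ, P.V x ≤ β → (∀ i, r x i ∈ P.U i) ∧
      fderiv ℝ P.V x (P.f x (r x)) + P.l x (r x) ≤ 0

/-! ### The local problems and the sensitivity-based algorithm -/

/-- The gradient `g_ji = ∂_{x_i} l_ji(x_j, x_i) + ∂_{x_i} f_ji(x_j, x_i)ᵀ λ_j`, evaluated at the
previous iterate `(z, w)`. -/
def sens (j i : Fin N) (z w : P.State) : P.AState i :=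
  gradient (fun y => P.lCpl j i (z j) y + inner ℝ (w j) (P.fCpl j i (z j) y)) (z i)

/-- The linear sensitivity term in the local cost of agent `i`. -/
def sensTerm (i : Fin N) (xi : P.AState i) (z w : P.State) : ℝ :=
  ∑ j ∈ P.receiving i, inner ℝ (P.sens j i z w) (xi - z i)

/-- Local Hamiltonian of agent `i` for the previous iterate `(z, w)`. -/
def localH (i : Fin N) (xi : P.AState i) (ui : P.AInput i) (li : P.AState i)
    (z w : P.State) : ℝ :=
  P.lAgent i xi ui z + inner ℝ li (P.fAgent i xi ui z) + P.sensTerm i xi z w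

/-- Admissible inputs of agent `i`. -/
def LocalAdmissible (T : ℝ) (i : Fin N) (ui : ℝ → P.AInput i) : Prop :=
  Measurable ui ∧ ∀ τ ∈ Icc (0 : ℝ) T, ui τ ∈ P.U i

/-- Trajectory of agent `i`, with its neighbors frozen at the previous iterate `xb`. -/
def IsLocalTraj (T : ℝ) (i : Fin N) (x₀ : P.State) (xb : ℝ → P.State)
    (ui : ℝ → P.AInput i) (xi : ℝ → P.AState i) : Prop :=
  SolvesForward T (fun s y => P.fAgent i y (ui s) (xb s)) (x₀ i) xi

/-- Local cost of agent `i`, extended by the sensitivities of its neighbors. -/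
def localCost (T : ℝ) (i : Fin N) (xb lb : ℝ → P.State)
    (ui : ℝ → P.AInput i) (xi : ℝ → P.AState i) : ℝ :=
  P.VLoc i (xi T) + ∫ τ in (0 : ℝ)..T,
    (P.lAgent i (xi τ) (ui τ) (xb τ) + P.sensTerm i (xi τ) (xb τ) (lb τ))

/-- Local adjoint equation of agent `i`. -/
def IsLocalAdjoint (T : ℝ) (i : Fin N) (xb lb : ℝ → P.State)
    (ui : ℝ → P.AInput i) (xi li : ℝ → P.AState i) : Prop :=
  SolvesBackward T (fun s y => gradient (fun z => P.localH i z (ui s) y (xb s) (lb s)) (xi s))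
    (gradient (P.VLoc i) (xi T)) li

/-- `(ui, xi)` solves the local optimal control problem of agent `i`, with adjoint `li`. -/
def IsLocalSolution (T : ℝ) (i : Fin N) (x₀ : P.State) (xb lb : ℝ → P.State)
    (ui : ℝ → P.AInput i) (xi li : ℝ → P.AState i) : Prop :=
  P.LocalAdmissible T i ui ∧ P.IsLocalTraj T i x₀ xb ui xi ∧
  (∀ vi yi, P.LocalAdmissible T i vi → P.IsLocalTraj T i x₀ xb vi yi →
    P.localCost T i xb lb ui xi ≤ P.localCost T i xb lb vi yi) ∧
  P.IsLocalAdjoint T i xb lb ui xi li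

/-- `(ui, xi, li)` satisfies the first-order (Pontryagin) optimality conditions of the local
optimal control problem of agent `i`. -/
def IsLocalExtremal (T : ℝ) (i : Fin N) (x₀ : P.State) (xb lb : ℝ → P.State)
    (ui : ℝ → P.AInput i) (xi li : ℝ → P.AState i) : Prop :=
  P.LocalAdmissible T i ui ∧ P.IsLocalTraj T i x₀ xb ui xi ∧
  P.IsLocalAdjoint T i xb lb ui xi li ∧
  ∀ᵐ τ, τ ∈ Icc (0 : ℝ) T → ∀ v ∈ P.U i,
    P.localH i (xi τ) (ui τ) (li τ) (xb τ) (lb τ) ≤ P.localH i (xi τ) v (li τ) (xb τ) (lb τ)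

/-- One iteration of the algorithm: all agents solve their local problems for the previous
iterate `(xb, lb)` in parallel. -/
def IsStep (T : ℝ) (x₀ : P.State) (xb lb : ℝ → P.State)
    (u : ℝ → P.Input) (x lam : ℝ → P.State) : Prop :=
  ∀ i, P.IsLocalSolution T i x₀ xb lb (fun τ => u τ i) (fun τ => x τ i) (fun τ => lam τ i)

/-- Stacked first-order solutions of all the local problems for the previous iterate
`(xb, lb)`. -/
def IsExtremalStep (T : ℝ) (x₀ : P.State) (xb lb : ℝ → P.State)
    (u : ℝ → P.Input) (x lam : ℝ → P.State) : Prop :=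
  ∀ i, P.IsLocalExtremal T i x₀ xb lb (fun τ => u τ i) (fun τ => x τ i) (fun τ => lam τ i)

/-- Continuous state and adjoint trajectories `(xb, lb)` on `[0,T]` with `xb` in the
`rx`-neighborhood `G^rx` of the set `G` and `lb` in the `rl`-neighborhood of `∇V(G^rx)`. -/
def Appropriate (T : ℝ) (G : Set P.State) (rx rl : ℝ) (xb lb : ℝ → P.State) : Prop :=
  ContinuousOn xb (Icc 0 T) ∧ ContinuousOn lb (Icc 0 T) ∧
  ∀ τ ∈ Icc (0 : ℝ) T, xb τ ∈ nbhdSet G rx ∧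
    lb τ ∈ nbhdSet ((fun x => gradient P.V x) '' nbhdSet G rx) rl

/-- The stopping criterion, for all agents. -/
def Stops (T d : ℝ) (x₀ : P.State) (x lam xb lb : ℝ → P.State) : Prop :=
  ∀ i, Linf T (fun τ => (WithLp.toLp 2 (x τ i - xb τ i, lam τ i - lb τ i) :
    WithLp 2 (P.AState i × P.AState i))) ≤ d * ‖x₀ i‖

/-- The algorithm, run at the system state `x₀`, produces the iterates `(u s, x s, lam s)`,
starting from `(x 0, lam 0)`, and quits in iteration `q`, the first iteration in which the
stopping criterion with constant `d` holds. -/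
structure IsAlgorithmRun (T d : ℝ) (x₀ : P.State) (q : ℕ)
    (u : ℕ → ℝ → P.Input) (x lam : ℕ → ℝ → P.State) : Prop where
  one_le : 1 ≤ q
  step : ∀ s < q, P.IsStep T x₀ (x s) (lam s) (u (s + 1)) (x (s + 1)) (lam (s + 1))
  stopped : P.Stops T d x₀ (x q) (lam q) (x (q - 1)) (lam (q - 1))
  first : ∀ s, 1 ≤ s → s < q → ¬ P.Stops T d x₀ (x s) (lam s) (x (s - 1)) (lam (s - 1))

/-- The closed loop under the distributed control law, with sampling time `dt`: `xs k` is the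
system state at time `k * dt`, `x k s`, `lam k s`, `u k s` are the iterates in sampling step `k`,
`q k` is the last iteration in that step, and `xc k` is the actual trajectory of the system
under the input `u k (q k)`. In step `0` the algorithm is initialized with appropriate trajectories
(for the set `G`), and afterwards it is warm-started. -/
structure IsClosedLoop (T dt d : ℝ) (G : Set P.State) (rx rl : ℝ)
    (xs : ℕ → P.State) (q : ℕ → ℕ) (u : ℕ → ℕ → ℝ → P.Input) (x lam : ℕ → ℕ → ℝ → P.State)
    (xc : ℕ → ℝ → P.State) : Prop where
  init : P.Appropriate T G rx rl (x 0 0) (lam 0 0)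
  run : ∀ k, P.IsAlgorithmRun T d (xs k) (q k) (u k) (x k) (lam k)
  warm_x : ∀ k, EqOn (x (k + 1) 0) (x k (q k)) (Icc 0 T)
  warm_lam : ∀ k, EqOn (lam (k + 1) 0) (lam k (q k)) (Icc 0 T)
  actual : ∀ k, P.IsTraj T (xs k) (u k (q k)) (xc k)
  next : ∀ k, xs (k + 1) = xc k dt

/-- The state of the closed loop at time `t = k * dt + τ`, `τ ∈ [0, dt)`, which is `xc k τ`. -/
def closedLoopState (dt : ℝ) (xc : ℕ → ℝ → P.State) (t : ℝ) : P.State :=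
  xc ⌊t / dt⌋₊ (t - ⌊t / dt⌋₊ * dt)

/-! ### The feedback laws -/

/-- The optimal control is generated by a feedback law `u*(τ; x₀) = κ*(τ, x*(τ; x₀); x₀)` that
vanishes at the state `0` and is locally Lipschitz in the state and in `x₀ ∈ Γ` (stated on compact
sets, uniformly in `τ`; the law may, but need not, depend on `τ` explicitly). -/
def HasLipschitzOptimalLaw (T : ℝ) (Γ : Set P.State) : Prop :=
  ∃ κ : ℝ → P.State → P.State → P.Input,
    (∀ x₀ ∈ Γ, ∀ u x, P.IsOptimal T x₀ u x → ∀ᵐ τ, τ ∈ Icc (0 : ℝ) T → u τ = κ τ (x τ) x₀) ∧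
    (∀ τ ∈ Icc (0 : ℝ) T, ∀ x₀ ∈ Γ, κ τ 0 x₀ = 0) ∧
    ∀ K C : Set P.State, IsCompact K → IsCompact C → C ⊆ Γ →
      ∃ Lk : ℝ, ∀ τ ∈ Icc (0 : ℝ) T, ∀ x ∈ K, ∀ y ∈ K, ∀ z ∈ C, ∀ w ∈ C,
        ‖κ τ x z - κ τ y w‖ ≤ Lk * (‖x - y‖ + ‖z - w‖)

/-- The controls of the algorithm are generated by a feedback law
`u^q(τ; x₀) = κ(τ, x^q(τ); x^{q-1}, λ^{q-1}, x₀)`, parametrized by the state and adjoint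
trajectories of the previous iteration: `κ` generates the solutions of the local problems and, more
generally, all triples that satisfy their first-order optimality conditions. On the bounded set of
arguments `x₀ ∈ G`, `x ∈ G^rx`, `(xb, lb)` appropriate, it is Lipschitz with constant `L`. -/
def HasLipschitzDMPCLaw (T : ℝ) (G : Set P.State) (rx rl L : ℝ) : Prop :=
  ∃ κ : ℝ → P.State → (ℝ → P.State) → (ℝ → P.State) → P.State → P.Input,
    (∀ x₀ ∈ G, ∀ xb lb, P.Appropriate T G rx rl xb lb → ∀ u x lam,
      P.IsStep T x₀ xb lb u x lam ∨ P.IsExtremalStep T x₀ xb lb u x lam →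
      ∀ᵐ τ, τ ∈ Icc (0 : ℝ) T → u τ = κ τ (x τ) xb lb x₀) ∧
    ∀ x₀ ∈ G, ∀ xb lb yb mb, P.Appropriate T G rx rl xb lb → P.Appropriate T G rx rl yb mb →
      ∀ τ ∈ Icc (0 : ℝ) T, ∀ x ∈ nbhdSet G rx, ∀ y ∈ nbhdSet G rx,
        ‖κ τ x xb lb x₀ - κ τ y yb mb x₀‖ ≤
          L * (‖x - y‖ + Linf T (fun s => xb s - yb s) + Linf T (fun s => lb s - mb s))

/-! ### Convergence of the algorithm and the constants of the stability analysis -/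

/-- Linear convergence of the algorithm with ratio `p` to the central optimal state and adjoint
trajectories, for all system states in `G`; the iterates stay appropriate. -/
def ConvergesLinearly (T : ℝ) (G : Set P.State) (rx rl p : ℝ) : Prop :=
  ∀ x₀ ∈ G, ∀ us xo lo, P.IsOptimal T x₀ us xo → P.IsCentralAdjoint T us xo lo →
    ∀ xb lb, P.Appropriate T G rx rl xb lb → ∀ u x lam, P.IsStep T x₀ xb lb u x lam →
      P.Appropriate T G rx rl x lam ∧
      Linf T (fun τ => (WithLp.toLp 2 (xo τ - x τ, lo τ - lam τ) :
          WithLp 2 (P.State × P.State))) ≤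
        p * Linf T (fun τ => (WithLp.toLp 2 (xo τ - xb τ, lo τ - lb τ) :
          WithLp 2 (P.State × P.State)))

/-- `m_J ‖x‖² ≤ J*(x) ≤ M_J ‖x‖²` on `G`. -/
def CostBound (T : ℝ) (G : Set P.State) (mJ MJ : ℝ) : Prop :=
  ∀ x ∈ G, mJ * ‖x‖ ^ 2 ≤ P.optCost T x ∧ P.optCost T x ≤ MJ * ‖x‖ ^ 2

/-- `‖Δx_c‖_{L_∞} ≤ D d ‖x₀‖` for all system states `x₀ ∈ G`, where `Δx_c` is the difference of the
actual trajectory, under the input returned by the algorithm with stopping constant `d`, and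
the optimal trajectory. -/
def ErrorBound (T : ℝ) (G : Set P.State) (rx rl D d : ℝ) : Prop :=
  ∀ x₀ ∈ G, ∀ q u x lam, P.Appropriate T G rx rl (x 0) (lam 0) →
    P.IsAlgorithmRun T d x₀ q u x lam → ∀ xc, P.IsTraj T x₀ (u q) xc →
    ∀ us xo, P.IsOptimal T x₀ us xo → Linf T (fun τ => xc τ - xo τ) ≤ D * d * ‖x₀‖

/-- For system states `x₀ ∈ Γ_αb`, the next state `x_c(dt)` of the system, under the input returned
by the algorithm with stopping constant `d`, is in `Γ_α`, and
`J*(x_c(dt)) ≤ (1 - a) J*(x₀) + b √(J*(x₀)) ‖Δx_c‖ + c ‖Δx_c‖²`. -/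
def DescentBound (T dt : ℝ) (Γ : Set P.State) (α rx rl a b c d αb : ℝ) : Prop :=
  ∀ x₀ ∈ P.level T Γ αb, ∀ q u x lam, P.Appropriate T (P.level T Γ α) rx rl (x 0) (lam 0) →
    P.IsAlgorithmRun T d x₀ q u x lam → ∀ xc, P.IsTraj T x₀ (u q) xc →
    ∀ us xo, P.IsOptimal T x₀ us xo →
      xc dt ∈ P.level T Γ α ∧
      P.optCost T (xc dt) ≤ (1 - a) * P.optCost T x₀
        + b * √(P.optCost T x₀) * Linf T (fun τ => xc τ - xo τ)
        + c * Linf T (fun τ => xc τ - xo τ) ^ 2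

/-- Exponential decay in the closed loop from all initial states in `Γ_αb`, a neighborhood of the
origin: of the optimal cost with ratio `pJ`, of the error, bounded by
`E √(pJ^k J*(x(0)))`, and of the state, with constants uniform in the initial state and in the
closed-loop run. -/
def ExponentialDecay (T dt : ℝ) (Γ : Set P.State) (α rx rl d αb pJ E : ℝ) : Prop :=
  P.level T Γ αb ∈ 𝓝 (0 : P.State) ∧
  (∀ xs q u x lam xc, P.IsClosedLoop T dt d (P.level T Γ α) rx rl xs q u x lam xc →
    xs 0 ∈ P.level T Γ αb → ∀ k,
      xs k ∈ P.level T Γ αb ∧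
      P.optCost T (xs k) ≤ pJ ^ k * P.optCost T (xs 0) ∧
      ∀ us xo, P.IsOptimal T (xs k) us xo →
        Linf T (fun τ => xc k τ - xo τ) ≤ E * √(pJ ^ k * P.optCost T (xs 0))) ∧
  ∃ γ₁ γ₂ : ℝ, 0 < γ₁ ∧ 0 < γ₂ ∧
    ∀ xs q u x lam xc, P.IsClosedLoop T dt d (P.level T Γ α) rx rl xs q u x lam xc →
      xs 0 ∈ P.level T Γ αb → ∀ t : ℝ, 0 ≤ t →
        ‖P.closedLoopState dt xc t‖ ≤ γ₁ * Real.exp (-γ₂ * t) * ‖xs 0‖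

end AgentNetwork

end

noncomputable section

/-! ### The sup norm on `[0,T]`. -/

section Linf

variable {E : Type*} [NormedAddCommGroup E] {T : ℝ}

/-! A short horizon replaces Gronwall arguments. The states, adjoints and inputs that occur stay in
a ball of radius `R` on which the stacked dynamics, the stacked Hamiltonian gradients, `∇V` and the
stage cost are bounded by, and Lipschitz with, one constant `C`. When `C * T` is small, trajectories
cannot leave the ball, and an error that reappears on the right of its own estimate can be absorbed
on the left (`ShortHorizon`, `exists_shortHorizon`).

Convergence: the central optimum is a fixed point of the iteration at the level of first-order
conditions. Its state gradient of the Hamiltonian splits into the local gradients with the neighbors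
frozen at the optimum itself (`hasGradientAt_centralH`), the sensitivity terms being exactly the
derivatives that the local costs miss. The maximum principle, proved by needle variations
(`needle_variation`, `hamiltonian_le_of_optimal`), gives the local minimum conditions when one
agent's input is varied (`isExtremalStep`). The feedback law therefore generates both the optimal
input and the iterate's input. Its Lipschitz bound, inserted in the integral equations, makes an
iteration contract with factor `1/2` (`step_contraction`). At the quitting iteration this turns the
stopping criterion into an error bound (`errorBound`).

Cost: Cauchy–Schwarz bounds the displacement along a trajectory by its stage cost, which yields the
quadratic lower bound on `J*` and shows that one sampling interval consumes a fixed fraction of `J*`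
(`exists_fraction`); the zero input yields the upper bound. For the decrease of `J*`, the rest of
the optimal trajectory is prolonged by a terminal input costing at most `V` up to `ε`. The terminal
feedback carries no regularity, so this input is built by sample-and-hold (`exists_sampled_input`,
`optCost_traj_le`). Passing from the optimal to the actual next state uses that `J*` is `C²` with a
minimum at `0`: its gradient vanishes there, so its increments are of second order
(`exists_increment_le`, `exists_descentBound`).

Stability: inserting the error bound into the descent inequality gives `J*` the ratio `1 - a + b s +
c s²` with `s = D d / √mJ`, and the bound on `d` says that `s` lies below the positive root of `c s²
+ b s = a` (`decayRate_bounds`). Induction over the sampling steps, which also carries the warm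
start, finishes the proof (`exponentialDecay`). -/

theorem norm_le_Linf {q : ℝ → E} (hq : ContinuousOn q (Icc 0 T)) {τ : ℝ} (hτ : τ ∈ Icc 0 T) :
    ‖q τ‖ ≤ Linf T q :=
  le_csSup (isCompact_Icc.image_of_continuousOn hq.norm).bddAbove ⟨τ, hτ, rfl⟩

theorem Linf_le {q : ℝ → E} (hT : 0 ≤ T) {c : ℝ} (h : ∀ τ ∈ Icc 0 T, ‖q τ‖ ≤ c) :
    Linf T q ≤ c := by
  refine csSup_le ⟨_, 0, ⟨le_rfl, hT⟩, rfl⟩ ?_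
  rintro _ ⟨τ, hτ, rfl⟩
  exact h τ hτ

theorem Linf_nonneg (q : ℝ → E) : 0 ≤ Linf T q := by
  refine Real.sSup_nonneg ?_
  rintro _ ⟨τ, -, rfl⟩
  exact norm_nonneg _

end Linf

/-! ### Integral equations: confinement, comparison, existence. -/

section Ode

variable {E : Type*} [NormedAddCommGroup E] [NormedSpace ℝ E] {T : ℝ}

theorem SolvesForward.apply_zero {F : ℝ → E → E} {x₀ : E} {x : ℝ → E} (hT : 0 ≤ T)
    (h : SolvesForward T F x₀ x) : x 0 = x₀ := by
  simpa using h.2 0 ⟨le_rfl, hT⟩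

/-- Time reversal, so that confinement of adjoints follows from the forward case. -/
theorem SolvesBackward.reverse {G : ℝ → E → E} {yT : E} {y : ℝ → E}
    (h : SolvesBackward T G yT y) :
    SolvesForward T (fun s z => G (T - s) z) yT (fun s => y (T - s)) := by
  have hm : MapsTo (fun s => T - s) (Icc 0 T) (Icc 0 T) := fun s hs => by
    constructor <;> linarith [hs.1, hs.2]
  refine ⟨h.1.comp (by fun_prop) hm, fun τ hτ => ?_⟩
  have := h.2 (T - τ) (hm hτ)
  show y (T - τ) = yT + ∫ s in (0 : ℝ)..τ, (fun s => G s (y s)) (T - s)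
  rw [this, intervalIntegral.integral_comp_sub_left (fun s => G s (y s)) T]
  simp

/-- First-exit argument: up to the first time at which the distance reaches `r` the speed is at most
`M`, so the distance there would be at most `M * T < r`. The field needs to be bounded on the ball
only, and no Lipschitz condition enters. -/
theorem SolvesForward.norm_sub_le_of_bounded {F : ℝ → E → E} {x₀ : E} {x : ℝ → E} {M r : ℝ}
    (h : SolvesForward T F x₀ x) (hM0 : 0 ≤ M) (hMT : M * T < r)
    (hM : ∀ s ∈ Icc 0 T, ∀ y, ‖y - x₀‖ ≤ r → ‖F s y‖ ≤ M) :
    ∀ τ ∈ Icc 0 T, ‖x τ - x₀‖ ≤ M * τ := by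
  -- The half-open interval leaves out the exit time itself, where the ball bound may fail; one
  -- point does not affect the integral.
  have key : ∀ τ ∈ Icc 0 T, (∀ s ∈ Ico 0 τ, ‖x s - x₀‖ ≤ r) → ‖x τ - x₀‖ ≤ M * τ := by
    intro τ hτ hs
    rw [h.2 τ hτ, add_sub_cancel_left]
    refine (intervalIntegral.norm_integral_le_of_norm_le_const_ae (C := M) ?_).trans_eq
      (by rw [sub_zero, abs_of_nonneg hτ.1])
    have : ∀ᵐ s : ℝ, s ≠ τ := by simp [ae_iff]
    filter_upwards [this] with s hsτ hs'
    rw [uIoc_of_le hτ.1] at hs'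
    have h1 : s < τ := lt_of_le_of_ne hs'.2 hsτ
    exact hM s ⟨hs'.1.le, h1.le.trans hτ.2⟩ _ (hs s ⟨hs'.1.le, h1⟩)
  have hball : ∀ τ ∈ Icc 0 T, ‖x τ - x₀‖ < r := by
    by_contra! hcon
    obtain ⟨τ₁, hτ₁, hr⟩ := hcon
    have hc : IsCompact (Icc 0 T ∩ (fun τ => ‖x τ - x₀‖) ⁻¹' Ici r) :=
      isCompact_Icc.of_isClosed_subset (ContinuousOn.preimage_isClosed_of_isClosed
        (h.1.sub continuousOn_const).norm isClosed_Icc isClosed_Ici) inter_subset_left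
    obtain ⟨τ, ⟨hτ, hτr⟩, hmin⟩ := hc.exists_isLeast ⟨τ₁, hτ₁, hr⟩
    have := key τ hτ fun s hs => by
      by_contra! hsr
      exact absurd (hmin ⟨⟨hs.1, hs.2.le.trans hτ.2⟩, hsr.le⟩) (not_le.2 hs.2)
    have h2 : M * τ ≤ M * T := mul_le_mul_of_nonneg_left hτ.2 hM0
    have h3 : r ≤ ‖x τ - x₀‖ := hτr
    linarith
  exact fun τ hτ => key τ hτ fun s hs => (hball s ⟨hs.1, hs.2.le.trans hτ.2⟩).le

theorem SolvesBackward.norm_sub_le_of_bounded {G : ℝ → E → E} {yT : E} {y : ℝ → E} {M r : ℝ}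
    (h : SolvesBackward T G yT y) (hM0 : 0 ≤ M) (hMT : M * T < r)
    (hM : ∀ s ∈ Icc 0 T, ∀ z, ‖z - yT‖ ≤ r → ‖G s z‖ ≤ M) :
    ∀ τ ∈ Icc 0 T, ‖y τ - yT‖ ≤ M * (T - τ) := by
  intro τ hτ
  have := h.reverse.norm_sub_le_of_bounded hM0 hMT
    (fun s hs => hM (T - s) ⟨by linarith [hs.2], by linarith [hs.1]⟩) (T - τ)
    ⟨by linarith [hτ.2], by linarith [hτ.1]⟩
  simpa using this

theorem norm_integral_sub_le {f g : ℝ → E} {K a b : ℝ} (ha : a ∈ Icc 0 T) (hb : b ∈ Icc 0 T)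
    (hab : a ≤ b)
    (hf : IntervalIntegrable f volume 0 T) (hg : IntervalIntegrable g volume 0 T)
    (hK : ∀ᵐ s, s ∈ Icc 0 T → ‖f s - g s‖ ≤ K) :
    ‖(∫ s in a..b, f s) - ∫ s in a..b, g s‖ ≤ K * (b - a) := by
  have hT : 0 ≤ T := ha.1.trans ha.2
  have hsub : uIcc a b ⊆ uIcc 0 T := by
    rw [uIcc_of_le hab, uIcc_of_le hT]; exact Icc_subset_Icc ha.1 hb.2
  rw [← intervalIntegral.integral_sub (hf.mono_set hsub) (hg.mono_set hsub)]
  refine (intervalIntegral.norm_integral_le_of_norm_le_const_ae (C := K) ?_).trans_eq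
    (by rw [abs_of_nonneg (by linarith)])
  filter_upwards [hK] with s hs hs'
  rw [uIoc_of_le hab] at hs'
  exact hs ⟨ha.1.trans hs'.1.le, hs'.2.trans hb.2⟩

/-- The bound `K` is taken along the two trajectories and may itself contain their sup-distance. On
a short horizon that term is absorbed later, which avoids Gronwall. -/
theorem SolvesForward.norm_sub_le {F F' : ℝ → E → E} {x₀ x₀' : E} {x x' : ℝ → E} {K : ℝ}
    (h : SolvesForward T F x₀ x) (h' : SolvesForward T F' x₀' x') (hK0 : 0 ≤ K)
    (hi : IntervalIntegrable (fun s => F s (x s)) volume 0 T)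
    (hi' : IntervalIntegrable (fun s => F' s (x' s)) volume 0 T)
    (hK : ∀ᵐ s, s ∈ Icc 0 T → ‖F s (x s) - F' s (x' s)‖ ≤ K) :
    ∀ τ ∈ Icc 0 T, ‖x τ - x' τ‖ ≤ ‖x₀ - x₀'‖ + K * T := by
  intro τ hτ
  rw [h.2 τ hτ, h'.2 τ hτ, add_sub_add_comm]
  refine (norm_add_le _ _).trans (add_le_add le_rfl ?_)
  refine (norm_integral_sub_le ⟨le_rfl, hτ.1.trans hτ.2⟩ hτ hτ.1 hi hi' hK).trans ?_
  gcongr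
  linarith [hτ.2]

theorem SolvesBackward.norm_sub_le {G G' : ℝ → E → E} {yT yT' : E} {y y' : ℝ → E} {K : ℝ}
    (h : SolvesBackward T G yT y) (h' : SolvesBackward T G' yT' y') (hK0 : 0 ≤ K)
    (hi : IntervalIntegrable (fun s => G s (y s)) volume 0 T)
    (hi' : IntervalIntegrable (fun s => G' s (y' s)) volume 0 T)
    (hK : ∀ᵐ s, s ∈ Icc 0 T → ‖G s (y s) - G' s (y' s)‖ ≤ K) :
    ∀ τ ∈ Icc 0 T, ‖y τ - y' τ‖ ≤ ‖yT - yT'‖ + K * T := by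
  intro τ hτ
  rw [h.2 τ hτ, h'.2 τ hτ, add_sub_add_comm]
  refine (norm_add_le _ _).trans (add_le_add le_rfl ?_)
  refine (norm_integral_sub_le hτ ⟨hτ.1.trans hτ.2, le_rfl⟩ hτ.2 hi hi' hK).trans ?_
  gcongr
  linarith [hτ.1]

/-- Banach's fixed point theorem for the Picard operator on continuous functions on `[0,T]`: `K * T
< 1` makes it a contraction on the whole interval at once, without a weighted norm. -/
theorem exists_solvesBackward [CompleteSpace E] {K : ℝ} (hT : 0 ≤ T) (hK0 : 0 ≤ K)
    (hKT : K * T < 1) (G : ℝ → E → E) (yT : E)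
    (hint : ∀ y, ContinuousOn y (Icc 0 T) → IntervalIntegrable (fun s => G s (y s)) volume 0 T)
    (hlip : ∀ s ∈ Icc 0 T, ∀ y z, ‖G s y - G s z‖ ≤ K * ‖y - z‖) :
    ∃ y, SolvesBackward T G yT y := by
  let ext : C(Icc (0 : ℝ) T, E) → ℝ → E := fun y => IccExtend hT y
  have hext : ∀ y, ContinuousOn (ext y) (Icc 0 T) := fun y =>
    (Continuous.Icc_extend' y.continuous).continuousOn
  have hcont : ∀ y : ℝ → E, ContinuousOn y (Icc 0 T) →
      ContinuousOn (fun τ => yT + ∫ s in τ..T, G s (y s)) (Icc 0 T) := by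
    intro y hy
    have := intervalIntegral.continuousOn_primitive_interval_left (a := 0) (b := T) (μ := volume)
      (f := fun s => G s (y s)) (by
        rw [uIcc_of_le hT]; exact (intervalIntegrable_iff_integrableOn_Icc_of_le hT).1 (hint y hy))
    rw [uIcc_of_le hT] at this
    exact continuousOn_const.add this
  let Φ : C(Icc (0 : ℝ) T, E) → C(Icc (0 : ℝ) T, E) := fun y =>
    ⟨fun τ => yT + ∫ s in (τ : ℝ)..T, G s (ext y s),
      continuousOn_iff_continuous_domRestrict.1 (hcont _ (hext y))⟩
  have hΦa : ∀ y τ, Φ y τ = yT + ∫ s in (τ : ℝ)..T, G s (ext y s) := fun y τ => rfl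
  have hKT0 : 0 ≤ K * T := mul_nonneg hK0 hT
  have hΦ : ContractingWith ⟨K * T, hKT0⟩ Φ := by
    refine ⟨by exact_mod_cast hKT, LipschitzWith.of_dist_le_mul fun y z => ?_⟩
    rw [ContinuousMap.dist_le (by positivity)]
    rintro ⟨τ, hτ⟩
    have : ‖(∫ s in τ..T, G s (ext y s)) - ∫ s in τ..T, G s (ext z s)‖
        ≤ (K * dist y z) * (T - τ) := by
      refine norm_integral_sub_le hτ ⟨hT, le_rfl⟩ hτ.2 (hint _ (hext y)) (hint _ (hext z))
        (Eventually.of_forall fun s hs => (hlip s hs _ _).trans ?_)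
      gcongr
      rw [← dist_eq_norm]
      simp only [ext, IccExtend_of_mem hT _ hs]
      exact ContinuousMap.dist_apply_le_dist _
    rw [hΦa, hΦa, dist_eq_norm, add_sub_add_left_eq_sub]
    rw [dist_eq_norm] at this ⊢
    refine this.trans ?_
    show _ ≤ K * T * ‖y - z‖
    calc K * ‖y - z‖ * (T - τ) ≤ K * ‖y - z‖ * T := by gcongr; linarith [hτ.1]
      _ = _ := by ring
  let y := ContractingWith.fixedPoint Φ hΦ
  have hy : Φ y = y := hΦ.fixedPoint_isFixedPt
  refine ⟨ext y, hext y, fun τ hτ => ?_⟩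
  conv_lhs => simp only [ext, IccExtend_of_mem hT _ hτ]
  exact (DFunLike.congr_fun hy ⟨τ, hτ⟩).symm.trans (hΦa y ⟨τ, hτ⟩)

end Ode

/-! ### Bounds and Lipschitz constants on balls. -/

section Lipschitz

/-- On the ball of radius `R` the map `Φ` is bounded by `C` and Lipschitz with constant `C`. -/
def BoundedLipschitz {A B : Type*} [NormedAddCommGroup A] [NormedAddCommGroup B] (R C : ℝ)
    (Φ : A → B) : Prop :=
  (∀ p, ‖p‖ ≤ R → ‖Φ p‖ ≤ C) ∧ ∀ p q, ‖p‖ ≤ R → ‖q‖ ≤ R → ‖Φ p - Φ q‖ ≤ C * ‖p - q‖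

theorem BoundedLipschitz.mono {A B : Type*} [NormedAddCommGroup A] [NormedAddCommGroup B]
    {R C C' : ℝ} {Φ : A → B} (h : BoundedLipschitz R C Φ) (hC : C ≤ C') :
    BoundedLipschitz R C' Φ :=
  ⟨fun p hp => (h.1 p hp).trans hC, fun p q hp hq => (h.2 p q hp hq).trans (by gcongr)⟩

/-- The ball is compact, so the map and its derivative are bounded on it; it is convex, so the mean
value inequality applies. -/
theorem ContDiffOn.exists_boundedLipschitz {A B : Type*} [NormedAddCommGroup A]
    [NormedSpace ℝ A] [FiniteDimensional ℝ A] [NormedAddCommGroup B] [NormedSpace ℝ B]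
    {S : Set A} (hS : IsOpen S) {Φ : A → B} (h : ContDiffOn ℝ 1 Φ S) {R : ℝ}
    (hR : Metric.closedBall 0 R ⊆ S) :
    ∃ C, BoundedLipschitz R C Φ := by
  have hK := isCompact_closedBall (0 : A) R
  have hd : ContinuousOn (fderiv ℝ Φ) S := h.continuousOn_fderiv_of_isOpen hS le_rfl
  obtain ⟨C₁, h₁⟩ := hK.exists_bound_of_continuousOn (h.continuousOn.mono hR)
  obtain ⟨C₂, h₂⟩ := hK.exists_bound_of_continuousOn (hd.mono hR)
  refine ⟨max C₁ C₂, fun p hp => (h₁ p (by simpa using hp)).trans (le_max_left _ _),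
    fun p q hp hq => ?_⟩
  refine (convex_closedBall (0 : A) R).norm_image_sub_le_of_norm_fderiv_le (f := Φ) (𝕜 := ℝ)
    (fun x hx => ?_) (fun x hx => (h₂ x hx).trans (le_max_right _ _)) (by simpa using hq)
    (by simpa using hp)
  exact (h.differentiableOn one_ne_zero).differentiableAt (hS.mem_nhds (hR hx))

theorem ContDiff.exists_boundedLipschitz {A B : Type*} [NormedAddCommGroup A]
    [NormedSpace ℝ A] [FiniteDimensional ℝ A] [NormedAddCommGroup B] [NormedSpace ℝ B]
    {Φ : A → B} (h : ContDiff ℝ 1 Φ) (R : ℝ) : ∃ C, BoundedLipschitz R C Φ :=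
  h.contDiffOn.exists_boundedLipschitz isOpen_univ (subset_univ _)

/-- First-order Taylor estimate for a function whose gradient is Lipschitz. -/
theorem abs_sub_sub_inner_le {E : Type*} [NormedAddCommGroup E] [InnerProductSpace ℝ E]
    [CompleteSpace E] {φ : E → ℝ} {g : E → E} {K R : ℝ} (hK : 0 ≤ K)
    (hg : ∀ x, ‖x‖ ≤ R → HasGradientAt φ (g x) x)
    (hlip : ∀ x y, ‖x‖ ≤ R → ‖y‖ ≤ R → ‖g x - g y‖ ≤ K * ‖x - y‖) {x y : E} (hx : ‖x‖ ≤ R)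
    (hy : ‖y‖ ≤ R) : |φ y - φ x - inner ℝ (g x) (y - x)| ≤ K * ‖y - x‖ ^ 2 := by
  have hseg : ∀ z ∈ segment ℝ x y, ‖z‖ ≤ R ∧ ‖z - x‖ ≤ ‖y - x‖ := by
    intro z hz
    refine ⟨?_, ?_⟩
    · have := (convex_closedBall (0 : E) R).segment_subset (by simpa using hx) (by simpa using hy)
        hz
      simpa using this
    · have := norm_sub_le_of_mem_segment hz
      simpa [norm_sub_rev] using this
  have := (convex_segment x y).norm_image_sub_le_of_norm_hasFDerivWithin_le' (𝕜 := ℝ) (f := φ)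
    (f' := fun z => InnerProductSpace.toDual ℝ E (g z)) (φ := InnerProductSpace.toDual ℝ E (g x))
    (C := K * ‖y - x‖) (x := x) (y := y)
    (fun z hz => (hg z (hseg z hz).1).hasFDerivAt.hasFDerivWithinAt) (fun z hz => ?_)
    (left_mem_segment ℝ x y) (right_mem_segment ℝ x y)
  · simpa [Real.norm_eq_abs, pow_two, mul_assoc] using this
  · rw [← map_sub, LinearIsometryEquiv.norm_map]
    refine (hlip z x (hseg z hz).1 hx).trans ?_
    gcongr
    exact (hseg z hz).2

end Lipschitz

/-! ### Integrability of compositions and Cauchy–Schwarz. -/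

section Integral

variable {T : ℝ}

theorem intervalIntegrable_comp_of_bounded {A B : Type*} [TopologicalSpace A]
    [NormedAddCommGroup B] {Φ : A → B} (hΦ : Continuous Φ) (hT : 0 ≤ T)
    {p : ℝ → A} (hp : AEStronglyMeasurable p (volume.restrict (Icc 0 T))) {C : ℝ}
    (hC : ∀ s ∈ Icc 0 T, ‖Φ (p s)‖ ≤ C) :
    IntervalIntegrable (fun s => Φ (p s)) volume 0 T := by
  rw [intervalIntegrable_iff_integrableOn_Icc_of_le hT]
  exact Integrable.of_bound (hΦ.comp_aestronglyMeasurable hp) C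
    ((ae_restrict_iff' measurableSet_Icc).2 (Eventually.of_forall hC))

/-- Expand `0 ≤ ∫ (g - c)²` and take for `c` the mean of `g`. -/
theorem sq_integral_le {g : ℝ → ℝ} {a b : ℝ} (hab : a ≤ b)
    (hg : IntervalIntegrable g volume a b)
    (hg2 : IntervalIntegrable (fun s => g s ^ 2) volume a b) :
    (∫ s in a..b, g s) ^ 2 ≤ (b - a) * ∫ s in a..b, g s ^ 2 := by
  set I := ∫ s in a..b, g s with hI
  have h : ∀ c : ℝ, 0 ≤ (∫ s in a..b, g s ^ 2) - 2 * c * I + c ^ 2 * (b - a) := by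
    intro c
    have h1 : 0 ≤ ∫ s in a..b, (g s - c) ^ 2 :=
      intervalIntegral.integral_nonneg hab fun s _ => sq_nonneg _
    have h2 : (fun s => (g s - c) ^ 2) = fun s => g s ^ 2 - 2 * c * g s + c ^ 2 := by
      ext s; ring
    rw [h2, intervalIntegral.integral_add (hg2.sub (hg.const_mul _)) (by simp),
      intervalIntegral.integral_sub hg2 (hg.const_mul _), intervalIntegral.integral_const_mul,
      intervalIntegral.integral_const, smul_eq_mul] at h1
    linarith
  rcases hab.eq_or_lt with rfl | hlt
  · simp [hI]
  · have hc := h (I / (b - a))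
    have hpos : 0 < b - a := by linarith
    field_simp at hc
    nlinarith

end Integral

/-! ### Integration by parts for primitives. -/

section ProductRule

variable {E : Type*} [NormedAddCommGroup E] [InnerProductSpace ℝ E] [CompleteSpace E] {T : ℝ}

/-- Product rule for two functions given as primitives of bounded integrable functions. -/
theorem inner_primitive_eq_integral (hT : 0 ≤ T) {α γ : ℝ → E} (c : E) {K : ℝ}
    (hα : IntervalIntegrable α volume 0 T) (hγ : IntervalIntegrable γ volume 0 T)
    (hαK : ∀ s ∈ Icc 0 T, ‖α s‖ ≤ K) (hγK : ∀ s ∈ Icc 0 T, ‖γ s‖ ≤ K) :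
    inner ℝ c (∫ s in (0 : ℝ)..T, α s) = ∫ s in (0 : ℝ)..T,
      (inner ℝ (c + ∫ r in s..T, γ r) (α s) - inner ℝ (γ s) (∫ r in (0 : ℝ)..s, α r)) := by
  have hK : 0 ≤ K := (norm_nonneg _).trans (hαK 0 ⟨le_rfl, hT⟩)
  set e : ℝ → E := fun s => ∫ r in (0 : ℝ)..s, α r with he
  set lam : ℝ → E := fun s => c + ∫ r in s..T, γ r with hlam
  have hsub : ∀ {a b}, a ∈ Icc 0 T → b ∈ Icc 0 T → uIcc a b ⊆ uIcc 0 T := by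
    intro a b ha hb
    rw [uIcc_of_le hT]
    exact uIcc_subset_Icc ha hb
  have hprim : ∀ (g : ℝ → E), (∀ s ∈ Icc 0 T, ‖g s‖ ≤ K) → ∀ a ∈ Icc 0 T, ∀ b ∈ Icc 0 T,
      ‖∫ r in a..b, g r‖ ≤ K * |b - a| := by
    intro g hg a ha b hb
    refine intervalIntegral.norm_integral_le_of_norm_le_const fun s hs => hg s ?_
    have := hsub ha hb (uIoc_subset_uIcc hs)
    rwa [uIcc_of_le hT] at this
  have h0 : (0 : ℝ) ∈ Icc 0 T := ⟨le_rfl, hT⟩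
  have h1 : T ∈ Icc 0 T := ⟨hT, le_rfl⟩
  have heL : ∀ a ∈ Icc 0 T, ∀ b ∈ Icc 0 T, ‖e a - e b‖ ≤ K * |a - b| := by
    intro a ha b hb
    have : e a - e b = ∫ r in b..a, α r := by
      simp only [he]
      exact intervalIntegral.integral_interval_sub_left (hα.mono_set (hsub h0 ha))
        (hα.mono_set (hsub h0 hb))
    rw [this]
    exact hprim α hαK b hb a ha
  have hlL : ∀ a ∈ Icc 0 T, ∀ b ∈ Icc 0 T, ‖lam a - lam b‖ ≤ K * |a - b| := by
    intro a ha b hb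
    have : lam a - lam b = ∫ r in a..b, γ r := by
      simp only [hlam, add_sub_add_left_eq_sub]
      exact sub_eq_of_eq_add (intervalIntegral.integral_add_adjacent_intervals
        (hγ.mono_set (hsub ha hb)) (hγ.mono_set (hsub hb h1))).symm
    rw [this, abs_sub_comm]
    exact hprim γ hγK a ha b hb
  have heB : ∀ a ∈ Icc 0 T, ‖e a‖ ≤ K * T := by
    intro a ha
    refine (hprim α hαK 0 h0 a ha).trans ?_
    rw [sub_zero, abs_of_nonneg ha.1]
    gcongr
    exact ha.2
  have hlB : ∀ a ∈ Icc 0 T, ‖lam a‖ ≤ ‖c‖ + K * T := by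
    intro a ha
    refine (norm_add_le _ _).trans (add_le_add le_rfl ((hprim γ hγK a ha T h1).trans ?_))
    rw [abs_of_nonneg (by linarith [ha.2])]
    gcongr
    linarith [ha.1]
  -- The integrands are only measurable, so the primitives are differentiable only almost
  -- everywhere. Lipschitz continuity makes the product absolutely continuous, so the fundamental
  -- theorem of calculus still holds.
  have hLip : LipschitzOnWith (Real.toNNReal ((‖c‖ + K * T) * K + K * (K * T)))
      (fun s => inner ℝ (lam s) (e s)) (uIcc 0 T) := by
    rw [uIcc_of_le hT]
    refine LipschitzOnWith.of_dist_le_mul fun a ha b hb => ?_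
    rw [Real.coe_toNNReal _ (by positivity), Real.dist_eq, Real.dist_eq]
    have : inner ℝ (lam a) (e a) - inner ℝ (lam b) (e b)
        = inner ℝ (lam a) (e a - e b) + inner ℝ (lam a - lam b) (e b) := by
      rw [inner_sub_right, inner_sub_left]; ring
    rw [this]
    calc _ ≤ ‖lam a‖ * ‖e a - e b‖ + ‖lam a - lam b‖ * ‖e b‖ :=
          (abs_add_le _ _).trans (add_le_add (abs_real_inner_le_norm _ _)
            (abs_real_inner_le_norm _ _))
      _ ≤ (‖c‖ + K * T) * (K * |a - b|) + (K * |a - b|) * (K * T) := by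
          gcongr
          · exact hlB a ha
          · exact heL a ha b hb
          · exact hlL a ha b hb
          · exact heB b hb
      _ = _ := by ring
  have hFTC := hLip.absolutelyContinuousOnInterval.integral_deriv_eq_sub
  have hend : inner ℝ (lam T) (e T) - inner ℝ (lam 0) (e 0) = inner ℝ c (∫ s in (0 : ℝ)..T, α s) := by
    simp [he, hlam]
  rw [← hend, ← hFTC]
  refine intervalIntegral.integral_congr_ae ?_
  filter_upwards [hα.ae_hasDerivAt_integral, hγ.ae_hasDerivAt_integral] with s hs1 hs2 hs
  have hs' := uIoc_subset_uIcc hs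
  have d1 : HasDerivAt e (α s) s := hs1 hs' 0 (by simp)
  have d2 : HasDerivAt lam (-γ s) s := by
    have := ((hs2 hs' T (by simp)).neg).const_add c
    convert! this using 2 with r
    simp only [Pi.neg_apply, hlam]
    rw [intervalIntegral.integral_symm]
  rw [(d2.inner ℝ d1).deriv, inner_neg_left, ← sub_eq_add_neg]

end ProductRule

/-! ### The maximum principle by needle variations. -/

section Pontryagin

theorem integral_indicator_Ioc {g : ℝ → ℝ} {T t t' : ℝ} (ht : 0 ≤ t) (htt : t ≤ t')
    (ht' : t' ≤ T) :
    ∫ s in (0 : ℝ)..T, (Ioc t t').indicator g s = ∫ s in t..t', g s := by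
  rw [intervalIntegral.integral_of_le (by linarith), intervalIntegral.integral_of_le htt,
    setIntegral_indicator measurableSet_Ioc, inter_eq_self_of_subset_right]
  exact Ioc_subset_Ioc ht ht'

theorem intervalIntegrable_indicator_Ioc {g : ℝ → ℝ} {T t t' : ℝ} (hT : 0 ≤ T)
    (hg : IntervalIntegrable g volume 0 T) :
    IntervalIntegrable ((Ioc t t').indicator g) volume 0 T := by
  rw [intervalIntegrable_iff_integrableOn_Ioc_of_le hT] at hg ⊢
  exact hg.indicator measurableSet_Ioc

/-- If a bounded integrable function has integral at least `-K (b - a)²` on all small intervals,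
it is nonnegative almost everywhere. -/
theorem ae_nonneg_of_integral_ge {g : ℝ → ℝ} {T K : ℝ} (hT : 0 ≤ T)
    (hg : IntervalIntegrable g volume 0 T)
    (h : ∀ t t', 0 ≤ t → t ≤ t' → t' ≤ T → -(K * (t' - t) ^ 2) ≤ ∫ s in t..t', g s) :
    ∀ᵐ s, s ∈ Icc 0 T → 0 ≤ g s := by
  have hne : ∀ᵐ s : ℝ, s ≠ T := by simp [ae_iff]
  filter_upwards [hg.ae_hasDerivAt_integral, hne] with s hs hsT hsI
  rw [uIcc_of_le hT] at hs
  -- At a Lebesgue point the difference quotients of the primitive tend to `g s`; from the right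
  -- they are at least `-(K * r)`, which tends to `0`.
  have hd := (hs hsI 0 ⟨le_rfl, hT⟩).tendsto_slope_zero_right
  have hlt : s < T := lt_of_le_of_ne hsI.2 hsT
  have hlim : Tendsto (fun r : ℝ => -(K * r)) (𝓝[>] 0) (𝓝 0) := by
    have : Tendsto (fun r : ℝ => -(K * r)) (𝓝 0) (𝓝 (-(K * 0))) := by
      exact Continuous.tendsto (by fun_prop) 0
    simpa using this.mono_left nhdsWithin_le_nhds
  refine le_of_tendsto_of_tendsto hlim hd ?_
  have hmem : Ioc 0 (T - s) ∈ 𝓝[>] (0 : ℝ) := Ioc_mem_nhdsGT (by linarith)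
  filter_upwards [hmem] with r hr
  have hI : ∀ {a b}, a ∈ Icc 0 T → b ∈ Icc 0 T → IntervalIntegrable g volume a b :=
    fun ha hb => hg.mono_set (by rw [uIcc_of_le hT]; exact uIcc_subset_Icc ha hb)
  have h0 : (0 : ℝ) ∈ Icc 0 T := ⟨le_rfl, hT⟩
  have hsr : s + r ∈ Icc 0 T := ⟨by linarith [hsI.1, hr.1], by linarith [hr.2]⟩
  rw [intervalIntegral.integral_interval_sub_left (hI h0 hsr) (hI h0 hsI), smul_eq_mul]
  have := h s (s + r) hsI.1 (by linarith [hr.1]) hsr.2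
  rw [add_sub_cancel_left] at this
  rw [inv_mul_eq_div, le_div_iff₀ hr.1]
  linarith

variable {E W : Type*} [NormedAddCommGroup E] [InnerProductSpace ℝ E] [FiniteDimensional ℝ E]
  [NormedAddCommGroup W] [SecondCountableTopology W] [MeasurableSpace W] [BorelSpace W]

/-- The needle variation estimate behind the maximum principle. -/
theorem needle_variation
    {f : E → W → E} {l : E → W → ℝ} {V : E → ℝ} {gV x₀ : E} {gH : E → W → E → E} {S : Set W}
    {R C T : ℝ}
    (hfc : Continuous (Function.uncurry f)) (hlc : Continuous (Function.uncurry l))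
    (hgc : Continuous fun p : E × W × E => gH p.1 p.2.1 p.2.2)
    (hfb : ∀ x v, ‖x‖ ≤ R → v ∈ S → ‖f x v‖ ≤ C)
    (hfl : ∀ x y v, ‖x‖ ≤ R → ‖y‖ ≤ R → v ∈ S → ‖f x v - f y v‖ ≤ C * ‖x - y‖)
    (hlb : ∀ x v, ‖x‖ ≤ R → v ∈ S → ‖l x v‖ ≤ C)
    (hgb : ∀ x v w, ‖x‖ ≤ R → v ∈ S → ‖w‖ ≤ R → ‖gH x v w‖ ≤ C)
    (hH : ∀ x y v w, ‖x‖ ≤ R → ‖y‖ ≤ R → v ∈ S → ‖w‖ ≤ R →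
      |(l y v + inner ℝ w (f y v)) - (l x v + inner ℝ w (f x v)) - inner ℝ (gH x v w) (y - x)|
        ≤ C * ‖y - x‖ ^ 2)
    (hT : 0 < T) (hCT : C * T ≤ 1 / 2)
    {u : ℝ → W} {x lam : ℝ → E} (hu : Measurable u) (huS : ∀ s ∈ Icc 0 T, u s ∈ S)
    (hx : SolvesForward T (fun s y => f y (u s)) x₀ x) (hxR : ∀ s ∈ Icc 0 T, ‖x s‖ ≤ R)
    (hV : ∀ y, ‖y‖ ≤ R → |V y - V (x T) - inner ℝ gV (y - x T)| ≤ C * ‖y - x T‖ ^ 2)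
    (hlam : SolvesBackward T (fun s y => gH (x s) (u s) y) gV lam)
    (hlamR : ∀ s ∈ Icc 0 T, ‖lam s‖ ≤ R)
    (hopt : ∀ v, Measurable v → (∀ s ∈ Icc 0 T, v s ∈ S) →
      ∃ y, SolvesForward T (fun s y => f y (v s)) x₀ y ∧ (∀ s ∈ Icc 0 T, ‖y s‖ ≤ R) ∧
        V (x T) + ∫ s in (0 : ℝ)..T, l (x s) (u s) ≤ V (y T) + ∫ s in (0 : ℝ)..T, l (y s) (v s))
    {w : W} (hw : w ∈ S) {t t' : ℝ} (ht : 0 ≤ t) (htt : t ≤ t') (ht' : t' ≤ T) :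
    -((C * (4 * C) ^ 2 * (1 + T) + 8 * C ^ 2) * (t' - t) ^ 2) ≤
      ∫ s in t..t', ((l (x s) w + inner ℝ (lam s) (f (x s) w)) -
        (l (x s) (u s) + inner ℝ (lam s) (f (x s) (u s)))) := by
  classical
  set h := t' - t with hh
  have hh0 : 0 ≤ h := by linarith
  -- The needle: the constant `w` on `(t, t']`, the given input elsewhere.
  set v : ℝ → W := (Ioc t t').piecewise (fun _ => w) u with hv
  have hvm : Measurable v := Measurable.piecewise measurableSet_Ioc measurable_const hu
  have hvS : ∀ s ∈ Icc 0 T, v s ∈ S := by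
    intro s hs
    by_cases hst : s ∈ Ioc t t'
    · simpa [hv, hst] using hw
    · simpa [hv, hst] using huS s hs
  obtain ⟨y, hy, hyR, hcost⟩ := hopt v hvm hvS
  have h0m : (0 : ℝ) ∈ Icc 0 T := ⟨le_rfl, hT.le⟩
  have hTm : T ∈ Icc 0 T := ⟨hT.le, le_rfl⟩
  have hC : 0 ≤ C := (norm_nonneg _).trans (hfb (x 0) (u 0) (hxR 0 h0m) (huS 0 h0m))
  have mx : AEStronglyMeasurable x (volume.restrict (Icc 0 T)) :=
    hx.1.aestronglyMeasurable measurableSet_Icc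
  have my : AEStronglyMeasurable y (volume.restrict (Icc 0 T)) :=
    hy.1.aestronglyMeasurable measurableSet_Icc
  have ml : AEStronglyMeasurable lam (volume.restrict (Icc 0 T)) :=
    hlam.1.aestronglyMeasurable measurableSet_Icc
  have mu : AEStronglyMeasurable u (volume.restrict (Icc 0 T)) := hu.aestronglyMeasurable
  have mv : AEStronglyMeasurable v (volume.restrict (Icc 0 T)) := hvm.aestronglyMeasurable
  have mw : AEStronglyMeasurable (fun _ : ℝ => w) (volume.restrict (Icc 0 T)) :=
    aestronglyMeasurable_const
  have ifun : ∀ {z : ℝ → E} {q : ℝ → W}, AEStronglyMeasurable z (volume.restrict (Icc 0 T)) →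
      AEStronglyMeasurable q (volume.restrict (Icc 0 T)) → (∀ s ∈ Icc 0 T, ‖z s‖ ≤ R) →
      (∀ s ∈ Icc 0 T, q s ∈ S) → IntervalIntegrable (fun s => f (z s) (q s)) volume 0 T :=
    fun mz mq hz hq => intervalIntegrable_comp_of_bounded hfc hT.le (mz.prodMk mq)
      (fun s hs => hfb _ _ (hz s hs) (hq s hs))
  have ilun : ∀ {z : ℝ → E} {q : ℝ → W}, AEStronglyMeasurable z (volume.restrict (Icc 0 T)) →
      AEStronglyMeasurable q (volume.restrict (Icc 0 T)) → (∀ s ∈ Icc 0 T, ‖z s‖ ≤ R) →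
      (∀ s ∈ Icc 0 T, q s ∈ S) → IntervalIntegrable (fun s => l (z s) (q s)) volume 0 T :=
    fun mz mq hz hq => intervalIntegrable_comp_of_bounded hlc hT.le (mz.prodMk mq)
      (fun s hs => hlb _ _ (hz s hs) (hq s hs))
  have ihun : ∀ {z : ℝ → E} {q : ℝ → W}, AEStronglyMeasurable z (volume.restrict (Icc 0 T)) →
      AEStronglyMeasurable q (volume.restrict (Icc 0 T)) → (∀ s ∈ Icc 0 T, ‖z s‖ ≤ R) →
      (∀ s ∈ Icc 0 T, q s ∈ S) →
      IntervalIntegrable (fun s => inner ℝ (lam s) (f (z s) (q s))) volume 0 T := by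
    intro z q mz mq hz hq
    refine intervalIntegrable_comp_of_bounded
      (Φ := fun p : E × E × W => inner ℝ p.1 (f p.2.1 p.2.2)) (C := R * C)
      (continuous_fst.inner (hfc.comp continuous_snd)) hT.le (ml.prodMk (mz.prodMk mq))
      (fun s hs => ?_)
    refine (norm_inner_le_norm _ _).trans ?_
    have := hlamR s hs
    have := hfb _ _ (hz s hs) (hq s hs)
    gcongr
    exact (norm_nonneg _).trans (hlamR s hs)
  have cw : ∀ s ∈ Icc (0 : ℝ) T, (fun _ : ℝ => w) s ∈ S := fun s _ => hw
  have ig : IntervalIntegrable (fun s => gH (x s) (u s) (lam s)) volume 0 T :=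
    intervalIntegrable_comp_of_bounded hgc hT.le (mx.prodMk (mu.prodMk ml))
      (fun s hs => hgb _ _ _ (hxR s hs) (huS s hs) (hlamR s hs))
  set e : ℝ → E := fun s => y s - x s with he
  have hec : ContinuousOn e (Icc 0 T) := hy.1.sub hx.1
  have heI : ∀ τ ∈ Icc 0 T, e τ = ∫ s in (0 : ℝ)..τ, (f (y s) (v s) - f (x s) (u s)) := by
    intro τ hτ
    have hsub : uIcc 0 τ ⊆ uIcc 0 T := by
      rw [uIcc_of_le hT.le]; exact uIcc_subset_Icc h0m hτ
    simp only [he]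
    rw [hy.2 τ hτ, hx.2 τ hτ, add_sub_add_left_eq_sub, intervalIntegral.integral_sub
      ((ifun my mv hyR hvS).mono_set hsub) ((ifun mx mu hxR huS).mono_set hsub)]
  have iα := (ifun my mv hyR hvS).sub (ifun mx mu hxR huS)
  -- the variation of the trajectory is of the order of the length of the needle
  have heB : ∀ τ ∈ Icc 0 T, ‖e τ‖ ≤ 4 * C * h := by
    set A := Linf T e with hA
    have hA0 : 0 ≤ A := Linf_nonneg e
    have hind : ∫ s in (0 : ℝ)..T, (Ioc t t').indicator (fun _ => 2 * C) s = 2 * C * h := by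
      rw [integral_indicator_Ioc ht htt ht', intervalIntegral.integral_const, smul_eq_mul]
      ring
    have iind : IntervalIntegrable ((Ioc t t').indicator (fun _ => 2 * C)) volume 0 T :=
      intervalIntegrable_indicator_Ioc hT.le (by simp)
    have hpt : ∀ s ∈ Icc 0 T, ‖f (y s) (v s) - f (x s) (u s)‖ ≤
        C * A + (Ioc t t').indicator (fun _ => 2 * C) s := by
      intro s hs
      have h1 : ‖f (y s) (v s) - f (x s) (v s)‖ ≤ C * A :=
        (hfl _ _ _ (hyR s hs) (hxR s hs) (hvS s hs)).trans
          (mul_le_mul_of_nonneg_left (norm_le_Linf hec hs) hC)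
      by_cases hst : s ∈ Ioc t t'
      · rw [indicator_of_mem hst]
        have h2 := hfb _ _ (hxR s hs) (hvS s hs)
        have h3 := hfb _ _ (hxR s hs) (huS s hs)
        have := norm_sub_le_norm_sub_add_norm_sub (f (y s) (v s)) (f (x s) (v s)) (f (x s) (u s))
        have := norm_sub_le (f (x s) (v s)) (f (x s) (u s))
        linarith
      · rw [indicator_of_notMem hst, add_zero]
        simpa [hv, hst] using h1
    have hb : ∀ τ ∈ Icc 0 T, ‖e τ‖ ≤ C * A * T + 2 * C * h := by
      intro τ hτ
      rw [heI τ hτ]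
      refine (intervalIntegral.norm_integral_le_integral_norm hτ.1).trans ?_
      calc _ ≤ ∫ s in (0 : ℝ)..T, ‖f (y s) (v s) - f (x s) (u s)‖ :=
            intervalIntegral.integral_mono_interval le_rfl hτ.1 hτ.2
              (Eventually.of_forall fun s => norm_nonneg _) iα.norm
        _ ≤ ∫ s in (0 : ℝ)..T, (C * A + (Ioc t t').indicator (fun _ => 2 * C) s) :=
            intervalIntegral.integral_mono_on hT.le iα.norm (by
              exact (by simp : IntervalIntegrable (fun _ => C * A) volume 0 T).add iind) hpt
        _ = _ := by
            rw [intervalIntegral.integral_add (by simp) iind, hind,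
              intervalIntegral.integral_const, smul_eq_mul]
            ring
    have hAle : A ≤ C * A * T + 2 * C * h := Linf_le hT.le hb
    -- Since `C * T ≤ 1/2`, half of `A` is absorbed, which gives the constant `4 * C`.
    have h5 : C * A * T ≤ 1 / 2 * A := by nlinarith
    intro τ hτ
    have := norm_le_Linf hec hτ
    linarith
  -- the cost difference
  have hprod := inner_primitive_eq_integral hT.le gV (K := 2 * C) iα ig
    (fun s hs => by
      have := hfb _ _ (hyR s hs) (hvS s hs)
      have := hfb _ _ (hxR s hs) (huS s hs)
      have := norm_sub_le (f (y s) (v s)) (f (x s) (u s))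
      linarith)
    (fun s hs => by
      have := hgb _ _ _ (hxR s hs) (huS s hs) (hlamR s hs)
      linarith)
  rw [← heI T hTm] at hprod
  have hprod' : inner ℝ gV (e T) = ∫ s in (0 : ℝ)..T,
      (inner ℝ (lam s) (f (y s) (v s) - f (x s) (u s)) - inner ℝ (gH (x s) (u s) (lam s)) (e s)) := by
    rw [hprod]
    refine intervalIntegral.integral_congr fun s hs => ?_
    rw [uIcc_of_le hT.le] at hs
    rw [← hlam.2 s hs, ← heI s hs]
  have ihe : IntervalIntegrable (fun s => inner ℝ (gH (x s) (u s) (lam s)) (e s)) volume 0 T := by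
    refine intervalIntegrable_comp_of_bounded
      (Φ := fun p : (E × W × E) × E => inner ℝ (gH p.1.1 p.1.2.1 p.1.2.2) p.2)
      (C := C * (4 * C * h)) ((hgc.comp continuous_fst).inner continuous_snd) hT.le
      ((mx.prodMk (mu.prodMk ml)).prodMk (my.sub mx)) (fun s hs => ?_)
    refine (norm_inner_le_norm _ _).trans ?_
    exact mul_le_mul (hgb _ _ _ (hxR s hs) (huS s hs) (hlamR s hs)) (heB s hs) (norm_nonneg _) hC
  have iHw : IntervalIntegrable (fun s => (l (x s) w + inner ℝ (lam s) (f (x s) w)) -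
        (l (x s) (u s) + inner ℝ (lam s) (f (x s) (u s)))) volume 0 T :=
    ((ilun mx mw hxR cw).add (ihun mx mw hxR cw)).sub
      ((ilun mx mu hxR huS).add (ihun mx mu hxR huS))
  set B := C * (4 * C * h) ^ 2 with hB
  have hpt : ∀ s ∈ Icc 0 T, (l (y s) (v s) + inner ℝ (lam s) (f (y s) (v s))) -
      (l (x s) (u s) + inner ℝ (lam s) (f (x s) (u s))) - inner ℝ (gH (x s) (u s) (lam s)) (e s) ≤
      B + (Ioc t t').indicator (fun s => ((l (x s) w + inner ℝ (lam s) (f (x s) w)) -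
        (l (x s) (u s) + inner ℝ (lam s) (f (x s) (u s)))) + 8 * C ^ 2 * h) s := by
    intro s hs
    have h1 := (abs_le.1 (hH _ _ _ _ (hxR s hs) (hyR s hs) (hvS s hs) (hlamR s hs))).2
    have h2 : C * ‖y s - x s‖ ^ 2 ≤ B := by
      have := heB s hs
      simp only [hB]
      gcongr
    -- Off the needle this is the Taylor estimate. On it, Taylor produces the gradient at `w` while
    -- the adjoint equation has the one at `u s`; each gradient term is at most `C * (4 * C * h)`,
    -- together `8 * C ^ 2 * h`.
    by_cases hst : s ∈ Ioc t t'
    · rw [indicator_of_mem hst]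
      have hvs : v s = w := by simp [hv, hst]
      rw [hvs] at h1 ⊢
      have h3 : inner ℝ (gH (x s) w (lam s)) (y s - x s) ≤ C * (4 * C * h) :=
        (real_inner_le_norm _ _).trans (mul_le_mul (hgb _ _ _ (hxR s hs) hw (hlamR s hs))
          (heB s hs) (norm_nonneg _) hC)
      have h4 : -inner ℝ (gH (x s) (u s) (lam s)) (e s) ≤ C * (4 * C * h) :=
        (neg_le_abs _).trans ((abs_real_inner_le_norm _ _).trans
          (mul_le_mul (hgb _ _ _ (hxR s hs) (huS s hs) (hlamR s hs))
          (heB s hs) (norm_nonneg _) hC))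
      nlinarith
    · rw [indicator_of_notMem hst]
      have hvs : v s = u s := by simp [hv, hst]
      rw [hvs] at h1 ⊢
      simp only [he]
      linarith
  have iL : IntervalIntegrable (fun s => (l (y s) (v s) + inner ℝ (lam s) (f (y s) (v s))) -
      (l (x s) (u s) + inner ℝ (lam s) (f (x s) (u s))) -
      inner ℝ (gH (x s) (u s) (lam s)) (e s)) volume 0 T :=
    (((ilun my mv hyR hvS).add (ihun my mv hyR hvS)).sub
      ((ilun mx mu hxR huS).add (ihun mx mu hxR huS))).sub ihe
  have iHw' : IntervalIntegrable (fun s => ((l (x s) w + inner ℝ (lam s) (f (x s) w)) -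
        (l (x s) (u s) + inner ℝ (lam s) (f (x s) (u s)))) + 8 * C ^ 2 * h) volume 0 T :=
    iHw.add (by simp)
  have hint : ∫ s in (0 : ℝ)..T, ((l (y s) (v s) + inner ℝ (lam s) (f (y s) (v s))) -
      (l (x s) (u s) + inner ℝ (lam s) (f (x s) (u s))) -
      inner ℝ (gH (x s) (u s) (lam s)) (e s)) ≤ B * T + ((∫ s in t..t',
        ((l (x s) w + inner ℝ (lam s) (f (x s) w)) -
        (l (x s) (u s) + inner ℝ (lam s) (f (x s) (u s))))) + 8 * C ^ 2 * h ^ 2) := by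
    have hsub : uIcc t t' ⊆ uIcc 0 T := by
      rw [uIcc_of_le hT.le, uIcc_of_le htt]; exact Icc_subset_Icc ht ht'
    refine (intervalIntegral.integral_mono_on hT.le iL (by
      exact (by simp : IntervalIntegrable (fun _ => B) volume 0 T).add
        (intervalIntegrable_indicator_Ioc hT.le iHw')) hpt).trans_eq ?_
    rw [intervalIntegral.integral_add (by simp) (intervalIntegrable_indicator_Ioc hT.le iHw'),
      integral_indicator_Ioc ht htt ht', intervalIntegral.integral_add (iHw.mono_set hsub) (by simp),
      intervalIntegral.integral_const, intervalIntegral.integral_const, smul_eq_mul, smul_eq_mul,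
      ← hh]
    ring
  have hsplit : ∫ s in (0 : ℝ)..T, ((l (y s) (v s) + inner ℝ (lam s) (f (y s) (v s))) -
      (l (x s) (u s) + inner ℝ (lam s) (f (x s) (u s))) -
      inner ℝ (gH (x s) (u s) (lam s)) (e s)) =
      (∫ s in (0 : ℝ)..T, l (y s) (v s)) - (∫ s in (0 : ℝ)..T, l (x s) (u s)) +
        inner ℝ gV (e T) := by
    rw [hprod', ← intervalIntegral.integral_sub (ilun my mv hyR hvS) (ilun mx mu hxR huS),
      ← intervalIntegral.integral_add ((ilun my mv hyR hvS).sub (ilun mx mu hxR huS))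
        (by
          simp_rw [inner_sub_right]
          exact ((ihun my mv hyR hvS).sub (ihun mx mu hxR huS)).sub ihe)]
    refine intervalIntegral.integral_congr fun s _ => ?_
    simp only [inner_sub_right]
    ring
  have hVe := (abs_le.1 (hV (y T) (hyR T hTm))).2
  have hVB : C * ‖y T - x T‖ ^ 2 ≤ B := by
    have := heB T hTm
    simp only [hB]
    gcongr
  have hBe : B = C * (4 * C) ^ 2 * h ^ 2 := by simp only [hB]; ring
  have heT : e T = y T - x T := rfl
  rw [hsplit, heT] at hint
  rw [hBe] at hint hVB
  nlinarith

/-- Maximum principle for a problem with free terminal state, on a horizon that is short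
relative to the Lipschitz constants. -/
theorem hamiltonian_le_of_optimal
    {f : E → W → E} {l : E → W → ℝ} {V : E → ℝ} {gV x₀ : E} {gH : E → W → E → E} {S : Set W}
    {R C T : ℝ}
    (hfc : Continuous (Function.uncurry f)) (hlc : Continuous (Function.uncurry l))
    (hgc : Continuous fun p : E × W × E => gH p.1 p.2.1 p.2.2)
    (hfb : ∀ x v, ‖x‖ ≤ R → v ∈ S → ‖f x v‖ ≤ C)
    (hfl : ∀ x y v, ‖x‖ ≤ R → ‖y‖ ≤ R → v ∈ S → ‖f x v - f y v‖ ≤ C * ‖x - y‖)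
    (hlb : ∀ x v, ‖x‖ ≤ R → v ∈ S → ‖l x v‖ ≤ C)
    (hgb : ∀ x v w, ‖x‖ ≤ R → v ∈ S → ‖w‖ ≤ R → ‖gH x v w‖ ≤ C)
    (hH : ∀ x y v w, ‖x‖ ≤ R → ‖y‖ ≤ R → v ∈ S → ‖w‖ ≤ R →
      |(l y v + inner ℝ w (f y v)) - (l x v + inner ℝ w (f x v)) - inner ℝ (gH x v w) (y - x)|
        ≤ C * ‖y - x‖ ^ 2)
    (hT : 0 < T) (hCT : C * T ≤ 1 / 2)
    {u : ℝ → W} {x lam : ℝ → E} (hu : Measurable u) (huS : ∀ s ∈ Icc 0 T, u s ∈ S)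
    (hx : SolvesForward T (fun s y => f y (u s)) x₀ x) (hxR : ∀ s ∈ Icc 0 T, ‖x s‖ ≤ R)
    (hV : ∀ y, ‖y‖ ≤ R → |V y - V (x T) - inner ℝ gV (y - x T)| ≤ C * ‖y - x T‖ ^ 2)
    (hlam : SolvesBackward T (fun s y => gH (x s) (u s) y) gV lam)
    (hlamR : ∀ s ∈ Icc 0 T, ‖lam s‖ ≤ R)
    (hopt : ∀ v, Measurable v → (∀ s ∈ Icc 0 T, v s ∈ S) →
      ∃ y, SolvesForward T (fun s y => f y (v s)) x₀ y ∧ (∀ s ∈ Icc 0 T, ‖y s‖ ≤ R) ∧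
        V (x T) + ∫ s in (0 : ℝ)..T, l (x s) (u s) ≤ V (y T) + ∫ s in (0 : ℝ)..T, l (y s) (v s)) :
    ∀ᵐ s, s ∈ Icc 0 T → ∀ w ∈ S, l (x s) (u s) + inner ℝ (lam s) (f (x s) (u s)) ≤
      l (x s) w + inner ℝ (lam s) (f (x s) w) := by
  have h0m : (0 : ℝ) ∈ Icc 0 T := ⟨le_rfl, hT.le⟩
  have hR : 0 ≤ R := (norm_nonneg _).trans (hxR 0 h0m)
  have mx : AEStronglyMeasurable x (volume.restrict (Icc 0 T)) :=
    hx.1.aestronglyMeasurable measurableSet_Icc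
  have ml : AEStronglyMeasurable lam (volume.restrict (Icc 0 T)) :=
    hlam.1.aestronglyMeasurable measurableSet_Icc
  have hHc : Continuous fun p : E × W × E => l p.1 p.2.1 + inner ℝ p.2.2 (f p.1 p.2.1) := by
    have h1 : Continuous fun p : E × W × E => (p.1, p.2.1) := by fun_prop
    exact (hlc.comp h1).add ((continuous_snd.comp continuous_snd).inner (hfc.comp h1))
  have iH : ∀ q : ℝ → W, Measurable q → (∀ s ∈ Icc 0 T, q s ∈ S) →
      IntervalIntegrable (fun s => l (x s) (q s) + inner ℝ (lam s) (f (x s) (q s))) volume 0 T := by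
    intro q hq hqS
    refine intervalIntegrable_comp_of_bounded hHc (C := C + R * C) hT.le
      (mx.prodMk (hq.aestronglyMeasurable.prodMk ml)) fun s hs => ?_
    refine (norm_add_le _ _).trans (add_le_add (hlb _ _ (hxR s hs) (hqS s hs))
      ((norm_inner_le_norm _ _).trans ?_))
    exact mul_le_mul (hlamR s hs) (hfb _ _ (hxR s hs) (hqS s hs)) (norm_nonneg _) hR
  have hone : ∀ w ∈ S, ∀ᵐ s, s ∈ Icc 0 T → 0 ≤ (l (x s) w + inner ℝ (lam s) (f (x s) w)) -
      (l (x s) (u s) + inner ℝ (lam s) (f (x s) (u s))) := fun w hw =>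
    ae_nonneg_of_integral_ge hT.le ((iH (fun _ => w) measurable_const fun _ _ => hw).sub
      (iH u hu huS)) fun t t' ht htt ht' => needle_variation hfc hlc hgc hfb hfl hlb hgb hH hT hCT
        hu huS hx hxR hV hlam hlamR hopt hw ht htt ht'
  -- The exceptional null set depends on `w`. A countable dense set of values permits a common one,
  -- and continuity in `w` covers the rest.
  obtain ⟨D, hDc, hDd⟩ := TopologicalSpace.exists_countable_dense S
  have hall : ∀ᵐ s, ∀ w ∈ D, s ∈ Icc 0 T →
      0 ≤ (l (x s) w + inner ℝ (lam s) (f (x s) w)) -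
      (l (x s) (u s) + inner ℝ (lam s) (f (x s) (u s))) :=
    (ae_ball_iff hDc).2 fun w _ => hone w w.2
  filter_upwards [hall] with s hs hsI w hw
  have hcl : IsClosed {w : S | l (x s) (u s) + inner ℝ (lam s) (f (x s) (u s)) ≤
      l (x s) w + inner ℝ (lam s) (f (x s) w)} := by
    refine isClosed_le continuous_const ?_
    exact hHc.comp (g := fun p : E × W × E => l p.1 p.2.1 + inner ℝ p.2.2 (f p.1 p.2.1))
      (f := fun w : S => (x s, (w : W), lam s)) (by fun_prop)
  have hsub : D ⊆ {w : S | l (x s) (u s) + inner ℝ (lam s) (f (x s) (u s)) ≤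
      l (x s) w + inner ℝ (lam s) (f (x s) w)} := fun w hwD => by
    have := hs w hwD hsI
    simp only [mem_ofPred_eq]
    linarith
  have := hcl.closure_subset_iff.2 hsub
  rw [hDd.closure_eq] at this
  exact this (mem_univ (⟨w, hw⟩ : S))

end Pontryagin

/-! ### Calculus of gradients. -/

section Gradient

variable {E : Type*} [NormedAddCommGroup E] [InnerProductSpace ℝ E] [CompleteSpace E]

theorem HasGradientAt.add_gradient {φ ψ : E → ℝ} {g h x : E} (hφ : HasGradientAt φ g x)
    (hψ : HasGradientAt ψ h x) : HasGradientAt (fun z => φ z + ψ z) (g + h) x := by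
  rw [hasGradientAt_iff_hasFDerivAt, map_add]
  exact hφ.hasFDerivAt.add hψ.hasFDerivAt

theorem HasGradientAt.sum_gradient {ι : Type*} {s : Finset ι} {φ : ι → E → ℝ} {g : ι → E} {x : E}
    (h : ∀ i ∈ s, HasGradientAt (φ i) (g i) x) :
    HasGradientAt (fun z => ∑ i ∈ s, φ i z) (∑ i ∈ s, g i) x := by
  rw [hasGradientAt_iff_hasFDerivAt, map_sum]
  exact HasFDerivAt.fun_sum fun i hi => (h i hi).hasFDerivAt

theorem hasGradientAt_inner_sub (c z x : E) : HasGradientAt (fun y => inner ℝ c (y - z)) c x := by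
  rw [hasGradientAt_iff_hasFDerivAt]
  exact ((InnerProductSpace.toDual ℝ E c).hasFDerivAt).comp x ((hasFDerivAt_id x).sub_const z)

theorem contDiff_gradient {A : Type*} [NormedAddCommGroup A] [NormedSpace ℝ A] {h : A → E → ℝ}
    {g : A → E} (hh : ContDiff ℝ 2 (Function.uncurry h)) (hg : ContDiff ℝ 1 g) :
    ContDiff ℝ 1 fun a => gradient (h a) (g a) := by
  have : ContDiff ℝ 1 fun a => fderiv ℝ (h a) (g a) :=
    hh.fderiv hg (by norm_num)
  exact (InnerProductSpace.toDual ℝ E).symm.contDiff.comp this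

/-- The derivative of a function of two variables in terms of its partial gradients. -/
theorem HasFDerivAt.of_partial_gradients {E' : Type*} [NormedAddCommGroup E']
    [InnerProductSpace ℝ E'] [CompleteSpace E'] {A : Type*} [NormedAddCommGroup A]
    [NormedSpace ℝ A] {c : E → E' → ℝ} (hc : Differentiable ℝ (Function.uncurry c))
    (p : A →L[ℝ] E) (q : A →L[ℝ] E') (x : A) :
    HasFDerivAt (fun z => c (p z) (q z))
      ((innerSL ℝ (gradient (fun a => c a (q x)) (p x))).comp p +
        (innerSL ℝ (gradient (fun b => c (p x) b) (q x))).comp q) x := by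
  have hD := (hc (p x, q x)).hasFDerivAt
  set D := fderiv ℝ (Function.uncurry c) (p x, q x)
  have h1 : HasGradientAt (fun a => c a (q x))
      ((InnerProductSpace.toDual ℝ E).symm (D.comp (ContinuousLinearMap.inl ℝ E E'))) (p x) := by
    rw [hasGradientAt_iff_hasFDerivAt, LinearIsometryEquiv.apply_symm_apply]
    exact HasFDerivAt.comp (f := fun e => (e, q x)) (p x) hD (hasFDerivAt_prodMk_left (p x) (q x))
  have h2 : HasGradientAt (fun b => c (p x) b)
      ((InnerProductSpace.toDual ℝ E').symm (D.comp (ContinuousLinearMap.inr ℝ E E'))) (q x) := by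
    rw [hasGradientAt_iff_hasFDerivAt, LinearIsometryEquiv.apply_symm_apply]
    exact HasFDerivAt.comp (f := fun e => (p x, e)) (q x) hD (hasFDerivAt_prodMk_right (p x) (q x))
  rw [h1.gradient, h2.gradient]
  have h3 := hD.comp x (p.hasFDerivAt.prodMk q.hasFDerivAt)
  refine h3.congr_fderiv ?_
  ext z
  simp only [ContinuousLinearMap.comp_apply, add_apply, innerSL_apply_apply,
    InnerProductSpace.toDual_symm_apply, ContinuousLinearMap.inl_apply,
    ContinuousLinearMap.inr_apply, ContinuousLinearMap.prod_apply]
  rw [← map_add]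
  simp

end Gradient

/-! ### Stacked and componentwise integral equations. -/

section Stack

variable {ι : Type*} [Fintype ι] {A : ι → Type*} [∀ i, NormedAddCommGroup (A i)]
  [∀ i, NormedSpace ℝ (A i)] [∀ i, CompleteSpace (A i)] {T : ℝ}

theorem PiLp.intervalIntegral_apply {F : ℝ → PiLp 2 A} {a b : ℝ}
    (hF : IntervalIntegrable F volume a b) (i : ι) :
    (∫ s in a..b, F s) i = ∫ s in a..b, F s i :=
  ((PiLp.proj (𝕜 := ℝ) 2 A i).intervalIntegral_comp_comm hF).symm

/-- Projections commute with the Bochner integral only for integrable integrands, whence `hI`. It is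
asked for continuous `x` only, since continuity is available on either side of the equivalence. -/
theorem solvesForward_piLp_iff {F : ℝ → PiLp 2 A → PiLp 2 A}
    {Fi : (i : ι) → ℝ → A i → A i} {x₀ : PiLp 2 A} {x : ℝ → PiLp 2 A} (hT : 0 ≤ T)
    (hF : ∀ s i, F s (x s) i = Fi i s (x s i))
    (hI : ContinuousOn x (Icc 0 T) → IntervalIntegrable (fun s => F s (x s)) volume 0 T) :
    SolvesForward T F x₀ x ↔ ∀ i, SolvesForward T (Fi i) (x₀ i) (fun τ => x τ i) := by
  have hsub : ∀ τ ∈ Icc 0 T, uIcc 0 τ ⊆ uIcc 0 T := fun τ hτ => by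
    rw [uIcc_of_le hT]; exact uIcc_subset_Icc ⟨le_rfl, hT⟩ hτ
  constructor
  · intro h i
    refine ⟨(PiLp.continuous_apply 2 A i).comp_continuousOn h.1, fun τ hτ => ?_⟩
    show x τ i = _
    rw [h.2 τ hτ, PiLp.add_apply, PiLp.intervalIntegral_apply ((hI h.1).mono_set (hsub τ hτ))]
    simp only [hF]
  · intro h
    have hc : ContinuousOn x (Icc 0 T) := by
      have : ContinuousOn (fun τ i => x τ i) (Icc 0 T) := continuousOn_pi.2 fun i => (h i).1
      exact (PiLp.continuous_toLp 2 A).comp_continuousOn this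
    refine ⟨hc, fun τ hτ => ?_⟩
    ext1 i
    rw [PiLp.add_apply, PiLp.intervalIntegral_apply ((hI hc).mono_set (hsub τ hτ))]
    simp only [hF]
    exact (h i).2 τ hτ

theorem solvesBackward_piLp_iff {G : ℝ → PiLp 2 A → PiLp 2 A}
    {Gi : (i : ι) → ℝ → A i → A i} {yT : PiLp 2 A} {y : ℝ → PiLp 2 A} (hT : 0 ≤ T)
    (hG : ∀ s i, G s (y s) i = Gi i s (y s i))
    (hI : ContinuousOn y (Icc 0 T) → IntervalIntegrable (fun s => G s (y s)) volume 0 T) :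
    SolvesBackward T G yT y ↔ ∀ i, SolvesBackward T (Gi i) (yT i) (fun τ => y τ i) := by
  have hsub : ∀ τ ∈ Icc 0 T, uIcc τ T ⊆ uIcc 0 T := fun τ hτ => by
    rw [uIcc_of_le hT]; exact uIcc_subset_Icc hτ ⟨hT, le_rfl⟩
  constructor
  · intro h i
    refine ⟨(PiLp.continuous_apply 2 A i).comp_continuousOn h.1, fun τ hτ => ?_⟩
    show y τ i = _
    rw [h.2 τ hτ, PiLp.add_apply, PiLp.intervalIntegral_apply ((hI h.1).mono_set (hsub τ hτ))]
    simp only [hG]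
  · intro h
    have hc : ContinuousOn y (Icc 0 T) := by
      have : ContinuousOn (fun τ i => y τ i) (Icc 0 T) := continuousOn_pi.2 fun i => (h i).1
      exact (PiLp.continuous_toLp 2 A).comp_continuousOn this
    refine ⟨hc, fun τ hτ => ?_⟩
    ext1 i
    rw [PiLp.add_apply, PiLp.intervalIntegral_apply ((hI hc).mono_set (hsub τ hτ))]
    simp only [hG]
    exact (h i).2 τ hτ

end Stack

/-! ### Smoothness of the stacked data and the splitting of the central Hamiltonian gradient. -/

namespace AgentNetwork

variable {N : ℕ} (P : AgentNetwork N)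

/-- The product of the input constraint sets. -/
def inputSet : Set P.Input := {u | ∀ i, u i ∈ P.U i}

/-- Stacked right-hand sides of the local dynamics, with the neighbors' states taken from `z`. -/
def stackF (x : P.State) (u : P.Input) (z : P.State) : P.State :=
  WithLp.toLp 2 fun i => P.fAgent i (x i) (u i) z

/-- Stacked state gradients of the local Hamiltonians, for the previous iterate `(z, w)`. -/
def stackG (x : P.State) (u : P.Input) (y z w : P.State) : P.State :=
  WithLp.toLp 2 fun i => gradient (fun a => P.localH i a (u i) (y i) z w) (x i)

/-- This duality turns derivatives of the neighbors' couplings into the sensitivity terms of an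
agent. -/
theorem mem_receiving {i j : Fin N} : j ∈ P.receiving i ↔ i ∈ P.sending j := by
  simp [receiving, sending]

variable {P} {ml Ml mV MV : ℝ} (hP : P.IsRegular ml Ml mV MV)
include hP

theorem IsRegular.contDiff_stackF :
    ContDiff ℝ 2 fun p : P.State × P.Input × P.State => P.stackF p.1 p.2.1 p.2.2 := by
  refine contDiff_piLp' 2 fun i => ?_
  refine ContDiff.add ?_ (ContDiff.sum fun j hj => ?_)
  · exact (hP.fLoc_smooth i).comp (f := fun p : P.State × P.Input × P.State => (p.1 i, p.2.1 i))
      (by fun_prop)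
  · exact (hP.fCpl_smooth i j hj).comp
      (f := fun p : P.State × P.Input × P.State => (p.1 i, p.2.2 j)) (by fun_prop)

theorem IsRegular.contDiff_l : ContDiff ℝ 2 fun p : P.State × P.Input => P.l p.1 p.2 := by
  refine ContDiff.sum fun i _ => ?_
  refine ContDiff.add ?_ (ContDiff.sum fun j hj => ?_)
  · exact (hP.lLoc_smooth i).comp (f := fun p : P.State × P.Input => (p.1 i, p.2 i))
      (by fun_prop)
  · exact (hP.lCpl_smooth i j hj).comp
      (f := fun p : P.State × P.Input => (p.1 i, p.1 j)) (by fun_prop)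

theorem IsRegular.contDiff_V : ContDiff ℝ 2 P.V := by
  refine ContDiff.sum fun i _ => ?_
  exact (hP.VLoc_smooth i).comp (f := fun x : P.State => x i) (by fun_prop)

theorem IsRegular.contDiff_gradV : ContDiff ℝ 1 (gradient P.V) :=
  contDiff_gradient (h := fun _ : P.State => P.V) (g := fun x => x)
    (hP.contDiff_V.comp contDiff_snd) contDiff_id

theorem IsRegular.gradV_apply (x : P.State) (i : Fin N) :
    gradient P.V x i = gradient (P.VLoc i) (x i) := by
  have : HasGradientAt P.V (WithLp.toLp 2 fun i => gradient (P.VLoc i) (x i) : P.State) x := by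
    rw [hasGradientAt_iff_hasFDerivAt]
    have h1 : HasFDerivAt P.V (∑ i, (innerSL ℝ (gradient (P.VLoc i) (x i))).comp
        (PiLp.proj (𝕜 := ℝ) 2 P.AState i)) x := by
      refine HasFDerivAt.fun_sum fun i _ => ?_
      have hd : DifferentiableAt ℝ (P.VLoc i) (x i) :=
        (hP.VLoc_smooth i).differentiable two_ne_zero _
      exact hd.hasGradientAt.hasFDerivAt.comp x (PiLp.proj (𝕜 := ℝ) 2 P.AState i).hasFDerivAt
    refine h1.congr_fderiv ?_
    ext z
    simp [PiLp.inner_apply]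
  rw [this.gradient]

/-- The coupling part of the Hamiltonian for the pair `(i, j)`. -/
theorem IsRegular.contDiff_coupling {i j : Fin N} (hj : j ∈ P.sending i) :
    ContDiff ℝ 2 fun p : P.AState i × P.AState i × P.AState j =>
      P.lCpl i j p.2.1 p.2.2 + inner ℝ p.1 (P.fCpl i j p.2.1 p.2.2) := by
  have h1 : ContDiff ℝ 2 fun p : P.AState i × P.AState i × P.AState j => (p.2.1, p.2.2) := by
    fun_prop
  exact ((hP.lCpl_smooth i j hj).comp h1).add
    (contDiff_fst.inner ℝ ((hP.fCpl_smooth i j hj).comp h1))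

theorem IsRegular.contDiff_local (i : Fin N) :
    ContDiff ℝ 2 fun p : P.AState i × P.AState i × P.AInput i =>
      P.lLoc i p.2.1 p.2.2 + inner ℝ p.1 (P.fLoc i p.2.1 p.2.2) := by
  have h1 : ContDiff ℝ 2 fun p : P.AState i × P.AState i × P.AInput i => (p.2.1, p.2.2) := by
    fun_prop
  exact ((hP.lLoc_smooth i).comp h1).add
    (contDiff_fst.inner ℝ ((hP.fLoc_smooth i).comp h1))

/-- Regrouped by local part, couplings and sensitivities, the Hamiltonian is a sum of terms that are
each differentiable in the state; the sensitivity terms are affine in it and contribute constants.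
-/
theorem IsRegular.hasGradientAt_localH (i : Fin N) (x : P.AState i) (u : P.AInput i)
    (y : P.AState i) (z w : P.State) :
    HasGradientAt (fun a => P.localH i a u y z w)
      (gradient (fun a => P.lLoc i a u + inner ℝ y (P.fLoc i a u)) x +
        ∑ j ∈ P.sending i, gradient (fun a => P.lCpl i j a (z j) +
          inner ℝ y (P.fCpl i j a (z j))) x + ∑ j ∈ P.receiving i, P.sens j i z w) x := by
  have h1 : (fun a => P.localH i a u y z w) = fun a =>
      ((P.lLoc i a u + inner ℝ y (P.fLoc i a u)) +
        ∑ j ∈ P.sending i, (P.lCpl i j a (z j) + inner ℝ y (P.fCpl i j a (z j)))) +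
        ∑ j ∈ P.receiving i, inner ℝ (P.sens j i z w) (a - z i) := by
    ext a
    simp only [localH, lAgent, fAgent, sensTerm, inner_add_right, inner_sum,
      Finset.sum_add_distrib]
    ring
  rw [h1]
  refine (HasGradientAt.add_gradient (DifferentiableAt.hasGradientAt ?_)
    (HasGradientAt.sum_gradient fun j hj => DifferentiableAt.hasGradientAt ?_)).add_gradient
    (HasGradientAt.sum_gradient fun j _ => hasGradientAt_inner_sub _ _ _)
  · have := ((hP.contDiff_local i).comp (f := fun a : P.AState i => (y, a, u))
      (by fun_prop)).differentiable two_ne_zero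
    exact this x
  · have := ((hP.contDiff_coupling hj).comp (f := fun a : P.AState i => (y, a, z j))
      (by fun_prop)).differentiable two_ne_zero
    exact this x

theorem IsRegular.contDiff_stackG :
    ContDiff ℝ 1 fun p : P.State × P.Input × P.State × P.State × P.State =>
      P.stackG p.1 p.2.1 p.2.2.1 p.2.2.2.1 p.2.2.2.2 := by
  refine contDiff_piLp' 2 fun i => ?_
  simp only [stackG, (hP.hasGradientAt_localH _ _ _ _ _ _).gradient]
  refine ContDiff.add (ContDiff.add ?_ (ContDiff.sum fun j hj => ?_))
    (ContDiff.sum fun j hj => ?_)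
  · refine contDiff_gradient (h := fun (p : P.State × P.Input × P.State × P.State × P.State) a =>
      P.lLoc i a (p.2.1 i) + inner ℝ (p.2.2.1 i) (P.fLoc i a (p.2.1 i))) ?_ (by fun_prop)
    exact (hP.contDiff_local i).comp
      (f := fun q : (P.State × P.Input × P.State × P.State × P.State) × P.AState i =>
        (q.1.2.2.1 i, q.2, q.1.2.1 i)) (by fun_prop)
  · refine contDiff_gradient (h := fun (p : P.State × P.Input × P.State × P.State × P.State) a =>
      P.lCpl i j a (p.2.2.2.1 j) + inner ℝ (p.2.2.1 i) (P.fCpl i j a (p.2.2.2.1 j))) ?_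
      (by fun_prop)
    exact (hP.contDiff_coupling hj).comp
      (f := fun q : (P.State × P.Input × P.State × P.State × P.State) × P.AState i =>
        (q.1.2.2.1 i, q.2, q.1.2.2.2.1 j)) (by fun_prop)
  · refine contDiff_gradient (h := fun (p : P.State × P.Input × P.State × P.State × P.State) a =>
      P.lCpl j i (p.2.2.2.1 j) a + inner ℝ (p.2.2.2.2 j) (P.fCpl j i (p.2.2.2.1 j) a)) ?_
      (by fun_prop)
    exact (hP.contDiff_coupling (P.mem_receiving.1 hj)).comp
      (f := fun q : (P.State × P.Input × P.State × P.State × P.State) × P.AState i =>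
        (q.1.2.2.2.2 j, q.1.2.2.2.1 j, q.2)) (by fun_prop)

/-- The state gradient of the central Hamiltonian is stacked from the state gradients of the local
Hamiltonians with the previous iterate equal to the current one. -/
theorem IsRegular.hasGradientAt_centralH (x : P.State) (u : P.Input) (y : P.State) :
    HasGradientAt (fun z => P.centralH z u y) (P.stackG x u y x y) x := by
  have h1 : (fun z => P.centralH z u y) = fun z =>
      ∑ i, ((P.lLoc i (z i) (u i) + inner ℝ (y i) (P.fLoc i (z i) (u i))) +
        ∑ j ∈ P.sending i, (P.lCpl i j (z i) (z j) + inner ℝ (y i) (P.fCpl i j (z i) (z j)))) := by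
    ext z
    simp only [centralH, l, f, lAgent, fAgent, PiLp.inner_apply, inner_add_right, inner_sum,
      Finset.sum_add_distrib]
    ring
  rw [h1, hasGradientAt_iff_hasFDerivAt]
  have h2 := HasFDerivAt.fun_sum (u := Finset.univ) (fun i _ => HasFDerivAt.add
    (f := fun z : P.State => P.lLoc i (z i) (u i) + inner ℝ (y i) (P.fLoc i (z i) (u i)))
    (g := fun z : P.State => ∑ j ∈ P.sending i,
      (P.lCpl i j (z i) (z j) + inner ℝ (y i) (P.fCpl i j (z i) (z j))))
    (f' := (innerSL ℝ (gradient (fun a => P.lLoc i a (u i) +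
      inner ℝ (y i) (P.fLoc i a (u i))) (x i))).comp (PiLp.proj (𝕜 := ℝ) 2 P.AState i))
    (g' := ∑ j ∈ P.sending i,
      ((innerSL ℝ (gradient (fun a => P.lCpl i j a (x j) +
        inner ℝ (y i) (P.fCpl i j a (x j))) (x i))).comp (PiLp.proj (𝕜 := ℝ) 2 P.AState i) +
      (innerSL ℝ (P.sens i j x y)).comp (PiLp.proj (𝕜 := ℝ) 2 P.AState j))) (x := x) ?_ ?_)
  · refine h2.congr_fderiv ?_
    ext z
    simp only [stackG, (hP.hasGradientAt_localH _ _ _ _ _ _).gradient]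
    simp only [sum_apply, add_apply,
      ContinuousLinearMap.comp_apply, innerSL_apply_apply, PiLp.proj_apply,
      InnerProductSpace.toDual_apply_apply, PiLp.inner_apply, inner_add_left, sum_inner,
      Finset.sum_add_distrib, add_assoc]
    congr 2
    -- Derivatives in the second coupling argument are listed under the influenced agent. Exchanging
    -- the sums lists them under the agent whose state varies, as its sensitivities.
    refine Finset.sum_comm' fun i j => ?_
    simp [P.mem_receiving]
  · have hd : DifferentiableAt ℝ (fun a => P.lLoc i a (u i) + inner ℝ (y i) (P.fLoc i a (u i)))
        (x i) := ((hP.contDiff_local i).comp (f := fun a : P.AState i => (y i, a, u i))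
      (by fun_prop)).differentiable two_ne_zero _
    exact hd.hasGradientAt.hasFDerivAt.comp x (PiLp.proj (𝕜 := ℝ) 2 P.AState i).hasFDerivAt
  · refine HasFDerivAt.fun_sum fun j hj => ?_
    have hd : Differentiable ℝ (Function.uncurry fun a b => P.lCpl i j a b +
        inner ℝ (y i) (P.fCpl i j a b)) :=
      ((hP.contDiff_coupling hj).comp (f := fun q : P.AState i × P.AState j => (y i, q.1, q.2))
      (by fun_prop)).differentiable two_ne_zero
    exact HasFDerivAt.of_partial_gradients hd (PiLp.proj (𝕜 := ℝ) 2 P.AState i)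
      (PiLp.proj (𝕜 := ℝ) 2 P.AState j) x

end AgentNetwork

theorem intervalIntegrable_comp {A B : Type*} [NormedAddCommGroup A] [ProperSpace A]
    [NormedAddCommGroup B] {Φ : A → B} (hΦ : Continuous Φ) {T : ℝ} (hT : 0 ≤ T)
    {p : ℝ → A} (hp : AEStronglyMeasurable p (volume.restrict (Icc 0 T))) {R : ℝ}
    (hR : ∀ s ∈ Icc 0 T, ‖p s‖ ≤ R) :
    IntervalIntegrable (fun s => Φ (p s)) volume 0 T := by
  obtain ⟨C, hC⟩ := (isCompact_closedBall (0 : A) R).exists_bound_of_continuousOn hΦ.continuousOn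
  exact intervalIntegrable_comp_of_bounded hΦ hT hp (C := C) fun s hs => hC _ (by simpa using hR s hs)

theorem norm_sq_toLp_prod {A B : Type*} [NormedAddCommGroup A] [NormedAddCommGroup B]
    (a : A) (b : B) : ‖(WithLp.toLp 2 (a, b) : WithLp 2 (A × B))‖ ^ 2 = ‖a‖ ^ 2 + ‖b‖ ^ 2 :=
  WithLp.prod_norm_sq_eq_of_L2 (WithLp.toLp 2 (a, b))

theorem norm_toLp_prod_le {A B : Type*} [NormedAddCommGroup A] [NormedAddCommGroup B]
    (a : A) (b : B) : ‖(WithLp.toLp 2 (a, b) : WithLp 2 (A × B))‖ ≤ ‖a‖ + ‖b‖ := by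
  refine abs_le_of_sq_le_sq' ?_ (by positivity) |>.2
  rw [norm_sq_toLp_prod]
  nlinarith [mul_nonneg (norm_nonneg a) (norm_nonneg b)]

theorem norm_fst_le_toLp_prod {A B : Type*} [NormedAddCommGroup A] [NormedAddCommGroup B]
    (a : A) (b : B) : ‖a‖ ≤ ‖(WithLp.toLp 2 (a, b) : WithLp 2 (A × B))‖ := by
  refine abs_le_of_sq_le_sq' ?_ (by positivity) |>.2
  rw [norm_sq_toLp_prod]
  nlinarith [sq_nonneg ‖b‖]

theorem norm_snd_le_toLp_prod {A B : Type*} [NormedAddCommGroup A] [NormedAddCommGroup B]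
    (a : A) (b : B) : ‖b‖ ≤ ‖(WithLp.toLp 2 (a, b) : WithLp 2 (A × B))‖ := by
  refine abs_le_of_sq_le_sq' ?_ (by positivity) |>.2
  rw [norm_sq_toLp_prod]
  nlinarith [sq_nonneg ‖a‖]

/-! ### The constants and the admissible horizons. -/

namespace AgentNetwork

variable {N : ℕ} (P : AgentNetwork N)

/-- Bounds and Lipschitz constants of the network data on the ball of radius `R`. -/
structure HasConstants (R C : ℝ) : Prop where
  one_le : 1 ≤ C
  input : ∀ v ∈ P.inputSet, ‖v‖ ≤ R
  stackF : BoundedLipschitz R C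
    fun p : P.State × P.Input × P.State => P.stackF p.1 p.2.1 p.2.2
  stackG : BoundedLipschitz R C
    fun p : P.State × P.Input × P.State × P.State × P.State =>
      P.stackG p.1 p.2.1 p.2.2.1 p.2.2.2.1 p.2.2.2.2
  gradV : BoundedLipschitz R C (gradient P.V)
  l : BoundedLipschitz R C fun p : P.State × P.Input => P.l p.1 p.2

/-- The horizon `T` is short relative to the constants `R`, `C` of the network data, the size `ρ`
of the level set, the radii `rx`, `rl` and the Lipschitz constant `L` of the feedback law. -/
structure ShortHorizon (rx rl ρ L R C T : ℝ) : Prop where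
  regular : ∃ ml Ml mV MV, P.IsRegular ml Ml mV MV
  T_pos : 0 < T
  rx_pos : 0 < rx
  rl_pos : 0 < rl
  L_pos : 0 < L
  two_le : 2 ≤ R
  state_lt : ρ + rx + 1 ≤ R
  adjoint_le : ∀ x, ‖x‖ ≤ ρ + rx → ‖gradient P.V x‖ + rl ≤ R
  consts : P.HasConstants R C
  lt_rx : C * T < rx
  lt_rl : C * T < rl
  le_half : C * T ≤ 1 / 2
  le_one : 2 * T * C * (1 + L) ≤ 1
  contraction : T * ((2 * C + 2) * (2 * C * (2 * L + 1)) + 4 * C * (L + 1)) ≤ 1 / 2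

theorem exists_norm_le_of_mem_inputSet {ml Ml mV MV : ℝ} (hP : P.IsRegular ml Ml mV MV) :
    ∃ R, ∀ v ∈ P.inputSet, ‖v‖ ≤ R := by
  have h1 : IsCompact (Set.univ.pi P.U) := isCompact_univ_pi hP.U_compact
  have h2 := h1.image (PiLp.continuous_toLp 2 P.AInput)
  obtain ⟨R, hR⟩ := h2.isBounded.exists_norm_le
  exact ⟨R, fun v hv => hR v ⟨fun i => v i, fun i _ => hv i, rfl⟩⟩

theorem exists_hasConstants {ml Ml mV MV : ℝ} (hP : P.IsRegular ml Ml mV MV) {R : ℝ}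
    (hR : ∀ v ∈ P.inputSet, ‖v‖ ≤ R) : ∃ C, P.HasConstants R C := by
  obtain ⟨C₁, h₁⟩ := (hP.contDiff_stackF.of_le (m := 1) (by norm_num)).exists_boundedLipschitz R
  obtain ⟨C₂, h₂⟩ := hP.contDiff_stackG.exists_boundedLipschitz R
  obtain ⟨C₃, h₃⟩ := hP.contDiff_gradV.exists_boundedLipschitz R
  obtain ⟨C₄, h₄⟩ := (hP.contDiff_l.of_le (m := 1) (by norm_num)).exists_boundedLipschitz R
  refine ⟨max 1 (max (max C₁ C₂) (max C₃ C₄)), le_max_left _ _, hR, h₁.mono ?_, h₂.mono ?_,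
    h₃.mono ?_, h₄.mono ?_⟩ <;> simp

/-- A horizon bound that depends on the network, `rx`, `rl`, `ρ` and `L` only. -/
theorem exists_shortHorizon {ml Ml mV MV : ℝ} (hP : P.IsRegular ml Ml mV MV)
    {rx rl : ℝ} (ρ : ℝ) {L : ℝ} (hrx : 0 < rx) (hrl : 0 < rl) (hL : 0 < L) :
    ∃ R C Tmax : ℝ, 0 < Tmax ∧ ∀ T, 0 < T → T < Tmax → P.ShortHorizon rx rl ρ L R C T := by
  obtain ⟨R₁, h₁⟩ := P.exists_norm_le_of_mem_inputSet hP
  obtain ⟨R₂, h₂⟩ := hP.contDiff_gradV.exists_boundedLipschitz (ρ + rx)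
  -- The radius must contain the neighborhood of the level set with a margin of `1`, the inputs, and
  -- the neighborhood of the values of `∇V`. The `2` leaves room for the terminal phase, which
  -- starts in the unit ball and moves by at most `1`.
  set R := max (max 2 (ρ + rx + 1)) (max R₁ (R₂ + rl)) with hR
  obtain ⟨C, hC⟩ := P.exists_hasConstants hP (R := R) fun v hv =>
    (h₁ v hv).trans (by simp [hR])
  have hC1 := hC.one_le
  set K := (2 * C + 2) * (2 * C * (2 * L + 1)) + 4 * C * (L + 1) with hK
  have hKpos : 0 < K := by positivity
  refine ⟨R, C, min (min (rx / C) (rl / C)) (min (1 / (2 * C)) (min (1 / (2 * C * (1 + L)))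
    (1 / (2 * K)))), by positivity, fun T hT hTm => ?_⟩
  simp only [lt_min_iff] at hTm
  obtain ⟨⟨t1, t2⟩, t3, t4, t5⟩ := hTm
  have hC0 : 0 < C := by linarith
  rw [lt_div_iff₀ (by positivity)] at t1 t2 t3 t4 t5
  exact
    { regular := ⟨_, _, _, _, hP⟩
      T_pos := hT
      rx_pos := hrx
      rl_pos := hrl
      L_pos := hL
      two_le := by simp [hR]
      state_lt := by simp [hR]
      adjoint_le := fun x hx => (add_le_add (h₂.1 x hx) le_rfl).trans (by simp [hR])
      consts := hC
      lt_rx := by linarith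
      lt_rl := by linarith
      le_half := by linarith
      le_one := by linarith
      contraction := by linarith }

/-- Stacked form of the state and adjoint equations of one iteration. -/
structure StackedStep (T : ℝ) (x₀ : P.State) (xb lb : ℝ → P.State) (u : ℝ → P.Input)
    (x lam : ℝ → P.State) : Prop where
  measurable : Measurable u
  mem : ∀ s ∈ Icc 0 T, u s ∈ P.inputSet
  forward : SolvesForward T (fun s y => P.stackF y (u s) (xb s)) x₀ x
  backward : SolvesBackward T (fun s y => P.stackG (x s) (u s) y (xb s) (lb s))
    (gradient P.V (x T)) lam

theorem measurable_iff_components {u : ℝ → P.Input} :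
    Measurable u ↔ ∀ i, Measurable fun τ => u τ i := by
  constructor
  · intro h i
    exact (measurable_pi_apply i).comp ((WithLp.measurable_ofLp 2 _).comp h)
  · intro h
    exact (WithLp.measurable_toLp 2 _).comp (measurable_pi_iff.2 h)

/-! ### Integrability along admissible inputs. -/

section Integrability

variable {P} {ml Ml mV MV : ℝ} (hP : P.IsRegular ml Ml mV MV) {T : ℝ} (hT : 0 ≤ T)
  {u : ℝ → P.Input} (hu : P.Admissible T u) {x xb y lb : ℝ → P.State}
  (hx : ContinuousOn x (Icc 0 T))

include hP hT hu

omit hT in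
theorem Admissible.exists_norm_le : ∃ R, ∀ s ∈ Icc 0 T, ‖u s‖ ≤ R := by
  obtain ⟨R, hR⟩ := P.exists_norm_le_of_mem_inputSet hP
  exact ⟨R, fun s hs => hR _ (hu.2 s hs)⟩

include hx

theorem Admissible.intervalIntegrable_comp {B : Type*} [NormedAddCommGroup B]
    {Φ : P.State × P.Input → B} (hΦ : Continuous Φ) :
    IntervalIntegrable (fun s => Φ (x s, u s)) volume 0 T := by
  obtain ⟨R, hR⟩ := hu.exists_norm_le hP
  refine _root_.intervalIntegrable_comp hΦ hT ((hx.aestronglyMeasurable measurableSet_Icc).prodMk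
    hu.1.aestronglyMeasurable) (R := max (Linf T x) R) fun s hs => ?_
  exact max_le_max (norm_le_Linf hx hs) (hR s hs)

theorem Admissible.intervalIntegrable_f :
    IntervalIntegrable (fun s => P.f (x s) (u s)) volume 0 T :=
  hu.intervalIntegrable_comp hP hT hx (Φ := fun p => P.f p.1 p.2)
    (hP.contDiff_stackF.continuous.comp
      (f := fun p : P.State × P.Input => (p.1, p.2, p.1)) (by fun_prop))

theorem Admissible.intervalIntegrable_l :
    IntervalIntegrable (fun s => P.l (x s) (u s)) volume 0 T :=
  hu.intervalIntegrable_comp hP hT hx hP.contDiff_l.continuous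

theorem Admissible.intervalIntegrable_stackF (hxb : ContinuousOn xb (Icc 0 T)) :
    IntervalIntegrable (fun s => P.stackF (x s) (u s) (xb s)) volume 0 T := by
  obtain ⟨R, hR⟩ := hu.exists_norm_le hP
  refine _root_.intervalIntegrable_comp hP.contDiff_stackF.continuous
    (p := fun s => (x s, u s, xb s)) hT
    ((hx.aestronglyMeasurable measurableSet_Icc).prodMk (hu.1.aestronglyMeasurable.prodMk
      (hxb.aestronglyMeasurable measurableSet_Icc)))
    (R := max (Linf T x) (max R (Linf T xb))) fun s hs => ?_
  exact max_le_max (norm_le_Linf hx hs) (max_le_max (hR s hs) (norm_le_Linf hxb hs))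

theorem Admissible.intervalIntegrable_stackG (hy : ContinuousOn y (Icc 0 T))
    (hxb : ContinuousOn xb (Icc 0 T)) (hlb : ContinuousOn lb (Icc 0 T)) :
    IntervalIntegrable (fun s => P.stackG (x s) (u s) (y s) (xb s) (lb s)) volume 0 T := by
  obtain ⟨R, hR⟩ := hu.exists_norm_le hP
  refine _root_.intervalIntegrable_comp hP.contDiff_stackG.continuous
    (p := fun s => (x s, u s, y s, xb s, lb s)) hT
    ((hx.aestronglyMeasurable measurableSet_Icc).prodMk (hu.1.aestronglyMeasurable.prodMk
      ((hy.aestronglyMeasurable measurableSet_Icc).prodMk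
      ((hxb.aestronglyMeasurable measurableSet_Icc).prodMk
      (hlb.aestronglyMeasurable measurableSet_Icc)))))
    (R := max (Linf T x) (max R (max (Linf T y) (max (Linf T xb) (Linf T lb))))) fun s hs => ?_
  exact max_le_max (norm_le_Linf hx hs) (max_le_max (hR s hs) (max_le_max (norm_le_Linf hy hs)
    (max_le_max (norm_le_Linf hxb hs) (norm_le_Linf hlb hs))))

end Integrability

/-! ### One iteration as a single pair of equations. -/

section Stacking

variable {P} {ml Ml mV MV : ℝ} (hP : P.IsRegular ml Ml mV MV) {T : ℝ} (hT : 0 ≤ T)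
  {x₀ : P.State} {u : ℝ → P.Input} {x xb lam lb : ℝ → P.State}

include hP hT

/-- Neither side mentions minimality: the error analysis needs only these equations and the feedback
law, so it can compare an iterate with the central optimum. -/
theorem stackedStep_iff (hxb : ContinuousOn xb (Icc 0 T)) (hlb : ContinuousOn lb (Icc 0 T)) :
    P.StackedStep T x₀ xb lb u x lam ↔ ∀ i,
      P.LocalAdmissible T i (fun τ => u τ i) ∧
      P.IsLocalTraj T i x₀ xb (fun τ => u τ i) (fun τ => x τ i) ∧
      P.IsLocalAdjoint T i xb lb (fun τ => u τ i) (fun τ => x τ i) (fun τ => lam τ i) := by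
  have hfw : P.Admissible T u → (SolvesForward T (fun s y => P.stackF y (u s) (xb s)) x₀ x ↔
      ∀ i, P.IsLocalTraj T i x₀ xb (fun τ => u τ i) (fun τ => x τ i)) := fun hu =>
    solvesForward_piLp_iff hT (Fi := fun i s y => P.fAgent i y (u s i) (xb s)) (fun s i => rfl)
      fun hx => hu.intervalIntegrable_stackF hP hT hx hxb
  have hbw : P.Admissible T u → ContinuousOn x (Icc 0 T) →
      (SolvesBackward T (fun s y => P.stackG (x s) (u s) y (xb s) (lb s))
        (gradient P.V (x T)) lam ↔
      ∀ i, P.IsLocalAdjoint T i xb lb (fun τ => u τ i) (fun τ => x τ i) (fun τ => lam τ i)) := by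
    intro hu hx
    have h := solvesBackward_piLp_iff (G := fun s y => P.stackG (x s) (u s) y (xb s) (lb s))
      (yT := gradient P.V (x T)) (y := lam) hT (Gi := fun i s y =>
      gradient (fun z => P.localH i z (u s i) y (xb s) (lb s)) (x s i)) (fun s i => rfl)
      fun hy => hu.intervalIntegrable_stackG hP hT hx hy hxb hlb
    rw [h]
    simp only [hP.gradV_apply, IsLocalAdjoint]
  constructor
  · intro h i
    have hu : P.Admissible T u := ⟨h.measurable, h.mem⟩
    exact ⟨⟨P.measurable_iff_components.1 h.measurable i, fun τ hτ => h.mem τ hτ i⟩,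
      (hfw hu).1 h.forward i, (hbw hu h.forward.1).1 h.backward i⟩
  · intro h
    have hu : P.Admissible T u := ⟨P.measurable_iff_components.2 fun i => (h i).1.1,
      fun τ hτ i => (h i).1.2 τ hτ⟩
    have hf := (hfw hu).2 fun i => (h i).2.1
    exact ⟨hu.1, hu.2, hf, (hbw hu hf.1).2 fun i => (h i).2.2⟩

theorem IsStep.stackedStep (hxb : ContinuousOn xb (Icc 0 T)) (hlb : ContinuousOn lb (Icc 0 T))
    (h : P.IsStep T x₀ xb lb u x lam) : P.StackedStep T x₀ xb lb u x lam :=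
  (stackedStep_iff hP hT hxb hlb).2 fun i => ⟨(h i).1, (h i).2.1, (h i).2.2.2⟩

omit hT in
/-- The optimal solution solves the stacked equations for itself as the previous iterate. -/
theorem stackedStep_of_isCentralAdjoint (hu : P.Admissible T u) (hx : P.IsTraj T x₀ u x)
    (hl : P.IsCentralAdjoint T u x lam) : P.StackedStep T x₀ x lam u x lam := by
  refine ⟨hu.1, hu.2, ⟨hx.1, hx.2⟩, hl.1, fun τ hτ => ?_⟩
  rw [hl.2 τ hτ]
  simp only [(hP.hasGradientAt_centralH _ _ _).gradient]

end Stacking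

end AgentNetwork

/-! ### A priori bounds: trajectories stay in the ball, iterates stay appropriate. -/

namespace AgentNetwork

variable {N : ℕ} {P : AgentNetwork N} {rx rl ρ L R C T : ℝ} {G : Set P.State}
  (H : P.ShortHorizon rx rl ρ L R C T)

theorem HasConstants.norm_f_le (h : P.HasConstants R C) {x : P.State} {u : P.Input}
    (hx : ‖x‖ ≤ R) (hu : u ∈ P.inputSet) : ‖P.f x u‖ ≤ C :=
  h.stackF.1 (x, u, x) (max_le hx (max_le (h.input u hu) hx))

theorem HasConstants.norm_f_sub_le (h : P.HasConstants R C) {x y : P.State} {u v : P.Input}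
    (hx : ‖x‖ ≤ R) (hy : ‖y‖ ≤ R) (hu : u ∈ P.inputSet) (hv : v ∈ P.inputSet) :
    ‖P.f x u - P.f y v‖ ≤ C * (‖x - y‖ + ‖u - v‖) := by
  have hC := h.one_le
  refine (h.stackF.2 (x, u, x) (y, v, y) (max_le hx (max_le (h.input u hu) hx))
    (max_le hy (max_le (h.input v hv) hy))).trans ?_
  refine mul_le_mul_of_nonneg_left ?_ (by linarith)
  exact max_le (le_add_of_nonneg_right (norm_nonneg _))
    (max_le (le_add_of_nonneg_left (norm_nonneg _)) (le_add_of_nonneg_right (norm_nonneg _)))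

theorem HasConstants.norm_stackF_sub_le (h : P.HasConstants R C) {x y z w : P.State}
    {u v : P.Input} (hx : ‖x‖ ≤ R) (hy : ‖y‖ ≤ R) (hu : u ∈ P.inputSet) (hv : v ∈ P.inputSet)
    (hz : ‖z‖ ≤ R) (hw : ‖w‖ ≤ R) {K : ℝ} (hxy : ‖x - y‖ ≤ K) (huv : ‖u - v‖ ≤ K)
    (hzw : ‖z - w‖ ≤ K) : ‖P.stackF x u z - P.stackF y v w‖ ≤ C * K :=
  (h.stackF.2 (x, u, z) (y, v, w) (max_le hx (max_le (h.input u hu) hz))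
    (max_le hy (max_le (h.input v hv) hw))).trans
    (mul_le_mul_of_nonneg_left (max_le hxy (max_le huv hzw)) (by linarith [h.one_le]))

theorem HasConstants.norm_stackG_sub_le (h : P.HasConstants R C)
    {x y z w x' y' z' w' : P.State} {u u' : P.Input} (hu : u ∈ P.inputSet) (hu' : u' ∈ P.inputSet)
    (hx : ‖x‖ ≤ R) (hy : ‖y‖ ≤ R) (hz : ‖z‖ ≤ R) (hw : ‖w‖ ≤ R)
    (hx' : ‖x'‖ ≤ R) (hy' : ‖y'‖ ≤ R) (hz' : ‖z'‖ ≤ R) (hw' : ‖w'‖ ≤ R)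
    {K : ℝ} (hxx : ‖x - x'‖ ≤ K) (huu : ‖u - u'‖ ≤ K) (hyy : ‖y - y'‖ ≤ K)
    (hzz : ‖z - z'‖ ≤ K) (hww : ‖w - w'‖ ≤ K) :
    ‖P.stackG x u y z w - P.stackG x' u' y' z' w'‖ ≤ C * K :=
  (h.stackG.2 (x, u, y, z, w) (x', u', y', z', w')
    (max_le hx (max_le (h.input u hu) (max_le hy (max_le hz hw))))
    (max_le hx' (max_le (h.input u' hu') (max_le hy' (max_le hz' hw'))))).trans
    (mul_le_mul_of_nonneg_left (max_le hxx (max_le huu (max_le hyy (max_le hzz hww))))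
      (by linarith [h.one_le]))

theorem zero_mem_inputSet {ml Ml mV MV : ℝ} (hP : P.IsRegular ml Ml mV MV) :
    (0 : P.Input) ∈ P.inputSet := fun i => interior_subset (hP.U_zero i)

theorem f_zero_zero {ml Ml mV MV : ℝ} (hP : P.IsRegular ml Ml mV MV) :
    P.f 0 0 = 0 := by
  ext1 i
  exact hP.f_zero i

theorem HasConstants.norm_f_le_add (h : P.HasConstants R C) {ml Ml mV MV : ℝ}
    (hP : P.IsRegular ml Ml mV MV) (hR : 0 ≤ R) {x : P.State} {u : P.Input}
    (hx : ‖x‖ ≤ R) (hu : u ∈ P.inputSet) : ‖P.f x u‖ ≤ C * (‖x‖ + ‖u‖) := by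
  have := h.norm_f_sub_le hx (y := 0) (by simpa using hR) hu (zero_mem_inputSet hP)
  rwa [f_zero_zero hP, sub_zero, sub_zero, sub_zero] at this

theorem norm_le_of_norm_sub_le {E : Type*} [NormedAddCommGroup E] {x y : E} {a b c : ℝ}
    (hy : ‖y‖ ≤ a) (h : ‖x - y‖ ≤ b) (hc : a + b ≤ c) : ‖x‖ ≤ c := by
  have := norm_le_norm_add_norm_sub' x y
  linarith

section

include H

theorem ShortHorizon.C_pos : 0 < C := by linarith [H.consts.one_le]

theorem ShortHorizon.lt_one : C * T < 1 := by linarith [H.le_half]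

/-- A trajectory starting well inside the ball of radius `R` moves with speed at most `C`. -/
theorem ShortHorizon.norm_traj_sub_le {r : ℝ} {x₀ : P.State} {u : ℝ → P.Input}
    {x : ℝ → P.State} (hr : C * T < r) (h0 : ‖x₀‖ + r ≤ R) (hu : P.Admissible T u)
    (hx : P.IsTraj T x₀ u x) : ∀ τ ∈ Icc 0 T, ‖x τ - x₀‖ ≤ C * τ :=
  hx.norm_sub_le_of_bounded H.C_pos.le hr fun s hs _ hy =>
    H.consts.norm_f_le (norm_le_of_norm_sub_le le_rfl hy h0) (hu.2 s hs)

theorem ShortHorizon.traj_bounds {x₀ : P.State} {u : ℝ → P.Input} {x : ℝ → P.State}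
    (h0 : ‖x₀‖ ≤ ρ) (hu : P.Admissible T u) (hx : P.IsTraj T x₀ u x) :
    ∀ τ ∈ Icc 0 T, ‖x τ - x₀‖ ≤ rx ∧ ‖x τ‖ ≤ ρ + rx ∧ ‖x τ‖ ≤ R := by
  intro τ hτ
  have h1 : ‖x τ - x₀‖ ≤ rx := by
    have := H.norm_traj_sub_le H.lt_rx (by linarith [H.state_lt]) hu hx τ hτ
    have := mul_le_mul_of_nonneg_left hτ.2 H.C_pos.le
    linarith [H.lt_rx]
  exact ⟨h1, norm_le_of_norm_sub_le h0 h1 le_rfl,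
    norm_le_of_norm_sub_le h0 h1 (by linarith [H.state_lt])⟩

end

theorem mem_nbhdSet_of_norm_sub_le {E : Type*} [NormedAddCommGroup E] {S : Set E} {x y : E} {r : ℝ}
    (hy : y ∈ S) (h : ‖x - y‖ ≤ r) : x ∈ nbhdSet S r :=
  mem_biUnion hy (by simpa [dist_eq_norm] using h)

theorem norm_le_of_mem_nbhdSet {E : Type*} [NormedAddCommGroup E] {S : Set E} {x : E} {r a : ℝ}
    (hS : ∀ y ∈ S, ‖y‖ ≤ a) (h : x ∈ nbhdSet S r) : ‖x‖ ≤ a + r := by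
  obtain ⟨y, hy, hxy⟩ := mem_iUnion₂.1 h
  rw [Metric.mem_closedBall, dist_eq_norm] at hxy
  exact norm_le_of_norm_sub_le (hS y hy) hxy le_rfl

variable (hG : ∀ x ∈ G, ‖x‖ ≤ ρ)
include H hG

theorem ShortHorizon.appropriate_bounds {xb lb : ℝ → P.State}
    (h : P.Appropriate T G rx rl xb lb) {τ : ℝ} (hτ : τ ∈ Icc 0 T) :
    ‖xb τ‖ ≤ R ∧ ‖lb τ‖ ≤ R := by
  obtain ⟨h1, h2⟩ := h.2.2 τ hτ
  refine ⟨(norm_le_of_mem_nbhdSet hG h1).trans (by linarith [H.state_lt]), ?_⟩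
  obtain ⟨y, ⟨z, hz, rfl⟩, hy⟩ := mem_iUnion₂.1 h2
  rw [Metric.mem_closedBall, dist_eq_norm] at hy
  exact norm_le_of_norm_sub_le le_rfl hy (H.adjoint_le z (norm_le_of_mem_nbhdSet hG hz))


/-- One iteration from appropriate trajectories gives appropriate trajectories. -/
theorem ShortHorizon.appropriate_of_stackedStep {x₀ : P.State} (h0 : x₀ ∈ G)
    {xb lb : ℝ → P.State} (hb : P.Appropriate T G rx rl xb lb) {u : ℝ → P.Input}
    {x lam : ℝ → P.State} (h : P.StackedStep T x₀ xb lb u x lam) :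
    (∀ τ ∈ Icc 0 T, ‖x τ - x₀‖ ≤ rx) ∧ P.Appropriate T G rx rl x lam := by
  have hC := H.C_pos
  have hT := H.T_pos
  have h0ρ := hG x₀ h0
  have hTm : T ∈ Icc 0 T := ⟨hT.le, le_rfl⟩
  have h1 : ∀ τ ∈ Icc 0 T, ‖x τ - x₀‖ ≤ rx := by
    intro τ hτ
    have := h.forward.norm_sub_le_of_bounded hC.le H.lt_rx (fun s hs y hy => by
      have hyR : ‖y‖ ≤ R := norm_le_of_norm_sub_le h0ρ hy (by linarith [H.state_lt])
      exact H.consts.stackF.1 (y, u s, xb s) (max_le hyR (max_le (H.consts.input _ (h.mem s hs))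
        (H.appropriate_bounds hG hb hs).1))) τ hτ
    have := mul_le_mul_of_nonneg_left hτ.2 hC.le
    linarith [H.lt_rx]
  have h2 : ∀ τ ∈ Icc 0 T, ‖x τ‖ ≤ ρ + rx := fun τ hτ =>
    norm_le_of_norm_sub_le h0ρ (h1 τ hτ) le_rfl
  have h3 : ∀ τ ∈ Icc 0 T, ‖lam τ - gradient P.V (x T)‖ ≤ rl := by
    intro τ hτ
    have := h.backward.norm_sub_le_of_bounded hC.le H.lt_rl (fun s hs y hy => by
      have hyR : ‖y‖ ≤ R := norm_le_of_norm_sub_le le_rfl hy (H.adjoint_le _ (h2 T hTm))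
      exact H.consts.stackG.1 (x s, u s, y, xb s, lb s) (max_le
        ((h2 s hs).trans (by linarith [H.state_lt])) (max_le (H.consts.input _ (h.mem s hs))
        (max_le hyR (max_le (H.appropriate_bounds hG hb hs).1
        (H.appropriate_bounds hG hb hs).2))))) τ hτ
    have := mul_le_mul_of_nonneg_left (sub_le_self T hτ.1) hC.le
    linarith [H.lt_rl]
  refine ⟨h1, h.forward.1, h.backward.1, fun τ hτ => ⟨mem_nbhdSet_of_norm_sub_le h0 (h1 τ hτ),
    mem_nbhdSet_of_norm_sub_le ⟨x T, mem_nbhdSet_of_norm_sub_le h0 (h1 T hTm), rfl⟩ (h3 τ hτ)⟩⟩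

theorem ShortHorizon.appropriate_of_isStep {x₀ : P.State} (h0 : x₀ ∈ G)
    {xb lb : ℝ → P.State} (hb : P.Appropriate T G rx rl xb lb) {u : ℝ → P.Input}
    {x lam : ℝ → P.State} (h : P.IsStep T x₀ xb lb u x lam) : P.Appropriate T G rx rl x lam := by
  obtain ⟨ml, Ml, mV, MV, hP⟩ := H.regular
  exact (H.appropriate_of_stackedStep hG h0 hb (h.stackedStep hP H.T_pos.le hb.1 hb.2.1)).2

/-- The central optimal trajectories are appropriate. -/
theorem ShortHorizon.appropriate_of_isCentralAdjoint {x₀ : P.State} (h0 : x₀ ∈ G)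
    {u : ℝ → P.Input} {x lam : ℝ → P.State} (hu : P.Admissible T u) (hx : P.IsTraj T x₀ u x)
    (hl : P.IsCentralAdjoint T u x lam) : P.Appropriate T G rx rl x lam := by
  obtain ⟨ml, Ml, mV, MV, hP⟩ := H.regular
  have hC := H.C_pos
  have hTm : T ∈ Icc 0 T := ⟨H.T_pos.le, le_rfl⟩
  have hb := H.traj_bounds (hG x₀ h0) hu hx
  have h3 : ∀ τ ∈ Icc 0 T, ‖lam τ - gradient P.V (x T)‖ ≤ rl := by
    intro τ hτ
    have := SolvesBackward.norm_sub_le_of_bounded hl hC.le H.lt_rl (fun s hs y hy => by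
      have hyR : ‖y‖ ≤ R := norm_le_of_norm_sub_le le_rfl hy (H.adjoint_le _ (hb T hTm).2.1)
      rw [(hP.hasGradientAt_centralH _ _ _).gradient]
      have hxR := (hb s hs).2.2
      exact H.consts.stackG.1 (x s, u s, y, x s, y) (max_le hxR
        (max_le (H.consts.input _ (hu.2 s hs)) (max_le hyR (max_le hxR hyR))))) τ hτ
    have := mul_le_mul_of_nonneg_left (sub_le_self T hτ.1) hC.le
    linarith [H.lt_rl]
  refine ⟨hx.1, hl.1, fun τ hτ => ⟨mem_nbhdSet_of_norm_sub_le h0 (hb τ hτ).1,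
    mem_nbhdSet_of_norm_sub_le ⟨x T, mem_nbhdSet_of_norm_sub_le h0 (hb T hTm).1, rfl⟩ (h3 τ hτ)⟩⟩

/-- The central adjoint exists. -/
theorem ShortHorizon.exists_isCentralAdjoint {x₀ : P.State} (h0 : x₀ ∈ G)
    {u : ℝ → P.Input} {x : ℝ → P.State} (hu : P.Admissible T u) (hx : P.IsTraj T x₀ u x) :
    ∃ lam, P.IsCentralAdjoint T u x lam := by
  obtain ⟨ml, Ml, mV, MV, hP⟩ := H.regular
  have hb := H.traj_bounds (hG x₀ h0) hu hx
  refine exists_solvesBackward H.T_pos.le H.C_pos.le H.lt_one _ _ (fun y hy => ?_)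
    (fun s hs y z => ?_)
  · simp only [(hP.hasGradientAt_centralH _ _ _).gradient]
    exact hu.intervalIntegrable_stackG hP H.T_pos.le hx.1 hy hx.1 hy
  · rw [(hP.hasGradientAt_centralH _ _ _).gradient, (hP.hasGradientAt_centralH _ _ _).gradient]
    -- The Picard argument needs a Lipschitz bound for all adjoint values, whereas `stackG` is
    -- controlled on a ball only. The Hamiltonian is affine in the adjoint, so the difference of
    -- gradients is the gradient of `a ↦ ⟪y - z, f a (u s)⟫`, which is Lipschitz with constant `C *
    -- ‖y - z‖` near `x s`.
    have hd : HasFDerivAt (fun a => inner ℝ (y - z) (P.f a (u s)))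
        (InnerProductSpace.toDual ℝ P.State
          (P.stackG (x s) (u s) y (x s) y - P.stackG (x s) (u s) z (x s) z)) (x s) := by
      have := (hP.hasGradientAt_centralH (x s) (u s) y).hasFDerivAt.sub
        (hP.hasGradientAt_centralH (x s) (u s) z).hasFDerivAt
      rw [map_sub]
      refine this.congr_of_eventuallyEq (Eventually.of_forall fun a => ?_)
      simp only [centralH, Pi.sub_apply, inner_sub_left]
      ring
    have hball : Metric.ball (0 : P.State) R ∈ 𝓝 (x s) :=
      Metric.isOpen_ball.mem_nhds (by
        rw [mem_ball_zero_iff]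
        linarith [(hb s hs).2.1, H.state_lt])
    have := hd.le_of_lip' (C := C * ‖y - z‖) (mul_nonneg H.C_pos.le (norm_nonneg _)) (by
      filter_upwards [hball] with a ha
      rw [mem_ball_zero_iff] at ha
      rw [← inner_sub_right]
      refine (norm_inner_le_norm _ _).trans ?_
      have := H.consts.norm_f_sub_le ha.le (hb s hs).2.2 (hu.2 s hs) (hu.2 s hs)
      rw [sub_self, norm_zero, add_zero] at this
      calc _ ≤ ‖y - z‖ * (C * ‖a - x s‖) := by gcongr
        _ = _ := by ring)
    rwa [LinearIsometryEquiv.norm_map] at this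

end AgentNetwork

/-! ### The optimum as a fixed point, contraction, and the error bound. -/

namespace AgentNetwork

variable {N : ℕ} {P : AgentNetwork N} {rx rl ρ L R C T : ℝ} {G : Set P.State}
  (H : P.ShortHorizon rx rl ρ L R C T) (hG : ∀ x ∈ G, ‖x‖ ≤ ρ)

/-- Replacing one agent's input changes the central Hamiltonian as it changes the local one. -/
theorem centralH_update_sub (x : P.State)
    (u : P.Input) (y : P.State) (i : Fin N) (v : P.AInput i) :
    P.centralH x (WithLp.toLp 2 (Function.update u i v)) y - P.centralH x u y =
      P.localH i (x i) v (y i) x y - P.localH i (x i) (u i) (y i) x y := by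
  have h : ∀ u : P.Input, P.centralH x u y =
      ∑ k, (P.lAgent k (x k) (u k) x + inner ℝ (y k) (P.fAgent k (x k) (u k) x)) := by
    intro u
    simp only [centralH, l, f, PiLp.inner_apply, Finset.sum_add_distrib]
  rw [h, h, ← Finset.sum_sub_distrib, Finset.sum_eq_single i]
  · simp only [localH, Function.update_self]
    ring
  · intro k _ hk
    simp [Function.update_of_ne hk]
  · simp

theorem continuous_uncurry_f {ml Ml mV MV : ℝ} (hP : P.IsRegular ml Ml mV MV) :
    Continuous (Function.uncurry P.f) := by
  have h1 : Continuous fun p : P.State × P.Input => (p.1, p.2, p.1) := by fun_prop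
  exact hP.contDiff_stackF.continuous.comp h1

theorem continuous_stackG_diag {ml Ml mV MV : ℝ} (hP : P.IsRegular ml Ml mV MV) :
    Continuous fun p : P.State × P.Input × P.State =>
      P.stackG p.1 p.2.1 p.2.2 p.1 p.2.2 := by
  have h1 : Continuous fun p : P.State × P.Input × P.State =>
    (p.1, p.2.1, p.2.2, p.1, p.2.2) := by fun_prop
  exact (hP.contDiff_stackG.continuous.comp h1 :)

theorem HasConstants.norm_stackG_le (h : P.HasConstants R C)
    {x y z w : P.State} {u : P.Input} (hu : u ∈ P.inputSet)
    (hx : ‖x‖ ≤ R) (hy : ‖y‖ ≤ R) (hz : ‖z‖ ≤ R) (hw : ‖w‖ ≤ R) :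
    ‖P.stackG x u y z w‖ ≤ C :=
  h.stackG.1 (x, u, y, z, w) (max_le hx (max_le (h.input u hu) (max_le hy (max_le hz hw))))

theorem HasConstants.norm_l_le (h : P.HasConstants R C) {x : P.State} {u : P.Input}
    (hx : ‖x‖ ≤ R) (hu : u ∈ P.inputSet) : ‖P.l x u‖ ≤ C :=
  h.l.1 (x, u) (max_le hx (h.input u hu))

theorem HasConstants.centralH_taylor (h : P.HasConstants R C) {ml Ml mV MV : ℝ}
    (hP : P.IsRegular ml Ml mV MV) {x y w : P.State} {v : P.Input} (hx : ‖x‖ ≤ R) (hy : ‖y‖ ≤ R)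
    (hv : v ∈ P.inputSet) (hw : ‖w‖ ≤ R) :
    |(P.l y v + inner ℝ w (P.f y v)) - (P.l x v + inner ℝ w (P.f x v)) -
      inner ℝ (P.stackG x v w x w) (y - x)| ≤ C * ‖y - x‖ ^ 2 := by
  have h1 : ∀ a b : P.State, ‖a‖ ≤ R → ‖b‖ ≤ R →
      ‖P.stackG a v w a w - P.stackG b v w b w‖ ≤ C * ‖a - b‖ := fun a b ha hb =>
    h.norm_stackG_sub_le hv hv ha hw ha hw hb hw hb hw le_rfl (by simp) (by simp) le_rfl (by simp)
  have h2 := abs_sub_sub_inner_le (φ := fun z => P.centralH z v w) (by linarith [h.one_le])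
    (fun z _ => hP.hasGradientAt_centralH z v w) h1 hx hy
  exact h2

theorem HasConstants.V_taylor (h : P.HasConstants R C) {ml Ml mV MV : ℝ}
    (hP : P.IsRegular ml Ml mV MV) {x y : P.State} (hx : ‖x‖ ≤ R) (hy : ‖y‖ ≤ R) :
    |P.V y - P.V x - inner ℝ (gradient P.V x) (y - x)| ≤ C * ‖y - x‖ ^ 2 :=
  abs_sub_sub_inner_le (by linarith [h.one_le])
    (fun z _ => (hP.contDiff_V.differentiable two_ne_zero z).hasGradientAt) h.gradV.2 hx hy

section

include H hG

/-- The optimal solution satisfies the first-order conditions of the local problems for itself as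
the previous iterate. -/
theorem ShortHorizon.isExtremalStep {x₀ : P.State} (h0 : x₀ ∈ G)
    (hcomplete : ∀ x₀ u, P.Admissible T u → ∃ x, P.IsTraj T x₀ u x)
    {u : ℝ → P.Input} {x lam : ℝ → P.State} (ho : P.IsOptimal T x₀ u x)
    (hl : P.IsCentralAdjoint T u x lam) : P.IsExtremalStep T x₀ x lam u x lam := by
  obtain ⟨ml, Ml, mV, MV, hP⟩ := H.regular
  obtain ⟨hu, hx, hmin⟩ := ho
  have hT := H.T_pos
  have hC := H.C_pos
  have hx' : SolvesForward T (fun s y => P.f y (u s)) x₀ x := hx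
  have hTm : T ∈ Icc 0 T := ⟨hT.le, le_rfl⟩
  have hb := fun τ hτ => (H.traj_bounds (hG x₀ h0) hu hx τ hτ).2.2
  have happ := H.appropriate_of_isCentralAdjoint hG h0 hu hx hl
  have hst := stackedStep_of_isCentralAdjoint hP hu hx hl
  have hpmp := hamiltonian_le_of_optimal (f := P.f) (l := P.l) (V := P.V)
    (gV := gradient P.V (x T)) (gH := fun x v w => P.stackG x v w x w) (S := P.inputSet)
    (R := R) (C := C) (x₀ := x₀) (u := u) (x := x) (lam := lam) (T := T)
    (continuous_uncurry_f hP) hP.contDiff_l.continuous (continuous_stackG_diag hP)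
    (fun x v hx hv => H.consts.norm_f_le hx hv)
    (fun x y v hx hy hv => by simpa using H.consts.norm_f_sub_le hx hy hv hv)
    (fun x v hx hv => H.consts.norm_l_le hx hv)
    (fun x v w hx hv hw => H.consts.norm_stackG_le hv hx hw hx hw)
    (fun x y v w hx hy hv hw => H.consts.centralH_taylor hP hx hy hv hw)
    hT H.le_half hu.1 hu.2 hx' hb (fun y hy => H.consts.V_taylor hP (hb T hTm) hy)
    ⟨hst.backward.1, hst.backward.2⟩ (fun s hs => (H.appropriate_bounds hG happ hs).2)
    (fun v hv hvS => by
      obtain ⟨y, hy⟩ := hcomplete x₀ v ⟨hv, hvS⟩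
      exact ⟨y, hy, fun s hs => (H.traj_bounds (hG x₀ h0) ⟨hv, hvS⟩ hy s hs).2.2,
        hmin v y ⟨hv, hvS⟩ hy⟩)
  intro i
  obtain ⟨h1, h2, h3⟩ := (stackedStep_iff hP hT.le hx.1 hl.1).1 hst i
  refine ⟨h1, h2, h3, ?_⟩
  filter_upwards [hpmp] with s hs hsI v hv
  -- The input set is a product, so one agent's input may be varied alone; the central minimum
  -- condition then reduces to the local one.
  have hmem : (WithLp.toLp 2 (Function.update (u s) i v) : P.Input) ∈ P.inputSet := by
    intro k
    rcases eq_or_ne k i with rfl | hk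
    · simpa using hv
    · simpa [Function.update_of_ne hk] using hu.2 s hsI k
  have h4 : P.centralH (x s) (u s) (lam s) ≤
    P.centralH (x s) (WithLp.toLp 2 (Function.update (u s) i v)) (lam s) := hs hsI _ hmem
  have h5 := centralH_update_sub (x s) (u s) (lam s) i v
  linarith

end

/-- Two inputs differ, almost everywhere on `[0,T]`, by at most `L` times the difference of the
states plus `2 L E`. -/
def InputsClose (T L E : ℝ) (u u' : ℝ → P.Input) (x x' : ℝ → P.State) : Prop :=
  ∀ᵐ s, s ∈ Icc 0 T → ‖u s - u' s‖ ≤ L * (‖x s - x' s‖ + 2 * E)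

/-- One law generates both inputs, whether they come from minimizers or from extremals. This is how
the central optimum, known only to be an extremal of the local problems, becomes comparable with an
iterate. The state and adjoint differences of the previous iterates contribute `E` each. -/
theorem inputsClose_of_law (hL : 0 ≤ L) (hT : 0 ≤ T)
    (hlaw : P.HasLipschitzDMPCLaw T G rx rl L) {x₀ : P.State}
    (h0 : x₀ ∈ G) {xb lb xb' lb' x lam x' lam' : ℝ → P.State} {u u' : ℝ → P.Input}
    (hb : P.Appropriate T G rx rl xb lb) (hb' : P.Appropriate T G rx rl xb' lb')
    (h : P.IsStep T x₀ xb lb u x lam ∨ P.IsExtremalStep T x₀ xb lb u x lam)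
    (h' : P.IsStep T x₀ xb' lb' u' x' lam' ∨ P.IsExtremalStep T x₀ xb' lb' u' x' lam')
    (hx : P.Appropriate T G rx rl x lam) (hx' : P.Appropriate T G rx rl x' lam') {E : ℝ}
    (hxE : ∀ τ ∈ Icc 0 T, ‖xb τ - xb' τ‖ ≤ E) (hlE : ∀ τ ∈ Icc 0 T, ‖lb τ - lb' τ‖ ≤ E) :
    InputsClose T L E u u' x x' := by
  obtain ⟨κ, hκ, hlip⟩ := hlaw
  filter_upwards [hκ x₀ h0 xb lb hb u x lam h, hκ x₀ h0 xb' lb' hb' u' x' lam' h']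
    with s h1 h2 hs
  rw [h1 hs, h2 hs]
  refine (hlip x₀ h0 xb lb xb' lb' hb hb' s hs _ (hx.2.2 s hs).1 _ (hx'.2.2 s hs).1).trans ?_
  have := Linf_le hT hxE
  have := Linf_le hT hlE
  exact mul_le_mul_of_nonneg_left (by linarith) hL

/-- `h2` absorbs half of `A`, leaving `A ≤ 2 T C (2 L + 1) E`; `h1` absorbs half of `B`, leaving `B
≤ (2 C + 1) A + 4 T C (L + 1) E`. The left side of `h3` is the resulting factor of `E` in the sum.
-/
theorem contraction_arithmetic {T C L A B E : ℝ} (hC : 0 ≤ C)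
    (hA : 0 ≤ A) (hB : 0 ≤ B) (hE : 0 ≤ E) (h1 : C * T ≤ 1 / 2) (h2 : 2 * T * C * (1 + L) ≤ 1)
    (h3 : T * ((2 * C + 2) * (2 * C * (2 * L + 1)) + 4 * C * (L + 1)) ≤ 1 / 2)
    (hA1 : A ≤ C * (A + L * (A + 2 * E) + E) * T)
    (hB1 : B ≤ C * A + C * (A + L * (A + 2 * E) + B + 2 * E) * T) : A + B ≤ 1 / 2 * E := by
  have c1 := mul_le_mul_of_nonneg_right h2 hA
  have c2 := mul_le_mul_of_nonneg_right h1 hB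
  have c3 := mul_le_mul_of_nonneg_right h3 hE
  have hA2 : A ≤ 2 * T * C * (2 * L + 1) * E := by linarith
  have hB2 : B ≤ (2 * C + 1) * A + 4 * T * C * (L + 1) * E := by linarith
  have hA3 : (2 * C + 2) * A ≤ (2 * C + 2) * (2 * T * C * (2 * L + 1) * E) :=
    mul_le_mul_of_nonneg_left hA2 (by linarith)
  linarith

include H hG

/-- Contraction estimate for one iteration. -/
theorem ShortHorizon.step_contraction {x₀ : P.State} (h0 : x₀ ∈ G)
    {xb lb xb' lb' x lam x' lam' : ℝ → P.State} {u u' : ℝ → P.Input}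
    (hb : P.Appropriate T G rx rl xb lb) (hb' : P.Appropriate T G rx rl xb' lb')
    (h : P.StackedStep T x₀ xb lb u x lam) (h' : P.StackedStep T x₀ xb' lb' u' x' lam')
    {E : ℝ} (hxE : ∀ τ ∈ Icc 0 T, ‖xb τ - xb' τ‖ ≤ E) (hlE : ∀ τ ∈ Icc 0 T, ‖lb τ - lb' τ‖ ≤ E)
    (hu : InputsClose T L E u u' x x') :
    ∀ τ ∈ Icc 0 T, ‖x τ - x' τ‖ + ‖lam τ - lam' τ‖ ≤ 1 / 2 * E := by
  obtain ⟨ml, Ml, mV, MV, hP⟩ := H.regular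
  have hT := H.T_pos
  have hC := H.C_pos
  have hL := H.L_pos
  have hTm : T ∈ Icc 0 T := ⟨hT.le, le_rfl⟩
  have hx := (H.appropriate_of_stackedStep hG h0 hb h).2
  have hx' := (H.appropriate_of_stackedStep hG h0 hb' h').2
  have hE : 0 ≤ E := (norm_nonneg _).trans (hxE T hTm)
  have adm : P.Admissible T u := ⟨h.measurable, h.mem⟩
  have adm' : P.Admissible T u' := ⟨h'.measurable, h'.mem⟩
  have bb := fun s hs => H.appropriate_bounds hG hb (τ := s) hs
  have bb' := fun s hs => H.appropriate_bounds hG hb' (τ := s) hs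
  have bx := fun s hs => H.appropriate_bounds hG hx (τ := s) hs
  have bx' := fun s hs => H.appropriate_bounds hG hx' (τ := s) hs
  set A := Linf T (fun τ => x τ - x' τ) with hA
  set B := Linf T (fun τ => lam τ - lam' τ) with hB
  have hA0 : 0 ≤ A := Linf_nonneg _
  have hB0 : 0 ≤ B := Linf_nonneg _
  have hAx : ∀ τ ∈ Icc 0 T, ‖x τ - x' τ‖ ≤ A := fun τ hτ =>
    norm_le_Linf (q := fun τ => x τ - x' τ) (hx.1.sub hx'.1) hτ
  have hBx : ∀ τ ∈ Icc 0 T, ‖lam τ - lam' τ‖ ≤ B := fun τ hτ =>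
    norm_le_Linf (q := fun τ => lam τ - lam' τ) (hx.2.1.sub hx'.2.1) hτ
  have huA : ∀ᵐ s, s ∈ Icc 0 T → ‖u s - u' s‖ ≤ L * (A + 2 * E) := by
    filter_upwards [hu] with s hs hsI
    refine (hs hsI).trans ?_
    gcongr
    exact hAx s hsI
  have hLE : 0 ≤ L * (A + 2 * E) := mul_nonneg hL.le (by linarith)
  have hA1 : A ≤ C * (A + L * (A + 2 * E) + E) * T := by
    refine Linf_le hT.le fun τ hτ => ?_
    clear_value A B
    have := h.forward.norm_sub_le h'.forward (K := C * (A + L * (A + 2 * E) + E))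
      (mul_nonneg hC.le (by linarith))
      (adm.intervalIntegrable_stackF hP hT.le hx.1 hb.1)
      (adm'.intervalIntegrable_stackF hP hT.le hx'.1 hb'.1) (by
        filter_upwards [huA] with s hs hsI
        refine H.consts.norm_stackF_sub_le (bx s hsI).1 (bx' s hsI).1 (h.mem s hsI) (h'.mem s hsI)
          (bb s hsI).1 (bb' s hsI).1 ?_ ?_ ?_
        · exact (hAx s hsI).trans (by linarith)
        · exact (hs hsI).trans (by linarith)
        · exact (hxE s hsI).trans (by linarith)) τ hτ
    simpa using this
  have hB1 : B ≤ C * A + C * (A + L * (A + 2 * E) + B + 2 * E) * T := by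
    refine Linf_le hT.le fun τ hτ => ?_
    clear_value A B
    have hend : ‖gradient P.V (x T) - gradient P.V (x' T)‖ ≤ C * A :=
      (H.consts.gradV.2 _ _ (bx T hTm).1 (bx' T hTm).1).trans
        (mul_le_mul_of_nonneg_left (hAx T hTm) hC.le)
    have := h.backward.norm_sub_le h'.backward (K := C * (A + L * (A + 2 * E) + B + 2 * E))
      (mul_nonneg hC.le (by linarith))
      (adm.intervalIntegrable_stackG hP hT.le hx.1 hx.2.1 hb.1 hb.2.1)
      (adm'.intervalIntegrable_stackG hP hT.le hx'.1 hx'.2.1 hb'.1 hb'.2.1) (by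
        filter_upwards [huA] with s hs hsI
        refine H.consts.norm_stackG_sub_le (h.mem s hsI) (h'.mem s hsI)
          (bx s hsI).1 (bx s hsI).2 (bb s hsI).1 (bb s hsI).2
          (bx' s hsI).1 (bx' s hsI).2 (bb' s hsI).1 (bb' s hsI).2 ?_ ?_ ?_ ?_ ?_
        · exact (hAx s hsI).trans (by linarith)
        · exact (hs hsI).trans (by linarith)
        · exact (hBx s hsI).trans (by linarith)
        · exact (hxE s hsI).trans (by linarith)
        · exact (hlE s hsI).trans (by linarith)) τ hτ
    linarith
  have hAB := contraction_arithmetic hC.le hA0 hB0 hE H.le_half H.le_one H.contraction hA1 hB1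
  intro τ hτ
  linarith [hAx τ hτ, hBx τ hτ]

/-- In the contraction estimate the optimal pair plays both roles of the first solution: the iterate
and its own predecessor. -/
theorem ShortHorizon.convergesLinearly
    (hcomplete : ∀ x₀ u, P.Admissible T u → ∃ x, P.IsTraj T x₀ u x)
    (hlaw : P.HasLipschitzDMPCLaw T G rx rl L) : P.ConvergesLinearly T G rx rl (1 / 2) := by
  obtain ⟨ml, Ml, mV, MV, hP⟩ := H.regular
  have hT := H.T_pos
  intro x₀ h0 us xo lo ho hl xb lb hb u x lam hstep
  have hx := H.appropriate_of_isStep hG h0 hb hstep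
  have hox := H.appropriate_of_isCentralAdjoint hG h0 ho.1 ho.2.1 hl
  refine ⟨hx, ?_⟩
  set E := Linf T (fun τ => (WithLp.toLp 2 (xo τ - xb τ, lo τ - lb τ) :
          WithLp 2 (P.State × P.State))) with hE
  have hc : ContinuousOn (fun τ => (WithLp.toLp 2 (xo τ - xb τ, lo τ - lb τ) :
      WithLp 2 (P.State × P.State))) (Icc 0 T) :=
    (WithLp.prod_continuous_toLp 2 P.State P.State).comp_continuousOn
      ((hox.1.sub hb.1).prodMk (hox.2.1.sub hb.2.1))
  have hxE : ∀ τ ∈ Icc 0 T, ‖xo τ - xb τ‖ ≤ E := fun τ hτ =>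
    (norm_fst_le_toLp_prod _ _).trans (norm_le_Linf hc hτ)
  have hlE : ∀ τ ∈ Icc 0 T, ‖lo τ - lb τ‖ ≤ E := fun τ hτ =>
    (norm_snd_le_toLp_prod _ _).trans (norm_le_Linf hc hτ)
  have hclose := inputsClose_of_law H.L_pos.le hT.le hlaw h0 hox hb
    (Or.inr (H.isExtremalStep hG h0 hcomplete ho hl)) (Or.inl hstep) hox hx hxE hlE
  have := H.step_contraction hG h0 hox hb (stackedStep_of_isCentralAdjoint hP ho.1 ho.2.1 hl)
    (hstep.stackedStep hP hT.le hb.1 hb.2.1) hxE hlE hclose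
  exact Linf_le hT.le fun τ hτ => (norm_toLp_prod_le _ _).trans (this τ hτ)

theorem ShortHorizon.appropriate_of_run {d : ℝ} {x₀ : P.State} (h0 : x₀ ∈ G) {q : ℕ}
    {u : ℕ → ℝ → P.Input} {x lam : ℕ → ℝ → P.State} (hinit : P.Appropriate T G rx rl (x 0) (lam 0))
    (hrun : P.IsAlgorithmRun T d x₀ q u x lam) :
    ∀ s ≤ q, P.Appropriate T G rx rl (x s) (lam s) := by
  intro s
  induction s with
  | zero => exact fun _ => hinit
  | succ s ih =>
    intro hs
    exact H.appropriate_of_isStep hG h0 (ih (by omega)) (hrun.step s (by omega))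

/-- The last increment is at most `d ‖x₀‖` and the last iteration halves the error, so `E ≤ d ‖x₀‖ +
E / 2`. The input error is then at most `3 L E` and propagates to the actual trajectory as `6 C T L
E`; with `E ≤ 2 d ‖x₀‖` this produces the factor `12`. -/
theorem ShortHorizon.errorBound
    (hcomplete : ∀ x₀ u, P.Admissible T u → ∃ x, P.IsTraj T x₀ u x)
    (hlaw : P.HasLipschitzDMPCLaw T G rx rl L) {d : ℝ} (hd : 0 < d) :
    P.ErrorBound T G rx rl (12 * C * T * L) d := by
  obtain ⟨ml, Ml, mV, MV, hP⟩ := H.regular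
  have hT := H.T_pos
  have hC := H.C_pos
  have hL := H.L_pos
  intro x₀ h0 q u x lam hinit hrun xc hxc us xo ho
  obtain ⟨lo, hl⟩ := H.exists_isCentralAdjoint hG h0 ho.1 ho.2.1
  have hap := H.appropriate_of_run hG h0 hinit hrun
  obtain ⟨p, rfl⟩ : ∃ p, q = p + 1 := ⟨q - 1, by have := hrun.one_le; omega⟩
  have hb := hap p (by omega)
  have hq := hap (p + 1) le_rfl
  have hstep := hrun.step p (by omega)
  have hquit := hrun.stopped
  rw [Nat.add_sub_cancel] at hquit
  have hox := H.appropriate_of_isCentralAdjoint hG h0 ho.1 ho.2.1 hl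
  set E := Linf T (fun τ => (WithLp.toLp 2 (xo τ - x p τ, lo τ - lam p τ) :
          WithLp 2 (P.State × P.State))) with hE
  have hc : ContinuousOn (fun τ => (WithLp.toLp 2 (xo τ - x p τ, lo τ - lam p τ) :
      WithLp 2 (P.State × P.State))) (Icc 0 T) :=
    (WithLp.prod_continuous_toLp 2 P.State P.State).comp_continuousOn
      ((hox.1.sub hb.1).prodMk (hox.2.1.sub hb.2.1))
  have hE0 : 0 ≤ E := Linf_nonneg _
  have hxE : ∀ τ ∈ Icc 0 T, ‖xo τ - x p τ‖ ≤ E := fun τ hτ =>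
    (norm_fst_le_toLp_prod _ _).trans (norm_le_Linf hc hτ)
  have hlE : ∀ τ ∈ Icc 0 T, ‖lo τ - lam p τ‖ ≤ E := fun τ hτ =>
    (norm_snd_le_toLp_prod _ _).trans (norm_le_Linf hc hτ)
  have hclose := inputsClose_of_law H.L_pos.le hT.le hlaw h0 hox hb
    (Or.inr (H.isExtremalStep hG h0 hcomplete ho hl)) (Or.inl hstep) hox hq hxE hlE
  have hstk := hstep.stackedStep hP hT.le hb.1 hb.2.1
  have hcon := H.step_contraction hG h0 hox hb
    (stackedStep_of_isCentralAdjoint hP ho.1 ho.2.1 hl) hstk hxE hlE hclose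
  -- the stopping criterion, in stacked form
  have hδ : ∀ τ ∈ Icc 0 T, ‖(WithLp.toLp 2 (x (p + 1) τ - x p τ, lam (p + 1) τ - lam p τ) :
      WithLp 2 (P.State × P.State))‖ ≤ d * ‖x₀‖ := by
    intro τ hτ
    refine abs_le_of_sq_le_sq' ?_ (by positivity) |>.2
    -- The agentwise thresholds `d ‖x₀ i‖` square and sum to `d² ‖x₀‖²`, so the distributed
    -- criterion implies the stacked one with the same `d`.
    rw [norm_sq_toLp_prod, mul_pow, PiLp.norm_sq_eq_of_L2, PiLp.norm_sq_eq_of_L2,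
      PiLp.norm_sq_eq_of_L2, ← Finset.sum_add_distrib, Finset.mul_sum]
    refine Finset.sum_le_sum fun i _ => ?_
    have hci : ContinuousOn (fun τ => (WithLp.toLp 2 (x (p + 1) τ i - x p τ i,
        lam (p + 1) τ i - lam p τ i) : WithLp 2 (P.AState i × P.AState i))) (Icc 0 T) := by
      have hcomp : ∀ {y : ℝ → P.State}, ContinuousOn y (Icc 0 T) →
          ContinuousOn (fun τ => y τ i) (Icc 0 T) := fun hy =>
        (PiLp.continuous_apply 2 P.AState i).comp_continuousOn hy
      exact (WithLp.prod_continuous_toLp 2 _ _).comp_continuousOn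
        (((hcomp hq.1).sub (hcomp hb.1)).prodMk ((hcomp hq.2.1).sub (hcomp hb.2.1)))
    have h1 := (norm_le_Linf hci hτ).trans (hquit i)
    have h2 := pow_le_pow_left₀ (norm_nonneg _) h1 2
    rwa [norm_sq_toLp_prod, mul_pow] at h2
  have hE2 : E ≤ d * ‖x₀‖ + 1 / 2 * E := by
    refine Linf_le hT.le fun τ hτ => ?_
    -- The error before the last iteration is its increment plus the error after it.
    have hsum : (WithLp.toLp 2 (xo τ - x p τ, lo τ - lam p τ) : WithLp 2 (P.State × P.State)) =
        WithLp.toLp 2 (x (p + 1) τ - x p τ, lam (p + 1) τ - lam p τ) +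
        WithLp.toLp 2 (xo τ - x (p + 1) τ, lo τ - lam (p + 1) τ) := by
      rw [← WithLp.toLp_add, Prod.mk_add_mk]
      congr 2 <;> abel
    rw [hsum]
    exact (norm_add_le _ _).trans (add_le_add (hδ τ hτ)
      ((norm_toLp_prod_le _ _).trans (hcon τ hτ)))
  have hadm : P.Admissible T (u (p + 1)) := ⟨hstk.measurable, hstk.mem⟩
  have hbc := H.traj_bounds (hG x₀ h0) hadm hxc
  have hbo := H.traj_bounds (hG x₀ h0) ho.1 ho.2.1
  set A := Linf T (fun τ => xc τ - xo τ) with hA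
  have hA0 : 0 ≤ A := Linf_nonneg _
  have hAx : ∀ τ ∈ Icc 0 T, ‖xc τ - xo τ‖ ≤ A := fun τ hτ =>
    norm_le_Linf (q := fun τ => xc τ - xo τ) (hxc.1.sub ho.2.1.1) hτ
  have hA1 : A ≤ C * (A + 3 * L * E) * T := by
    refine Linf_le hT.le fun τ hτ => ?_
    have := SolvesForward.norm_sub_le hxc ho.2.1 (K := C * (A + 3 * L * E)) (by positivity)
      (hadm.intervalIntegrable_f hP hT.le hxc.1) (ho.1.intervalIntegrable_f hP hT.le ho.2.1.1) (by
        filter_upwards [hclose] with s hs hsI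
        refine (H.consts.norm_f_sub_le (hbc s hsI).2.2 (hbo s hsI).2.2 (hadm.2 s hsI)
          (ho.1.2 s hsI)).trans ?_
        have h1 := hs hsI
        have h2 := hcon s hsI
        have h3 := norm_nonneg (lo s - lam (p + 1) s)
        have h4 : ‖u (p + 1) s - us s‖ ≤ 3 * L * E := by
          rw [norm_sub_rev]
          refine h1.trans ?_
          have : ‖xo s - x (p + 1) s‖ + 2 * E ≤ 3 * E := by linarith
          nlinarith
        exact mul_le_mul_of_nonneg_left (add_le_add (hAx s hsI) h4) hC.le) τ hτ
    simpa using this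
  have c1 : C * T * A ≤ 1 / 2 * A := mul_le_mul_of_nonneg_right H.le_half hA0
  have c2 : 6 * C * T * L * E ≤ 6 * C * T * L * (2 * (d * ‖x₀‖)) := by
    have : 0 ≤ 6 * C * T * L := by positivity
    exact mul_le_mul_of_nonneg_left (by linarith) this
  nlinarith

end AgentNetwork

/-! ### The optimal cost, tails and concatenations of trajectories. -/

namespace AgentNetwork

variable {N : ℕ} {P : AgentNetwork N} {ml Ml mV MV : ℝ}

section Cost

variable (hP : P.IsRegular ml Ml mV MV)
include hP

theorem IsRegular.l_nonneg (x : P.State) (u : P.Input) : 0 ≤ P.l x u :=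
  (mul_nonneg hP.ml_pos.le (by positivity)).trans (hP.l_lower x u)

theorem IsRegular.V_nonneg (x : P.State) : 0 ≤ P.V x :=
  (mul_nonneg hP.mV_pos.le (by positivity)).trans (hP.V_lower x)

theorem IsRegular.cost_nonneg {T : ℝ} (hT : 0 ≤ T) (u : ℝ → P.Input) (x : ℝ → P.State) :
    0 ≤ P.cost T u x :=
  add_nonneg (hP.V_nonneg _) (intervalIntegral.integral_nonneg hT fun _ _ => hP.l_nonneg _ _)

theorem IsRegular.optCost_nonneg {T : ℝ} (hT : 0 ≤ T) (x₀ : P.State) : 0 ≤ P.optCost T x₀ := by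
  refine Real.sInf_nonneg ?_
  rintro _ ⟨u, x, -, -, rfl⟩
  exact hP.cost_nonneg hT u x

theorem IsRegular.optCost_le {T : ℝ} (hT : 0 ≤ T) {x₀ : P.State} {u : ℝ → P.Input}
    {x : ℝ → P.State} (hu : P.Admissible T u) (hx : P.IsTraj T x₀ u x) :
    P.optCost T x₀ ≤ P.cost T u x := by
  refine csInf_le ⟨0, ?_⟩ ⟨u, x, hu, hx, rfl⟩
  rintro _ ⟨u, x, -, -, rfl⟩
  exact hP.cost_nonneg hT u x

theorem IsRegular.optCost_eq {T : ℝ} (hT : 0 ≤ T) {x₀ : P.State} {u : ℝ → P.Input}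
    {x : ℝ → P.State} (h : P.IsOptimal T x₀ u x) : P.optCost T x₀ = P.cost T u x := by
  refine le_antisymm (hP.optCost_le hT h.1 h.2.1) (le_csInf ⟨_, u, x, h.1, h.2.1, rfl⟩ ?_)
  rintro _ ⟨v, y, hv, hy, rfl⟩
  exact h.2.2 v y hv hy

theorem IsRegular.admissible_zero (T : ℝ) : P.Admissible T fun _ => 0 :=
  ⟨measurable_const, fun _ _ => zero_mem_inputSet hP⟩

theorem IsRegular.optCost_zero {T : ℝ} (hT : 0 ≤ T) : P.optCost T 0 = 0 := by
  refine le_antisymm ?_ (hP.optCost_nonneg hT 0)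
  have htraj : P.IsTraj T 0 (fun _ => 0) (fun _ => 0) := by
    refine ⟨continuousOn_const, fun τ _ => ?_⟩
    simp [f_zero_zero hP]
  refine (hP.optCost_le hT (hP.admissible_zero T) htraj).trans ?_
  have h1 : P.V 0 ≤ 0 := (hP.V_upper 0).trans (by simp)
  have h2 : P.l 0 0 = 0 := le_antisymm ((hP.l_upper 0 0).trans (by simp)) (hP.l_nonneg 0 0)
  simpa [cost, h2] using h1

end Cost

section Trajectories

theorem Admissible.mono {s t : ℝ} (hst : s ≤ t) {u : ℝ → P.Input}
    (h : P.Admissible t u) : P.Admissible s u :=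
  ⟨h.1, fun τ hτ => h.2 τ ⟨hτ.1, hτ.2.trans hst⟩⟩

theorem IsTraj.mono {s t : ℝ} (hst : s ≤ t) {x₀ : P.State} {u : ℝ → P.Input} {x : ℝ → P.State}
    (h : P.IsTraj t x₀ u x) : P.IsTraj s x₀ u x :=
  ⟨h.1.mono (Icc_subset_Icc_right hst), fun τ hτ => h.2 τ ⟨hτ.1, hτ.2.trans hst⟩⟩

theorem Admissible.tail {s t : ℝ} (hs : 0 ≤ s) {u : ℝ → P.Input}
    (h : P.Admissible t u) : P.Admissible (t - s) fun τ => u (τ + s) :=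
  ⟨h.1.comp (measurable_id.add_const s), fun τ hτ =>
    h.2 (τ + s) ⟨by linarith [hτ.1], by linarith [hτ.2]⟩⟩

/-- Concatenation of two functions at time `s`. -/
def concat {A : Type*} (s : ℝ) (p q : ℝ → A) : ℝ → A := fun τ => if τ ≤ s then p τ else q (τ - s)

theorem concat_of_le {A : Type*} {s τ : ℝ} (p q : ℝ → A) (h : τ ≤ s) : concat s p q τ = p τ :=
  if_pos h

theorem concat_of_lt {A : Type*} {s τ : ℝ} (p q : ℝ → A) (h : s < τ) :
    concat s p q τ = q (τ - s) :=
  if_neg (not_le.2 h)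

theorem Admissible.concat {s t : ℝ} {u v : ℝ → P.Input}
    (hu : P.Admissible s u) (hv : P.Admissible t v) : P.Admissible (s + t) (concat s u v) := by
  refine ⟨Measurable.ite measurableSet_Iic hu.1 (hv.1.comp (measurable_id.sub_const s)),
    fun τ hτ => ?_⟩
  rcases le_or_gt τ s with h | h
  · rw [concat_of_le _ _ h]
    exact hu.2 τ ⟨hτ.1, h⟩
  · rw [concat_of_lt _ _ h]
    exact hv.2 _ ⟨by linarith, by linarith [hτ.2]⟩

variable (hP : P.IsRegular ml Ml mV MV)
include hP

theorem IsTraj.tail {s t : ℝ} (hs : 0 ≤ s) (hst : s ≤ t) {x₀ : P.State} {u : ℝ → P.Input}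
    {x : ℝ → P.State} (hu : P.Admissible t u) (h : P.IsTraj t x₀ u x) :
    P.IsTraj (t - s) (x s) (fun τ => u (τ + s)) fun τ => x (τ + s) := by
  have ht : 0 ≤ t := hs.trans hst
  have hi := hu.intervalIntegrable_f hP ht h.1
  have hm : MapsTo (fun τ : ℝ => τ + s) (Icc 0 (t - s)) (Icc 0 t) := fun τ hτ =>
    ⟨by linarith [hτ.1], by linarith [hτ.2]⟩
  refine ⟨h.1.comp (by fun_prop) hm, fun τ hτ => ?_⟩
  have h1 := h.2 (τ + s) (hm hτ)
  have h2 := h.2 s ⟨hs, hst⟩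
  have h3 := intervalIntegral.integral_comp_add_right (a := 0) (b := τ)
    (fun r => P.f (x r) (u r)) s
  have hsub : ∀ {a b}, a ∈ Icc 0 t → b ∈ Icc 0 t →
      IntervalIntegrable (fun r => P.f (x r) (u r)) volume a b := fun ha hb =>
    hi.mono_set (by rw [uIcc_of_le ht]; exact uIcc_subset_Icc ha hb)
  have h4 := intervalIntegral.integral_add_adjacent_intervals
    (hsub ⟨le_rfl, ht⟩ ⟨hs, hst⟩) (hsub ⟨hs, hst⟩ (hm hτ))
  show x (τ + s) = x s + ∫ r in (0 : ℝ)..τ, P.f (x (r + s)) (u (r + s))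
  rw [h1, ← h4, h3, zero_add, ← add_assoc]
  congr 1
  exact h2.symm

omit hP in
-- A general integrand lets the lemma serve both the state equation (`Φ = P.f`) and the accumulated
-- stage cost (`Φ = P.l`).
theorem integral_concat {B : Type*} [NormedAddCommGroup B] [NormedSpace ℝ B]
    {Φ : P.State → P.Input → B} {s t : ℝ} (hs : 0 ≤ s) (ht : 0 ≤ t)
    {u v : ℝ → P.Input} {x y : ℝ → P.State} {τ : ℝ} (hτ : τ ∈ Icc 0 t)
    (hi : IntervalIntegrable (fun r => Φ (x r) (u r)) volume 0 s)
    (hi' : IntervalIntegrable (fun r => Φ (y r) (v r)) volume 0 t) :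
    ∫ r in (0 : ℝ)..(s + τ), Φ (concat s x y r) (concat s u v r) =
      (∫ r in (0 : ℝ)..s, Φ (x r) (u r)) + ∫ r in (0 : ℝ)..τ, Φ (y r) (v r) := by
  have e1 : EqOn (fun r => Φ (x r) (u r)) (fun r => Φ (concat s x y r) (concat s u v r))
      (uIoc 0 s) := by
    intro r hr
    rw [uIoc_of_le hs] at hr
    simp only [concat_of_le _ _ hr.2]
  have e2 : EqOn (fun r => Φ (y (r - s)) (v (r - s)))
      (fun r => Φ (concat s x y r) (concat s u v r)) (uIoc s (s + τ)) := by
    intro r hr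
    rw [uIoc_of_le (by linarith [hτ.1])] at hr
    simp only [concat_of_lt _ _ hr.1]
  have hi'' : IntervalIntegrable (fun r => Φ (y r) (v r)) volume 0 τ :=
    hi'.mono_set (by rw [uIcc_of_le ht]; exact uIcc_subset_Icc ⟨le_rfl, ht⟩ hτ)
  have i1 := hi.congr e1
  have i2 : IntervalIntegrable (fun r => Φ (y (r - s)) (v (r - s))) volume s (s + τ) := by
    have := hi''.comp_sub_right s
    rwa [zero_add, add_comm τ s] at this
  rw [← intervalIntegral.integral_add_adjacent_intervals i1 (i2.congr e2)]
  congr 1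
  · exact (intervalIntegral.integral_congr_ae (Eventually.of_forall fun r hr => (e1 hr).symm))
  · rw [intervalIntegral.integral_congr_ae (Eventually.of_forall fun r hr => (e2 hr).symm),
      intervalIntegral.integral_comp_sub_right (fun r => Φ (y r) (v r))]
    simp

theorem IsTraj.concat {s t : ℝ} (hs : 0 ≤ s) (ht : 0 ≤ t) {x₀ : P.State} {u v : ℝ → P.Input}
    {x y : ℝ → P.State} (hu : P.Admissible s u) (hv : P.Admissible t v)
    (hx : P.IsTraj s x₀ u x) (hy : P.IsTraj t (x s) v y) :
    P.IsTraj (s + t) x₀ (concat s u v) (concat s x y) := by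
  have hi := hu.intervalIntegrable_f hP hs hx.1
  have hi' := hv.intervalIntegrable_f hP ht hy.1
  have hy0 : y 0 = x s := SolvesForward.apply_zero ht hy
  refine ⟨?_, fun τ hτ => ?_⟩
  · have h1 : ContinuousOn (AgentNetwork.concat s x y) (Icc 0 s) :=
      hx.1.congr fun τ hτ => concat_of_le _ _ hτ.2
    have h2 : ContinuousOn (AgentNetwork.concat s x y) (Icc s (s + t)) := by
      have : ContinuousOn (fun τ => y (τ - s)) (Icc s (s + t)) :=
        hy.1.comp (by fun_prop) fun τ hτ => ⟨by linarith [hτ.1], by linarith [hτ.2]⟩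
      refine this.congr fun τ hτ => ?_
      rcases hτ.1.eq_or_lt with rfl | h
      · simp [concat_of_le _ _ le_rfl, hy0]
      · exact concat_of_lt _ _ h
    have := h1.union_of_isClosed h2 isClosed_Icc isClosed_Icc
    rwa [Icc_union_Icc_eq_Icc hs (by linarith)] at this
  · rcases le_or_gt τ s with h | h
    · rw [concat_of_le _ _ h, hx.2 τ ⟨hτ.1, h⟩]
      congr 1
      refine intervalIntegral.integral_congr fun r hr => ?_
      rw [uIcc_of_le hτ.1] at hr
      simp only [concat_of_le _ _ (hr.2.trans h)]
    · have hτ' : τ - s ∈ Icc 0 t := ⟨by linarith, by linarith [hτ.2]⟩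
      rw [concat_of_lt _ _ h, hy.2 _ hτ', hx.2 s ⟨hs, le_rfl⟩, add_assoc]
      congr 1
      have := integral_concat (Φ := P.f) hs ht hτ' hi hi'
      rw [add_sub_cancel] at this
      exact this.symm

end Trajectories

end AgentNetwork

namespace AgentNetwork

variable {N : ℕ} {P : AgentNetwork N} {ml Ml mV MV : ℝ} {rx rl ρ L R C T : ℝ}
  (H : P.ShortHorizon rx rl ρ L R C T)

/-! ### The stage cost controls displacement and initial state. -/

section Energy

variable (hP : P.IsRegular ml Ml mV MV) (hc : P.HasConstants R C) (hR : 0 ≤ R) {t : ℝ}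
  {x₀ : P.State} {u : ℝ → P.Input} {x : ℝ → P.State} (hu : P.Admissible t u)
  (hx : P.IsTraj t x₀ u x) (hxR : ∀ s ∈ Icc 0 t, ‖x s‖ ≤ R)

include hP hu hx

theorem IsTraj.integral_l_mono {τ : ℝ} (hτ : τ ∈ Icc 0 t) :
    ∫ s in (0 : ℝ)..τ, P.l (x s) (u s) ≤ ∫ s in (0 : ℝ)..t, P.l (x s) (u s) :=
  intervalIntegral.integral_mono_interval le_rfl hτ.1 hτ.2
    (Eventually.of_forall fun _ => hP.l_nonneg _ _)
    (hu.intervalIntegrable_l hP (hτ.1.trans hτ.2) hx.1)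

include hc hR hxR

/-- The displacement along a trajectory is controlled by the accumulated stage cost. -/
theorem IsTraj.norm_sub_sq_le {τ : ℝ} (hτ : τ ∈ Icc 0 t) :
    ‖x τ - x₀‖ ^ 2 ≤ 2 * C ^ 2 * t / ml * ∫ s in (0 : ℝ)..t, P.l (x s) (u s) := by
  have hC : 0 ≤ C := by linarith [hc.one_le]
  have hml := hP.ml_pos
  have ht : 0 ≤ t := hτ.1.trans hτ.2
  have hxτ := hx.mono hτ.2
  have huτ := hu.mono hτ.2
  have ig : IntervalIntegrable (fun s => ‖x s‖ + ‖u s‖) volume 0 τ :=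
    huτ.intervalIntegrable_comp hP hτ.1 hxτ.1 (Φ := fun p => ‖p.1‖ + ‖p.2‖) (by fun_prop)
  have ig2 : IntervalIntegrable (fun s => (‖x s‖ + ‖u s‖) ^ 2) volume 0 τ :=
    huτ.intervalIntegrable_comp hP hτ.1 hxτ.1 (Φ := fun p => (‖p.1‖ + ‖p.2‖) ^ 2) (by fun_prop)
  have il := huτ.intervalIntegrable_l hP hτ.1 hxτ.1
  have h1 : ‖x τ - x₀‖ ≤ C * ∫ s in (0 : ℝ)..τ, (‖x s‖ + ‖u s‖) := by
    rw [hx.2 τ hτ, add_sub_cancel_left, ← intervalIntegral.integral_const_mul]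
    refine intervalIntegral.norm_integral_le_of_norm_le hτ.1 (Eventually.of_forall fun s hs => ?_)
      (ig.const_mul C)
    have hs' : s ∈ Icc 0 t := ⟨hs.1.le, hs.2.trans hτ.2⟩
    exact hc.norm_f_le_add hP hR (hxR s hs') (hu.2 s hs')
  -- Cauchy–Schwarz produces the integral of a square, which the quadratic lower bound on the stage
  -- cost dominates.
  have h2 := sq_integral_le hτ.1 ig ig2
  have h3 : ∫ s in (0 : ℝ)..τ, (‖x s‖ + ‖u s‖) ^ 2 ≤
      2 / ml * ∫ s in (0 : ℝ)..τ, P.l (x s) (u s) := by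
    rw [← intervalIntegral.integral_const_mul]
    refine intervalIntegral.integral_mono_on hτ.1 ig2 (il.const_mul _) fun s _ => ?_
    rw [div_mul_eq_mul_div, le_div_iff₀ hml]
    nlinarith [hP.l_lower (x s) (u s), mul_nonneg hml.le (sq_nonneg (‖x s‖ - ‖u s‖))]
  have h4 := hx.integral_l_mono hP hu hτ
  have h0 : 0 ≤ ∫ s in (0 : ℝ)..τ, P.l (x s) (u s) :=
    intervalIntegral.integral_nonneg hτ.1 fun _ _ => hP.l_nonneg _ _
  calc ‖x τ - x₀‖ ^ 2 ≤ (C * ∫ s in (0 : ℝ)..τ, (‖x s‖ + ‖u s‖)) ^ 2 :=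
        pow_le_pow_left₀ (norm_nonneg _) h1 2
    _ = C ^ 2 * (∫ s in (0 : ℝ)..τ, (‖x s‖ + ‖u s‖)) ^ 2 := by ring
    _ ≤ C ^ 2 * ((τ - 0) * (2 / ml * ∫ s in (0 : ℝ)..τ, P.l (x s) (u s))) := by
        gcongr
        refine h2.trans ?_
        have : 0 ≤ τ - 0 := by linarith [hτ.1]
        gcongr
    _ ≤ C ^ 2 * (t * (2 / ml * ∫ s in (0 : ℝ)..t, P.l (x s) (u s))) := by
        have : τ - 0 ≤ t := by linarith [hτ.2]
        gcongr
    _ = _ := by ring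

/-- The stage cost accumulated over `[0,t]` bounds the initial state. -/
theorem IsTraj.sq_norm_le_integral (ht : 0 < t) :
    t * ‖x₀‖ ^ 2 ≤ (2 + 4 * C ^ 2 * t ^ 2) / ml * ∫ s in (0 : ℝ)..t, P.l (x s) (u s) := by
  have hml := hP.ml_pos
  set I := ∫ s in (0 : ℝ)..t, P.l (x s) (u s) with hI
  -- The initial state is compared with every later state, and the result is integrated over
  -- `[0,t]`.
  have h1 : ∀ s ∈ Icc 0 t, ‖x₀‖ ^ 2 ≤ 2 / ml * P.l (x s) (u s) + 4 * C ^ 2 * t / ml * I := by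
    intro s hs
    have h2 := hx.norm_sub_sq_le hP hc hR hu hxR hs
    have h3 : ‖x₀‖ ≤ ‖x s‖ + ‖x s - x₀‖ := by
      rw [norm_sub_rev]
      exact norm_le_norm_add_norm_sub' x₀ (x s)
    have h4 : ‖x₀‖ ^ 2 ≤ 2 * ‖x s‖ ^ 2 + 2 * ‖x s - x₀‖ ^ 2 := by
      nlinarith [norm_nonneg x₀, sq_nonneg (‖x s‖ - ‖x s - x₀‖)]
    have h5 : 2 * ‖x s‖ ^ 2 ≤ 2 / ml * P.l (x s) (u s) := by
      rw [div_mul_eq_mul_div, le_div_iff₀ hml]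
      nlinarith [hP.l_lower (x s) (u s), mul_nonneg hml.le (sq_nonneg ‖u s‖)]
    calc _ ≤ 2 / ml * P.l (x s) (u s) + 2 * (2 * C ^ 2 * t / ml * I) := by linarith
      _ = _ := by ring
  have il := hu.intervalIntegrable_l hP ht.le hx.1
  have h2 := intervalIntegral.integral_mono_on ht.le (by simp)
    ((il.const_mul (2 / ml)).add (by simp)) h1
  rw [intervalIntegral.integral_const, intervalIntegral.integral_add (il.const_mul _) (by simp),
    intervalIntegral.integral_const_mul, intervalIntegral.integral_const, smul_eq_mul, smul_eq_mul,
    sub_zero, ← hI] at h2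
  refine h2.trans_eq ?_
  field_simp

end Energy

/-! ### Quadratic bounds on the optimal cost. -/

section Bounds

variable (hP : P.IsRegular ml Ml mV MV)
include H hP

/-- The initial state is at most the final state plus the displacement; the terminal cost controls
the former and the stage cost the latter. -/
theorem ShortHorizon.sq_norm_le_optCost {x₀ : P.State} (h0 : ‖x₀‖ ≤ ρ) {u : ℝ → P.Input}
    {x : ℝ → P.State} (ho : P.IsOptimal T x₀ u x) :
    ‖x₀‖ ^ 2 ≤ (2 / mV + 4 * C ^ 2 * T / ml) * P.optCost T x₀ := by
  have hT := H.T_pos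
  have hml := hP.ml_pos
  have hmV := hP.mV_pos
  have hb := H.traj_bounds h0 ho.1 ho.2.1
  have h2 := ho.2.1.norm_sub_sq_le hP H.consts (by linarith [H.two_le]) ho.1
    (fun s hs => (hb s hs).2.2) ⟨hT.le, le_rfl⟩
  rw [hP.optCost_eq hT.le ho]
  have h3 : ‖x₀‖ ≤ ‖x T‖ + ‖x T - x₀‖ := by
    rw [norm_sub_rev]
    exact norm_le_norm_add_norm_sub' x₀ (x T)
  have h4 : ‖x₀‖ ^ 2 ≤ 2 * ‖x T‖ ^ 2 + 2 * ‖x T - x₀‖ ^ 2 := by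
    nlinarith [norm_nonneg x₀, sq_nonneg (‖x T‖ - ‖x T - x₀‖)]
  have h5 : 2 * ‖x T‖ ^ 2 ≤ 2 / mV * P.V (x T) := by
    rw [div_mul_eq_mul_div, le_div_iff₀ hmV]
    linarith [hP.V_lower (x T)]
  have h6 : 0 ≤ ∫ s in (0 : ℝ)..T, P.l (x s) (u s) :=
    intervalIntegral.integral_nonneg hT.le fun _ _ => hP.l_nonneg _ _
  have h7 := hP.V_nonneg (x T)
  have h8 : 0 ≤ 2 / mV * ∫ s in (0 : ℝ)..T, P.l (x s) (u s) := by positivity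
  have h9 : 0 ≤ 4 * C ^ 2 * T / ml * P.V (x T) := by positivity
  have h10 : 2 * (2 * C ^ 2 * T / ml * ∫ s in (0 : ℝ)..T, P.l (x s) (u s)) =
    4 * C ^ 2 * T / ml * ∫ s in (0 : ℝ)..T, P.l (x s) (u s) := by ring
  rw [cost, add_mul, mul_add, mul_add]
  linarith

/-- It supplies `‖x*(τ)‖ ≤ S √J*`, the source of the mixed term `b √J* ‖Δx_c‖` in the descent
inequality. -/
theorem ShortHorizon.sq_norm_traj_le {x₀ : P.State} (h0 : ‖x₀‖ ≤ ρ) {u : ℝ → P.Input}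
    {x : ℝ → P.State} (ho : P.IsOptimal T x₀ u x) {τ : ℝ} (hτ : τ ∈ Icc 0 T) :
    ‖x τ‖ ^ 2 ≤ (2 * (2 / mV + 4 * C ^ 2 * T / ml) + 4 * C ^ 2 * T / ml) * P.optCost T x₀ := by
  have hT := H.T_pos
  have hml := hP.ml_pos
  have hb := H.traj_bounds h0 ho.1 ho.2.1
  have h1 := H.sq_norm_le_optCost hP h0 ho
  have h2 := ho.2.1.norm_sub_sq_le hP H.consts (by linarith [H.two_le]) ho.1
    (fun s hs => (hb s hs).2.2) hτ
  have h3 : ‖x τ‖ ≤ ‖x₀‖ + ‖x τ - x₀‖ := norm_le_norm_add_norm_sub' _ _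
  have h4 : ‖x τ‖ ^ 2 ≤ 2 * ‖x₀‖ ^ 2 + 2 * ‖x τ - x₀‖ ^ 2 := by
    nlinarith [norm_nonneg (x τ), sq_nonneg (‖x₀‖ - ‖x τ - x₀‖)]
  have h5 : 2 * C ^ 2 * T / ml * (∫ s in (0 : ℝ)..T, P.l (x s) (u s)) ≤
      2 * C ^ 2 * T / ml * P.optCost T x₀ := by
    rw [hP.optCost_eq hT.le ho, cost]
    have := hP.V_nonneg (x T)
    gcongr
    linarith
  calc _ ≤ 2 * ((2 / mV + 4 * C ^ 2 * T / ml) * P.optCost T x₀) +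
        2 * (2 * C ^ 2 * T / ml * P.optCost T x₀) := by linarith
    _ = _ := by ring

/-- The zero input is a competitor. Since `f` vanishes at the origin and `C * T ≤ 1/2`, its
trajectory has norm at most `2 ‖x₀‖`. -/
theorem ShortHorizon.optCost_le_sq_norm
    (hcomplete : ∀ x₀ u, P.Admissible T u → ∃ x, P.IsTraj T x₀ u x)
    {x₀ : P.State} (h0 : ‖x₀‖ ≤ ρ) :
    P.optCost T x₀ ≤ (4 * MV + 4 * T * Ml) * ‖x₀‖ ^ 2 := by
  have hT := H.T_pos
  have hadm := hP.admissible_zero T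
  have hMl : 0 ≤ Ml := hP.ml_pos.le.trans hP.ml_le
  have hMV : 0 ≤ MV := hP.mV_pos.le.trans hP.mV_le
  obtain ⟨y, hy⟩ := hcomplete x₀ _ hadm
  have hb := H.traj_bounds h0 hadm hy
  set A := Linf T y with hA
  have hA0 : 0 ≤ A := Linf_nonneg y
  have hyA : ∀ τ ∈ Icc 0 T, ‖y τ‖ ≤ A := fun τ hτ => norm_le_Linf hy.1 hτ
  have hA1 : A ≤ ‖x₀‖ + C * A * T := by
    refine Linf_le hT.le fun τ hτ => ?_
    rw [hy.2 τ hτ]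
    refine (norm_add_le _ _).trans (add_le_add le_rfl ?_)
    refine (intervalIntegral.norm_integral_le_of_norm_le_const (C := C * A) fun s hs => ?_).trans ?_
    · rw [uIoc_of_le hτ.1] at hs
      have hs' : s ∈ Icc 0 T := ⟨hs.1.le, hs.2.trans hτ.2⟩
      refine (H.consts.norm_f_le_add hP (by linarith [H.two_le]) (hb s hs').2.2
        (hadm.2 s hs')).trans ?_
      rw [norm_zero, add_zero]
      exact mul_le_mul_of_nonneg_left (hyA s hs') H.C_pos.le
    · rw [sub_zero, abs_of_nonneg hτ.1]
      exact mul_le_mul_of_nonneg_left hτ.2 (mul_nonneg H.C_pos.le hA0)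
  have hA2 : A ≤ 2 * ‖x₀‖ := by
    have := mul_le_mul_of_nonneg_right H.le_half hA0
    linarith
  have hy2 : ∀ τ ∈ Icc 0 T, ‖y τ‖ ^ 2 ≤ 4 * ‖x₀‖ ^ 2 := fun τ hτ => by
    have := pow_le_pow_left₀ (norm_nonneg _) ((hyA τ hτ).trans hA2) 2
    linarith
  refine (hP.optCost_le hT.le hadm hy).trans ?_
  have h1 : P.V (y T) ≤ MV * (4 * ‖x₀‖ ^ 2) :=
    (hP.V_upper _).trans (mul_le_mul_of_nonneg_left (hy2 T ⟨hT.le, le_rfl⟩) hMV)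
  have h2 : ∫ s in (0 : ℝ)..T, P.l (y s) 0 ≤ ∫ s in (0 : ℝ)..T, Ml * (4 * ‖x₀‖ ^ 2) := by
    refine intervalIntegral.integral_mono_on hT.le (hadm.intervalIntegrable_l hP hT.le hy.1)
      (by simp) fun s hs => (hP.l_upper _ _).trans ?_
    refine mul_le_mul_of_nonneg_left ?_ hMl
    simpa using hy2 s hs
  rw [intervalIntegral.integral_const, smul_eq_mul, sub_zero] at h2
  rw [cost]
  linarith

end Bounds

/-! ### Terminal phase by sample-and-hold, and decrease along the optimum. -/

section TerminalController

variable (hP : P.IsRegular ml Ml mV MV)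
  (hcomplete : ∀ x₀ u, P.Admissible T u → ∃ x, P.IsTraj T x₀ u x)
include H hP hcomplete

/-- Applying a constant input that satisfies the control-Lyapunov inequality at the initial state
for a time `h` violates the integrated inequality by `O(h²)` only. -/
theorem ShortHorizon.exists_constant_input {x : P.State} (hx : ‖x‖ ≤ 1) {v : P.Input}
    (hv : v ∈ P.inputSet) (hclf : inner ℝ (gradient P.V x) (P.f x v) + P.l x v ≤ 0) {h : ℝ}
    (hh : 0 ≤ h) (hhT : h ≤ T) :
    ∃ y, P.IsTraj h x (fun _ => v) y ∧
      P.V (y h) + ∫ s in (0 : ℝ)..h, P.l (y s) v ≤ P.V x + 3 * C ^ 3 * h ^ 2 := by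
  have hC1 := H.consts.one_le
  have hC := H.C_pos
  have hadm : ∀ t, P.Admissible t fun _ => v := fun t => ⟨measurable_const, fun _ _ => hv⟩
  obtain ⟨y, hyT⟩ := hcomplete x _ (hadm T)
  have hy := hyT.mono hhT
  have hb : ∀ s ∈ Icc 0 h, ‖y s - x‖ ≤ C * h := fun s hs =>
    (H.norm_traj_sub_le (r := 1) H.lt_one (by linarith [H.two_le]) (hadm T) hyT s
      ⟨hs.1, hs.2.trans hhT⟩).trans (mul_le_mul_of_nonneg_left hs.2 hC.le)
  have hCh : C * h ≤ 1 := (mul_le_mul_of_nonneg_left hhT hC.le).trans H.lt_one.le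
  have hxR : ‖x‖ ≤ R := hx.trans (by linarith [H.two_le])
  have hyR : ∀ s ∈ Icc 0 h, ‖y s‖ ≤ R := fun s hs =>
    norm_le_of_norm_sub_le hx (hb s hs) (by linarith [H.two_le])
  have hhm : h ∈ Icc 0 h := ⟨hh, le_rfl⟩
  refine ⟨y, hy, ?_⟩
  have hif := (hadm h).intervalIntegrable_f hP hh hy.1
  have hil := (hadm h).intervalIntegrable_l hP hh hy.1
  have h1 := (abs_le.1 (H.consts.V_taylor hP hxR (hyR h hhm))).2
  have h2 : ‖y h - x - h • P.f x v‖ ≤ C * (C * h) * h := by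
    have e : y h - x - h • P.f x v =
        (∫ s in (0 : ℝ)..h, P.f (y s) v) - ∫ s in (0 : ℝ)..h, P.f x v := by
      rw [hy.2 h hhm, add_sub_cancel_left, intervalIntegral.integral_const, sub_zero]
    rw [e]
    have := norm_integral_sub_le (T := h) (K := C * (C * h)) ⟨le_rfl, hh⟩ hhm hh hif
      (g := fun _ => P.f x v) (by simp) (Eventually.of_forall fun s hs => by
        refine (H.consts.norm_f_sub_le (hyR s hs) hxR hv hv).trans ?_
        rw [sub_self, norm_zero, add_zero]
        exact mul_le_mul_of_nonneg_left (hb s hs) hC.le)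
    rwa [sub_zero] at this
  have h3 : ∫ s in (0 : ℝ)..h, P.l (y s) v ≤ h * P.l x v + C * (C * h) * h := by
    have := intervalIntegral.integral_mono_on hh hil
      (g := fun _ => P.l x v + C * (C * h)) (by simp) fun s hs => by
        have h4 := H.consts.l.2 (y s, v) (x, v) (max_le (hyR s hs) (H.consts.input v hv))
          (max_le hxR (H.consts.input v hv))
        have h5 : ‖((y s, v) : P.State × P.Input) - (x, v)‖ ≤ C * h := by
          rw [Prod.mk_sub_mk, sub_self]
          exact max_le (hb s hs) (by
            rw [norm_zero]; exact mul_nonneg hC.le hh)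
        have h6 := (le_abs_self _).trans (h4.trans (mul_le_mul_of_nonneg_left h5 hC.le))
        simp only at h6
        linarith
    rw [intervalIntegral.integral_const, smul_eq_mul, sub_zero] at this
    linarith
  have h4 : inner ℝ (gradient P.V x) (y h - x) ≤
      h * inner ℝ (gradient P.V x) (P.f x v) + C * (C * (C * h) * h) := by
    have e : y h - x = h • P.f x v + (y h - x - h • P.f x v) := by abel
    rw [e, inner_add_right, inner_smul_right]
    refine add_le_add le_rfl ((real_inner_le_norm _ _).trans ?_)
    exact mul_le_mul (H.consts.gradV.1 x hxR) h2 (norm_nonneg _) hC.le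
  have h5 : C * ‖y h - x‖ ^ 2 ≤ C * (C * h) ^ 2 := by
    have := hb h hhm
    gcongr
  have h6 := mul_le_mul_of_nonneg_left hclf hh
  -- Three errors add up: the Taylor remainder of `V` and the gradient term, each at most `C ^ 3 * h
  -- ^ 2`, and the stage cost error `C ^ 2 * h ^ 2`, which `1 ≤ C` raises to the same size.
  have h7 : C * (C * h) * h ≤ C * (C * (C * h) * h) := by
    have : 0 ≤ C * (C * h) * h := by positivity
    nlinarith
  nlinarith

/-- Sample-and-hold: where the control-Lyapunov inequality can be satisfied pointwise, it can be
satisfied in integrated form up to an arbitrarily small error. -/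
theorem ShortHorizon.exists_sampled_input {r : ℝ} (hr1 : r ≤ 1) (hr0 : 0 ≤ r)
    (hclf : ∀ x, ‖x‖ ≤ r → ∃ v ∈ P.inputSet,
      inner ℝ (gradient P.V x) (P.f x v) + P.l x v ≤ 0) {h : ℝ} (hh : 0 ≤ h) (n : ℕ) :
    n * h ≤ T → ∀ x, P.V x + n * (3 * C ^ 3 * h ^ 2) ≤ mV * r ^ 2 →
      ∃ u y, P.Admissible (n * h) u ∧ P.IsTraj (n * h) x u y ∧
        P.V (y (n * h)) + ∫ s in (0 : ℝ)..(n * h), P.l (y s) (u s) ≤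
          P.V x + n * (3 * C ^ 3 * h ^ 2) := by
  have hC := H.C_pos
  induction n with
  | zero =>
    intro _ x _
    refine ⟨fun _ => 0, fun _ => x, hP.admissible_zero _, ⟨continuousOn_const, fun τ hτ => ?_⟩, ?_⟩
    · have : τ = 0 := le_antisymm (by simpa using hτ.2) hτ.1
      simp [this]
    · simp
  | succ n ih =>
    intro hnT x hVx
    push_cast at hnT hVx ⊢
    have hnh : 0 ≤ n * h := by positivity
    have hK : 0 ≤ 3 * C ^ 3 * h ^ 2 := by positivity
    have hnK : 0 ≤ n * (3 * C ^ 3 * h ^ 2) := by positivity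
    -- The budget `V x + (n + 1) * K ≤ mV * r ^ 2`, with `K` the error per step, keeps the state
    -- where a suitable input exists. One step raises `V` by at most `K` and leaves `n` steps, so
    -- the budget persists.
    have hxr : ‖x‖ ≤ r := by
      have h1 := hP.V_lower x
      have h2 : mV * ‖x‖ ^ 2 ≤ mV * r ^ 2 := by linarith
      exact abs_le_of_sq_le_sq' (le_of_mul_le_mul_left h2 hP.mV_pos) hr0 |>.2
    obtain ⟨v, hv, hvx⟩ := hclf x hxr
    obtain ⟨y, hy, hyV⟩ := H.exists_constant_input hP hcomplete (hxr.trans hr1) hv hvx hh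
      (by linarith)
    have hlpos : 0 ≤ ∫ s in (0 : ℝ)..h, P.l (y s) v :=
      intervalIntegral.integral_nonneg hh fun _ _ => hP.l_nonneg _ _
    obtain ⟨u', y', hu', hy', hV'⟩ := ih (by linarith) (y h) (by linarith)
    have hadm : P.Admissible h fun _ => v := ⟨measurable_const, fun _ _ => hv⟩
    have e : (n + 1 : ℝ) * h = h + n * h := by ring
    refine ⟨concat h (fun _ => v) u', concat h y y', ?_, ?_, ?_⟩
    · rw [e]; exact hadm.concat hu'
    · rw [e]; exact hy.concat hP hh hnh hadm hu' hy'
    · rw [e, integral_concat (Φ := P.l) hh hnh ⟨hnh, le_rfl⟩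
        (hadm.intervalIntegrable_l hP hh hy.1) (hu'.intervalIntegrable_l hP hnh hy'.1)]
      have hend : P.V (concat h y y' (h + n * h)) = P.V (y' (n * h)) := by
        -- If the second piece has length zero, the concatenation still takes its first branch at
        -- the end point, where the two pieces agree.
        rcases hnh.eq_or_lt with h0 | h0
        · rw [← h0, add_zero, concat_of_le _ _ le_rfl]
          rw [← h0] at hy'
          rw [SolvesForward.apply_zero le_rfl hy']
        · rw [concat_of_lt _ _ (by linarith), add_sub_cancel_left]
      rw [hend]
      linarith

/-- On a horizon `t ≤ T` the cost of the best input from `x` is at most `V x`. -/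
theorem ShortHorizon.exists_terminal_input {r : ℝ} (hr1 : r ≤ 1) (hr0 : 0 ≤ r)
    (hclf : ∀ x, ‖x‖ ≤ r → ∃ v ∈ P.inputSet,
      inner ℝ (gradient P.V x) (P.f x v) + P.l x v ≤ 0) {t : ℝ} (ht : 0 < t) (htT : t ≤ T)
    {x : P.State} (hVx : P.V x < mV * r ^ 2) {ε : ℝ} (hε : 0 < ε) :
    ∃ u y, P.Admissible t u ∧ P.IsTraj t x u y ∧
        P.V (y t) + ∫ s in (0 : ℝ)..t, P.l (y s) (u s) ≤ P.V x + ε := by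
  have hC := H.C_pos
  set δ := min ε (mV * r ^ 2 - P.V x) with hδ
  have hδ0 : 0 < δ := lt_min hε (by linarith)
  -- `n` steps of length `t / n` accumulate the error `3 C³ t² / n`, here below both `ε` and the gap
  -- `mV r² - V x`.
  obtain ⟨n, hn⟩ := exists_nat_gt (3 * C ^ 3 * t ^ 2 / δ)
  have hn0 : (0 : ℝ) < n := lt_of_le_of_lt (by positivity) hn
  have e : (n : ℝ) * (t / n) = t := by field_simp
  have hle : (n : ℝ) * (3 * C ^ 3 * (t / n) ^ 2) ≤ δ := by
    have e2 : (n : ℝ) * (3 * C ^ 3 * (t / n) ^ 2) = 3 * C ^ 3 * t ^ 2 / n := by field_simp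
    rw [e2, div_le_iff₀ hn0]
    rw [div_lt_iff₀ hδ0] at hn
    linarith
  have h1 : δ ≤ ε := min_le_left _ _
  have h2 : δ ≤ mV * r ^ 2 - P.V x := min_le_right _ _
  obtain ⟨u, y, hu, hy, hV⟩ := H.exists_sampled_input hP hcomplete hr1 hr0 hclf
    (h := t / n) (by positivity) n (by rw [e]; exact htT) x (by linarith)
  rw [e] at hu hy hV
  exact ⟨u, y, hu, hy, by linarith⟩

/-- Decrease of the optimal cost along the optimal trajectory. -/
theorem ShortHorizon.optCost_traj_le {r : ℝ} (hr1 : r ≤ 1) (hr0 : 0 ≤ r)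
    (hclf : ∀ x, ‖x‖ ≤ r → ∃ v ∈ P.inputSet,
      inner ℝ (gradient P.V x) (P.f x v) + P.l x v ≤ 0) {dt : ℝ} (hdt : 0 < dt) (hdtT : dt ≤ T)
    {x₀ : P.State} {u : ℝ → P.Input} {x : ℝ → P.State} (ho : P.IsOptimal T x₀ u x)
    (hVx : P.V (x T) < mV * r ^ 2) :
    P.optCost T (x dt) ≤ P.optCost T x₀ - ∫ s in (0 : ℝ)..dt, P.l (x s) (u s) := by
  have hT := H.T_pos
  obtain ⟨hu, hx, -⟩ := id ho
  refine le_of_forall_pos_le_add fun ε hε => ?_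
  -- The competitor from `x dt` follows the optimal input on `[dt, T]` and then `v` for a time `dt`;
  -- the second part replaces the terminal cost `V (x T)` at an expense of at most `ε`.
  obtain ⟨v, y, hv, hy, hV⟩ := H.exists_terminal_input hP hcomplete hr1 hr0 hclf hdt hdtT hVx hε
  have hs : 0 ≤ T - dt := by linarith
  have hu' := hu.tail (s := dt) hdt.le
  have hx' := hx.tail hP hdt.le hdtT hu
  have hy' : P.IsTraj dt ((fun τ => x (τ + dt)) (T - dt)) v y := by
    simpa using hy
  have hcu := hu'.concat hv
  have hcx := hx'.concat hP hs hdt.le hu' hv hy'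
  have e : T - dt + dt = T := by ring
  have hcost : P.cost T (concat (T - dt) (fun τ => u (τ + dt)) v)
      (concat (T - dt) (fun τ => x (τ + dt)) y) =
      P.V (y dt) + ((∫ s in dt..T, P.l (x s) (u s)) + ∫ s in (0 : ℝ)..dt, P.l (y s) (v s)) := by
    have h1 := integral_concat (Φ := P.l) hs hdt.le ⟨hdt.le, le_rfl⟩
      (hu'.intervalIntegrable_l hP hs hx'.1) (hv.intervalIntegrable_l hP hdt.le hy.1)
    rw [e, intervalIntegral.integral_comp_add_right (fun s => P.l (x s) (u s)), zero_add, e] at h1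
    rw [cost, h1, concat_of_lt _ _ (by linarith), sub_sub_cancel]
  rw [e] at hcu hcx
  have h2 := hP.optCost_le hT.le hcu hcx
  rw [hcost] at h2
  have hil := hu.intervalIntegrable_l hP hT.le hx.1
  have hsub : ∀ {a b}, a ∈ Icc 0 T → b ∈ Icc 0 T →
      IntervalIntegrable (fun r => P.l (x r) (u r)) volume a b := fun ha hb =>
    hil.mono_set (by rw [uIcc_of_le hT.le]; exact uIcc_subset_Icc ha hb)
  have h3 := intervalIntegral.integral_add_adjacent_intervals
    (hsub ⟨le_rfl, hT.le⟩ ⟨hdt.le, hdtT⟩) (hsub ⟨hdt.le, hdtT⟩ ⟨hT.le, le_rfl⟩)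
  rw [hP.optCost_eq hT.le ho, cost]
  linarith

end TerminalController

end AgentNetwork

/-- A nonnegative `C²` function that vanishes at `0` has increments that are quadratically small
near `0`. -/
theorem ContDiffOn.exists_increment_le {E : Type*} [NormedAddCommGroup E] [NormedSpace ℝ E]
    [FiniteDimensional ℝ E] {S : Set E} (hS : IsOpen S) {φ : E → ℝ} (h : ContDiffOn ℝ 2 φ S)
    (hnn : ∀ x, 0 ≤ φ x) (h0 : φ 0 = 0) {r : ℝ} (hr : 0 ≤ r) (hrS : Metric.closedBall 0 r ⊆ S) :
    ∃ K, 0 < K ∧ ∀ x y, ‖x‖ ≤ r → ‖y‖ ≤ r →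
      φ y ≤ φ x + K * (‖x‖ + ‖y - x‖) * ‖y - x‖ := by
  have hd : ContDiffOn ℝ 1 (fderiv ℝ φ) S := h.fderiv_of_isOpen hS (by norm_num)
  obtain ⟨K, hK⟩ := hd.exists_boundedLipschitz hS hrS
  -- `0` is a global minimum, so the derivative vanishes there and grows at most linearly; this
  -- makes the increments of second order.
  have hmin : fderiv ℝ φ 0 = 0 :=
    IsLocalMin.fderiv_eq_zero (Eventually.of_forall fun x => by rw [h0]; exact hnn x)
  have hK' := hK.mono (le_max_left K 1)
  have hK0 : 0 < max K 1 := lt_max_of_lt_right one_pos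
  refine ⟨max K 1, hK0, fun x y hx hy => ?_⟩
  have hb : ∀ z ∈ segment ℝ x y, ‖z‖ ≤ r ∧ ‖z‖ ≤ ‖x‖ + ‖y - x‖ := by
    intro z hz
    refine ⟨?_, ?_⟩
    · simpa using (convex_closedBall (0 : E) r).segment_subset (by simpa using hx)
        (by simpa using hy) hz
    · have h1 : ‖z - x‖ ≤ ‖y - x‖ := by
        simpa [norm_sub_rev] using norm_sub_le_of_mem_segment hz
      have := norm_le_norm_add_norm_sub' z x
      linarith
  have := (convex_segment x y).norm_image_sub_le_of_norm_fderiv_le (𝕜 := ℝ) (f := φ)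
    (C := max K 1 * (‖x‖ + ‖y - x‖))
    (fun z hz => (h.differentiableOn two_ne_zero).differentiableAt
      (hS.mem_nhds (hrS (by simpa using (hb z hz).1))))
    (fun z hz => by
      have h1 := hK'.2 z 0 (hb z hz).1 (by simpa using hr)
      rw [hmin, sub_zero, sub_zero] at h1
      exact h1.trans (mul_le_mul_of_nonneg_left (hb z hz).2 hK0.le))
    (left_mem_segment ℝ x y) (right_mem_segment ℝ x y)
  have h2 := (le_abs_self _).trans this
  linarith

/-! ### Existence of the constants in the descent inequality. -/

namespace AgentNetwork

variable {N : ℕ} {P : AgentNetwork N} {ml Ml mV MV : ℝ} {rx rl ρ L R C T : ℝ}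

theorem mem_level_self {Γ : Set P.State} {a b : ℝ} (hab : a ≤ b) {x : P.State}
    (h : x ∈ P.level T Γ a) : x ∈ P.level T Γ b :=
  ⟨h.1, h.2.trans hab⟩

/-- Only a suitable input at each single state is retained: without regularity of the feedback, its
closed-loop equation need not have a solution. -/
theorem StructuredCLF.exists_input {Γ : Set P.State} {β : ℝ} (h : P.StructuredCLF Γ β)
    {x : P.State} (hx : x ∈ Γ) (hV : P.V x ≤ β) :
    ∃ v ∈ P.inputSet, inner ℝ (gradient P.V x) (P.f x v) + P.l x v ≤ 0 := by
  obtain ⟨-, -, r, -, hr⟩ := h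
  obtain ⟨h1, h2⟩ := hr x hx hV
  exact ⟨r x, h1, by rwa [inner_gradient_left]⟩

section Existence

variable (H : P.ShortHorizon rx rl ρ L R C T) (hP : P.IsRegular ml Ml mV MV)
include H hP

theorem ShortHorizon.exists_costBound {Γ : Set P.State} {α : ℝ} (hW : P.CentralWellPosed T Γ α)
    (hρ : ∀ x ∈ P.level T Γ α, ‖x‖ ≤ ρ) :
    ∃ mJ MJ : ℝ, 0 < mJ ∧ 0 < MJ ∧ P.CostBound T (P.level T Γ α) mJ MJ := by
  have hT := H.T_pos
  have hC := H.C_pos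
  have hml := hP.ml_pos
  have hmV := hP.mV_pos
  have hMl : 0 < Ml := hml.trans_le hP.ml_le
  have hMV : 0 < MV := hmV.trans_le hP.mV_le
  refine ⟨1 / (2 / mV + 4 * C ^ 2 * T / ml), 4 * MV + 4 * T * Ml, by positivity, by positivity,
    fun x hx => ⟨?_, H.optCost_le_sq_norm hP hW.complete (hρ x hx)⟩⟩
  obtain ⟨u, y, ho⟩ := hW.exists_opt x hx.1
  have := H.sq_norm_le_optCost hP (hρ x hx) ho
  rw [one_div, inv_mul_le_iff₀ (by positivity)]
  exact this

/-- The optimal cost decreases by a fixed fraction in one sampling step along the optimal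
trajectory. -/
theorem ShortHorizon.exists_fraction {Γ : Set P.State} {α : ℝ}
    (hρ : ∀ x ∈ P.level T Γ α, ‖x‖ ≤ ρ) {mJ MJ : ℝ} (hMJ : 0 < MJ)
    (hJ : P.CostBound T (P.level T Γ α) mJ MJ) {dt : ℝ} (hdt : 0 < dt) (hdtT : dt ≤ T) :
    ∃ a : ℝ, 0 < a ∧ a ≤ 1 ∧ ∀ x₀ ∈ P.level T Γ α, ∀ u x, P.IsOptimal T x₀ u x →
      a * P.optCost T x₀ ≤ ∫ s in (0 : ℝ)..dt, P.l (x s) (u s) := by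
  have hT := H.T_pos
  have hC := H.C_pos
  have hml := hP.ml_pos
  -- The upper bound `MJ ‖x₀‖²` on `J*` combined with the bound of `dt ‖x₀‖²` by the stage cost on
  -- `[0,dt]`.
  set c := dt / ((2 + 4 * C ^ 2 * dt ^ 2) / ml) / MJ with hc
  have hc0 : 0 < c := by positivity
  refine ⟨min 1 c, lt_min one_pos hc0, min_le_left _ _, fun x₀ h0 u x ho => ?_⟩
  have hb := H.traj_bounds (hρ x₀ h0) ho.1 ho.2.1
  have h1 := (ho.2.1.mono hdtT).sq_norm_le_integral hP H.consts (by linarith [H.two_le])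
    (ho.1.mono hdtT) (fun s hs => (hb s ⟨hs.1, hs.2.trans hdtT⟩).2.2) hdt
  have h2 := (hJ x₀ h0).2
  have h3 : c * P.optCost T x₀ ≤ ∫ s in (0 : ℝ)..dt, P.l (x s) (u s) := by
    rw [hc, div_mul_eq_mul_div, div_le_iff₀ hMJ, div_mul_eq_mul_div, div_le_iff₀ (by positivity)]
    calc dt * P.optCost T x₀ ≤ dt * (MJ * ‖x₀‖ ^ 2) := by gcongr
      _ = MJ * (dt * ‖x₀‖ ^ 2) := by ring
      _ ≤ MJ * ((2 + 4 * C ^ 2 * dt ^ 2) / ml * ∫ s in (0 : ℝ)..dt, P.l (x s) (u s)) := by gcongr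
      _ = _ := by ring
  exact (mul_le_mul_of_nonneg_right (min_le_right _ _) (hP.optCost_nonneg hT.le x₀)).trans h3

/-- `J*` loses the fraction `a` along the optimal trajectory, and its second-order increments bound
the effect of moving from `xo dt` to `xc dt`. The constants come from these two facts and do not
involve `d`; only the level `αb` shrinks with `d`, to keep both states in a fixed ball. -/
theorem ShortHorizon.exists_descentBound {Γ : Set P.State} {α β : ℝ} (hα : 0 < α)
    (hW : P.CentralWellPosed T Γ α) (hCLF : P.StructuredCLF Γ β)
    (hρ : ∀ x ∈ P.level T Γ α, ‖x‖ ≤ ρ) (hJ2 : ContDiffOn ℝ 2 (P.optCost T) Γ)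
    {mJ MJ D : ℝ} (hmJ : 0 < mJ) (hMJ : 0 < MJ) (hD : 0 < D)
    (hJ : P.CostBound T (P.level T Γ α) mJ MJ)
    (hE : ∀ d : ℝ, 0 < d → P.ErrorBound T (P.level T Γ α) rx rl D d)
    {dt : ℝ} (hdt : 0 < dt) (hdtT : dt < T) :
    ∃ a b c : ℝ, 0 < a ∧ a ≤ 1 ∧ 0 < b ∧ 0 < c ∧ ∀ d : ℝ, 0 < d →
      ∃ αb : ℝ, 0 < αb ∧ αb < α ∧ P.DescentBound T dt Γ α rx rl a b c d αb := by
  have hT := H.T_pos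
  have hC := H.C_pos
  have hml := hP.ml_pos
  have hmV := hP.mV_pos
  have hMV : 0 < MV := hmV.trans_le hP.mV_le
  have hβ := hCLF.1
  have hdtm : dt ∈ Icc 0 T := ⟨hdt.le, hdtT.le⟩
  obtain ⟨a, ha0, ha1, ha⟩ := H.exists_fraction hP hρ hMJ hJ hdt hdtT.le
  -- a ball around the origin on which everything is under control
  obtain ⟨r₁, hr₁, hr₁Γ⟩ := Metric.nhds_basis_closedBall.mem_iff.1
    (hW.isOpen.mem_nhds hW.zero_mem)
  -- The ball lies in `Γ`, in the unit ball required by the sampled inputs, and in `V ≤ β`, where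
  -- the control-Lyapunov inequality is available.
  set r := min (min r₁ 1) √(β / MV) with hr
  have hr0 : 0 < r := by positivity
  have hr1 : r ≤ 1 := (min_le_left _ _).trans (min_le_right _ _)
  have hrΓ : Metric.closedBall (0 : P.State) r ⊆ Γ :=
    (Metric.closedBall_subset_closedBall ((min_le_left _ _).trans (min_le_left _ _))).trans hr₁Γ
  have hrβ : MV * r ^ 2 ≤ β := by
    have h1 : r ^ 2 ≤ β / MV := by
      have := pow_le_pow_left₀ hr0.le (min_le_right (min r₁ 1) √(β / MV)) 2
      rwa [Real.sq_sqrt (by positivity)] at this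
    rwa [le_div_iff₀ hMV, mul_comm] at h1
  have hclf : ∀ x, ‖x‖ ≤ r → ∃ v ∈ P.inputSet,
      inner ℝ (gradient P.V x) (P.f x v) + P.l x v ≤ 0 := fun x hx => by
    refine hCLF.exists_input (hrΓ (by simpa using hx)) ((hP.V_upper x).trans ?_)
    refine le_trans ?_ hrβ
    gcongr
  obtain ⟨K, hK0, hK⟩ := hJ2.exists_increment_le hW.isOpen (hP.optCost_nonneg hT.le)
    (hP.optCost_zero hT.le) hr0.le hrΓ
  set S := √(2 * (2 / mV + 4 * C ^ 2 * T / ml) + 4 * C ^ 2 * T / ml) with hS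
  have hS0 : 0 < S := by positivity
  refine ⟨a, K * S, K, ha0, ha1, by positivity, hK0, fun d hd => ?_⟩
  -- On this smaller ball `J* ≤ K * ‖x‖ ^ 2 ≤ α`, so the next state lies in `Γ_α`.
  set r₂ := min r √(α / K) with hr₂
  have hr₂0 : 0 < r₂ := by positivity
  have hr₂α : K * r₂ ^ 2 ≤ α := by
    have h1 : r₂ ^ 2 ≤ α / K := by
      have := pow_le_pow_left₀ hr₂0.le (min_le_right r √(α / K)) 2
      rwa [Real.sq_sqrt (by positivity)] at this
    rwa [le_div_iff₀ hK0, mul_comm] at h1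
  set q := S + D * d / √mJ with hq
  have hq0 : 0 < q := by positivity
  -- The entries ensure `αb < α`, a final optimal state from which the terminal input exists, and
  -- `‖xo dt‖ + e ≤ q * √J ≤ r₂`.
  set αb := min (α / 2) (min (mV * r ^ 2 / 2) ((r₂ / q) ^ 2)) with hαb
  have hαb0 : 0 < αb := by positivity
  have hαbα : αb < α := (min_le_left _ _).trans_lt (by linarith)
  refine ⟨αb, hαb0, hαbα, fun x₀ h0 qs u x lam hinit hrun xc hxc us xo ho => ?_⟩
  have h0α : x₀ ∈ P.level T Γ α := mem_level_self hαbα.le h0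
  set J := P.optCost T x₀ with hJdef
  have hJ0 : 0 ≤ J := hP.optCost_nonneg hT.le x₀
  have hJαb : J ≤ αb := h0.2
  set e := Linf T (fun τ => xc τ - xo τ) with he
  have he0 : 0 ≤ e := Linf_nonneg _
  have hed : e ≤ D * d * ‖x₀‖ := hE d hd x₀ h0α qs u x lam hinit hrun xc hxc us xo ho
  have hx₀ : ‖x₀‖ ≤ √J / √mJ := by
    rw [← Real.sqrt_div' _ hmJ.le]
    refine Real.le_sqrt_of_sq_le ?_
    rw [le_div_iff₀ hmJ, mul_comm]
    exact (hJ x₀ h0α).1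
  have hxo : ‖xo dt‖ ≤ S * √J := by
    rw [hS, ← Real.sqrt_mul' _ hJ0]
    exact Real.le_sqrt_of_sq_le (H.sq_norm_traj_le hP (hρ x₀ h0α) ho hdtm)
  have hΔ : ‖xc dt - xo dt‖ ≤ e :=
    norm_le_Linf (q := fun τ => xc τ - xo τ) (hxc.1.sub ho.2.1.1) hdtm
  have heJ : e ≤ D * d / √mJ * √J := by
    calc e ≤ D * d * ‖x₀‖ := hed
      _ ≤ D * d * (√J / √mJ) := by gcongr
      _ = _ := by ring
  have hsum : ‖xo dt‖ + e ≤ r₂ := by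
    have h1 : √J ≤ r₂ / q := by
      refine Real.sqrt_le_iff.2 ⟨by positivity, hJαb.trans ?_⟩
      exact (min_le_right _ _).trans (min_le_right _ _)
    calc ‖xo dt‖ + e ≤ S * √J + D * d / √mJ * √J := add_le_add hxo heJ
      _ = q * √J := by rw [hq]; ring
      _ ≤ q * (r₂ / q) := by gcongr
      _ = r₂ := by field_simp
  have hr₂r : r₂ ≤ r := min_le_left _ _
  have hxc2 : ‖xc dt‖ ≤ r₂ := by
    have := norm_le_norm_add_norm_sub' (xc dt) (xo dt)
    linarith
  have hxor : ‖xo dt‖ ≤ r := by linarith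
  have hVT : P.V (xo T) < mV * r ^ 2 := by
    have h1 : P.V (xo T) ≤ J := by
      rw [hJdef, hP.optCost_eq hT.le ho, cost]
      have : 0 ≤ ∫ s in (0 : ℝ)..T, P.l (xo s) (us s) :=
        intervalIntegral.integral_nonneg hT.le fun _ _ => hP.l_nonneg _ _
      linarith
    have h2 : αb ≤ mV * r ^ 2 / 2 := (min_le_right _ _).trans (min_le_left _ _)
    have h3 : 0 < mV * r ^ 2 := by positivity
    linarith
  have hdec := H.optCost_traj_le hP hW.complete hr1 hr0.le hclf hdt hdtT.le ho hVT
  have hfrac := ha x₀ h0α us xo ho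
  refine ⟨⟨hrΓ (by simpa using hxc2.trans hr₂r), ?_⟩, ?_⟩
  · have h1 := hK 0 (xc dt) (by simpa using hr0.le) (hxc2.trans hr₂r)
    rw [hP.optCost_zero hT.le, sub_zero, norm_zero, zero_add, zero_add] at h1
    calc _ ≤ K * ‖xc dt‖ * ‖xc dt‖ := h1
      _ = K * ‖xc dt‖ ^ 2 := by ring
      _ ≤ K * r₂ ^ 2 := by gcongr
      _ ≤ α := hr₂α
  · have h1 := hK (xo dt) (xc dt) hxor (hxc2.trans hr₂r)
    have h2 : K * (‖xo dt‖ + ‖xc dt - xo dt‖) * ‖xc dt - xo dt‖ ≤ K * (S * √J + e) * e := by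
      gcongr
    calc P.optCost T (xc dt) ≤ P.optCost T (xo dt) + K * (S * √J + e) * e := h1.trans (by linarith)
      _ ≤ (J - a * J) + K * (S * √J + e) * e := by linarith
      _ = _ := by ring

end Existence

/-! ### Decay in the closed loop. -/

section ClosedLoop

variable (H : P.ShortHorizon rx rl ρ L R C T) (hP : P.IsRegular ml Ml mV MV)

/-- With `s = D d / √mJ` the bound on `d` reads `2 c s + b < √(b² + 4 a c)`; squaring gives `b s + c
s² < a`. Positivity follows from `a ≤ 1` and the positive error terms. -/
theorem decayRate_bounds {mJ D a b c d pJ : ℝ} (hmJ : 0 < mJ) (hD : 0 < D) (ha1 : a ≤ 1)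
    (hb : 0 < b) (hc : 0 < c) (hd : 0 < d)
    (hdlt : d < √mJ / (2 * c * D) * (√(b ^ 2 + 4 * a * c) - b))
    (hpJ : pJ = (1 - a) + b * D * d / √mJ + c * D ^ 2 * d ^ 2 / mJ) : 0 < pJ ∧ pJ < 1 := by
  have hs : 0 < √mJ := Real.sqrt_pos.2 hmJ
  set s := D * d / √mJ with hsdef
  have hs0 : 0 < s := by positivity
  have e : pJ = (1 - a) + b * s + c * s ^ 2 := by
    rw [hpJ, hsdef, div_pow, mul_pow, Real.sq_sqrt hmJ.le]
    ring
  have h1 : 2 * c * s + b < √(b ^ 2 + 4 * a * c) := by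
    have h2 : 2 * c * D * d < √mJ * (√(b ^ 2 + 4 * a * c) - b) := by
      rwa [div_mul_eq_mul_div, lt_div_iff₀ (by positivity), mul_comm d] at hdlt
    have h3 : 2 * c * s < √(b ^ 2 + 4 * a * c) - b := by
      rw [hsdef, ← mul_div_assoc, div_lt_iff₀ hs]
      linarith
    linarith
  have h4 := Real.lt_sqrt (by positivity) |>.1 h1
  have h5 : c * (b * s + c * s ^ 2) < c * a := by nlinarith
  have h6 := lt_of_mul_lt_mul_left h5 hc.le
  have h7 : 0 < b * s := by positivity
  have h8 : 0 < c * s ^ 2 := by positivity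
  rw [e]
  constructor <;> linarith

include H hP

/-- The induction carries three facts together: an appropriate warm start gives the error and
descent bounds, these keep the state in `Γ_αb`, and that in turn makes the next warm start
appropriate. -/
theorem ShortHorizon.exponentialDecay {Γ : Set P.State} {α : ℝ}
    (hW : P.CentralWellPosed T Γ α) (hρ : ∀ x ∈ P.level T Γ α, ‖x‖ ≤ ρ)
    (hJ2 : ContDiffOn ℝ 2 (P.optCost T) Γ) {mJ MJ D a b c d αb pJ dt : ℝ}
    (hmJ : 0 < mJ) (hMJ : 0 < MJ) (hD : 0 < D) (hb : 0 < b) (hc : 0 < c)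
    (hd : 0 < d) (hαb : 0 < αb) (hαbα : αb < α) (hdt : 0 < dt) (hdtT : dt < T)
    (hJ : P.CostBound T (P.level T Γ α) mJ MJ)
    (hE : P.ErrorBound T (P.level T Γ α) rx rl D d)
    (hDesc : P.DescentBound T dt Γ α rx rl a b c d αb)
    (hpJ : pJ = (1 - a) + b * D * d / √mJ + c * D ^ 2 * d ^ 2 / mJ) (hp0 : 0 < pJ) (hp1 : pJ < 1) :
    P.ExponentialDecay T dt Γ α rx rl d αb pJ (D * d / √mJ) := by
  have hT := H.T_pos
  have hC := H.C_pos
  have hml := hP.ml_pos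
  have hmV := hP.mV_pos
  have hs : 0 < √mJ := Real.sqrt_pos.2 hmJ
  have hnorm : ∀ x ∈ P.level T Γ α, ‖x‖ ≤ √(P.optCost T x) / √mJ := fun x hx => by
    rw [← Real.sqrt_div' _ hmJ.le]
    refine Real.le_sqrt_of_sq_le ?_
    rw [le_div_iff₀ hmJ, mul_comm]
    exact (hJ x hx).1
  -- invariance and decay at the sampling instants
  have hmain : ∀ xs q u x lam xc, P.IsClosedLoop T dt d (P.level T Γ α) rx rl xs q u x lam xc →
      xs 0 ∈ P.level T Γ αb → ∀ k,
      P.Appropriate T (P.level T Γ α) rx rl (x k 0) (lam k 0) ∧ xs k ∈ P.level T Γ αb ∧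
      P.optCost T (xs k) ≤ pJ ^ k * P.optCost T (xs 0) := by
    intro xs q u x lam xc hcl h0 k
    induction k with
    | zero => exact ⟨hcl.init, h0, by simp⟩
    | succ k ih =>
      obtain ⟨hap, hk, hJk⟩ := ih
      have hkα := mem_level_self hαbα.le hk
      have hlast := H.appropriate_of_run hρ hkα hap (hcl.run k) (q k) le_rfl
      obtain ⟨us, xo, ho⟩ := hW.exists_opt (xs k) hk.1
      have herr := hE (xs k) hkα (q k) (u k) (x k) (lam k) hap (hcl.run k) (xc k) (hcl.actual k)
        us xo ho
      obtain ⟨hnext, hdesc⟩ := hDesc (xs k) hk (q k) (u k) (x k) (lam k) hap (hcl.run k) (xc k)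
        (hcl.actual k) us xo ho
      rw [← hcl.next k] at hnext hdesc
      set J := P.optCost T (xs k) with hJdef
      have hJ0 : 0 ≤ J := hP.optCost_nonneg hT.le _
      set e := Linf T (fun τ => xc k τ - xo τ) with he
      have he0 : 0 ≤ e := Linf_nonneg _
      have heJ : e ≤ D * d / √mJ * √J := by
        calc e ≤ D * d * ‖xs k‖ := herr
          _ ≤ D * d * (√J / √mJ) := by gcongr; exact hnorm _ hkα
          _ = _ := by ring
      have hstep : P.optCost T (xs (k + 1)) ≤ pJ * J := by
        calc _ ≤ (1 - a) * J + b * √J * e + c * e ^ 2 := hdesc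
          _ ≤ (1 - a) * J + b * √J * (D * d / √mJ * √J) + c * (D * d / √mJ * √J) ^ 2 := by gcongr
          _ = (1 - a) * J + b * D * d / √mJ * (√J * √J) + c * D ^ 2 * d ^ 2 / (√mJ) ^ 2 *
              (√J) ^ 2 := by ring
          _ = pJ * J := by
              rw [Real.mul_self_sqrt hJ0, Real.sq_sqrt hJ0, Real.sq_sqrt hmJ.le, hpJ]
              ring
      refine ⟨?_, ⟨hnext.1, ?_⟩, ?_⟩
      · refine ⟨hlast.1.congr (hcl.warm_x k), hlast.2.1.congr (hcl.warm_lam k), fun τ hτ => ?_⟩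
        rw [hcl.warm_x k hτ, hcl.warm_lam k hτ]
        exact hlast.2.2 τ hτ
      · have h1 : J ≤ αb := hk.2
        have h2 : pJ * J ≤ 1 * J := mul_le_mul_of_nonneg_right hp1.le hJ0
        linarith
      · calc _ ≤ pJ * J := hstep
          _ ≤ pJ * (pJ ^ k * P.optCost T (xs 0)) := by gcongr
          _ = _ := by ring
  have herror : ∀ xs q u x lam xc, P.IsClosedLoop T dt d (P.level T Γ α) rx rl xs q u x lam xc →
      xs 0 ∈ P.level T Γ αb → ∀ k us xo, P.IsOptimal T (xs k) us xo →
      Linf T (fun τ => xc k τ - xo τ) ≤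
        D * d / √mJ * √(pJ ^ k * P.optCost T (xs 0)) := by
    intro xs q u x lam xc hcl h0 k us xo ho
    obtain ⟨hap, hk, hJk⟩ := hmain xs q u x lam xc hcl h0 k
    have hkα := mem_level_self hαbα.le hk
    calc _ ≤ D * d * ‖xs k‖ := hE (xs k) hkα (q k) (u k) (x k) (lam k) hap (hcl.run k) (xc k)
          (hcl.actual k) us xo ho
      _ ≤ D * d * (√(P.optCost T (xs k)) / √mJ) := by gcongr; exact hnorm _ hkα
      _ ≤ D * d * (√(pJ ^ k * P.optCost T (xs 0)) / √mJ) := by gcongr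
      _ = _ := by ring
  refine ⟨?_, fun xs q u x lam xc hcl h0 k => ?_, ?_⟩
  -- `J*` is continuous and vanishes at the origin, so its sublevel set is a neighborhood.
  · have hcont : ContinuousAt (P.optCost T) 0 :=
      hJ2.continuousOn.continuousAt (hW.isOpen.mem_nhds hW.zero_mem)
    have h1 : ∀ᶠ x in 𝓝 (0 : P.State), P.optCost T x < αb := by
      refine hcont.eventually_lt continuousAt_const ?_
      rwa [hP.optCost_zero hT.le]
    filter_upwards [h1, hW.isOpen.mem_nhds hW.zero_mem] with x hx hxΓ
    exact ⟨hxΓ, hx.le⟩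
  · obtain ⟨-, hk, hJk⟩ := hmain xs q u x lam xc hcl h0 k
    exact ⟨hk, hJk, herror xs q u x lam xc hcl h0 k⟩
  · set S := √(2 * (2 / mV + 4 * C ^ 2 * T / ml) + 4 * C ^ 2 * T / ml) with hS
    have hS0 : 0 < S := by positivity
    set g := (S + D * d / √mJ) * √MJ with hg
    have hg0 : 0 < g := by positivity
    have hlog : Real.log pJ < 0 := Real.log_neg hp0 hp1
    -- `J*` gains the factor `pJ` per sampling step and the state scales like `√J*`, hence the `2`.
    set γ := -Real.log pJ / (2 * dt) with hγ
    have hγ0 : 0 < γ := div_pos (by linarith) (by linarith)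
    -- The factor `exp (γ * dt)` pays for rounding `t` down to the last sampling instant.
    refine ⟨g * Real.exp (γ * dt), γ, by positivity, hγ0, fun xs q u x lam xc hcl h0 t ht => ?_⟩
    set k := ⌊t / dt⌋₊ with hk
    have h1 : (k : ℝ) ≤ t / dt := Nat.floor_le (by positivity)
    have h2 : t / dt < k + 1 := Nat.lt_floor_add_one _
    rw [le_div_iff₀ hdt] at h1
    rw [div_lt_iff₀ hdt] at h2
    have hτ : t - k * dt ∈ Icc 0 T := ⟨by linarith, by linarith⟩
    obtain ⟨hap, hkl, hJk⟩ := hmain xs q u x lam xc hcl h0 k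
    obtain ⟨us, xo, ho⟩ := hW.exists_opt (xs k) hkl.1
    have hkα := mem_level_self hαbα.le hkl
    have h0α := mem_level_self hαbα.le h0
    have h3 : ‖xc k (t - k * dt) - xo (t - k * dt)‖ ≤
        D * d / √mJ * √(pJ ^ k * P.optCost T (xs 0)) :=
      (norm_le_Linf (q := fun τ => xc k τ - xo τ) ((hcl.actual k).1.sub ho.2.1.1) hτ).trans
        (herror xs q u x lam xc hcl h0 k us xo ho)
    have h4 : ‖xo (t - k * dt)‖ ≤ S * √(pJ ^ k * P.optCost T (xs 0)) := by
      have hJ0 : 0 ≤ P.optCost T (xs k) := hP.optCost_nonneg hT.le _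
      calc _ ≤ S * √(P.optCost T (xs k)) := by
            rw [hS, ← Real.sqrt_mul' _ hJ0]
            exact Real.le_sqrt_of_sq_le (H.sq_norm_traj_le hP (hρ _ hkα) ho hτ)
        _ ≤ _ := by gcongr
    have h5 : √(pJ ^ k * P.optCost T (xs 0)) ≤ √(pJ ^ k) * (√MJ * ‖xs 0‖) := by
      rw [Real.sqrt_mul (by positivity)]
      gcongr
      have := Real.sqrt_le_sqrt (hJ _ h0α).2
      rwa [Real.sqrt_mul hMJ.le, Real.sqrt_sq (norm_nonneg _)] at this
    have h6 : √(pJ ^ k) ≤ Real.exp (γ * dt) * Real.exp (-γ * t) := by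
      have e1 : √(pJ ^ k) = Real.exp (-(γ * (k * dt))) := by
        rw [Real.sqrt_eq_iff_mul_self_eq_of_pos (Real.exp_pos _), ← Real.exp_add]
        have e2 : -(γ * (k * dt)) + -(γ * (k * dt)) = k * Real.log pJ := by
          rw [hγ]; field_simp; ring
        rw [e2, Real.exp_nat_mul, Real.exp_log hp0]
      rw [e1, ← Real.exp_add]
      refine Real.exp_le_exp.2 ?_
      nlinarith
    show ‖xc k (t - k * dt)‖ ≤ _
    calc ‖xc k (t - k * dt)‖ ≤ ‖xo (t - k * dt)‖ + ‖xc k (t - k * dt) - xo (t - k * dt)‖ :=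
          norm_le_norm_add_norm_sub' _ _
      _ ≤ S * √(pJ ^ k * P.optCost T (xs 0)) + D * d / √mJ * √(pJ ^ k * P.optCost T (xs 0)) :=
          add_le_add h4 h3
      _ = (S + D * d / √mJ) * √(pJ ^ k * P.optCost T (xs 0)) := by ring
      _ ≤ (S + D * d / √mJ) * ((Real.exp (γ * dt) * Real.exp (-γ * t)) * (√MJ * ‖xs 0‖)) := by
          gcongr
          exact h5.trans (by gcongr)
      _ = _ := by rw [hg]; ring

end ClosedLoop

end AgentNetwork

end

/-! ### Assembly of the theorem. -/

theorem theorem2 {N : ℕ} (P : AgentNetwork N) (ml Ml mV MV : ℝ)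
    (hP : P.IsRegular ml Ml mV MV)
    (rx rl ρ L : ℝ) (hrx : 0 < rx) (hrl : 0 < rl) (hL : 0 < L) :
    -- `Tmax` depends on the network, on `rx`, `rl`, on a bound `ρ` for the level set `Γ_α`, and on
    -- a Lipschitz constant `L` of the distributed feedback law
    ∃ Tmax : ℝ, 0 < Tmax ∧ ∀ T : ℝ, 0 < T → T < Tmax → ∀ dt : ℝ, 0 < dt → dt < T →
      ∀ (Γ : Set P.State) (β α : ℝ), α = β * (1 + ml / mV * T) →
      P.CentralWellPosed T Γ α →
      P.StructuredCLF Γ β →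
      (∀ x ∈ P.level T Γ α, ‖x‖ ≤ ρ) →
      ContDiffOn ℝ 2 (P.optCost T) Γ →
      P.HasLipschitzOptimalLaw T Γ →
      P.HasLipschitzDMPCLaw T (P.level T Γ α) rx rl L →
      -- the algorithm converges linearly
      (∃ p : ℝ, 0 < p ∧ p < 1 ∧ P.ConvergesLinearly T (P.level T Γ α) rx rl p) ∧
      -- the constants `mJ, MJ, D, a, b, c` (independent of `d`) and `αb` exist
      (∃ mJ MJ D a b c : ℝ, 0 < mJ ∧ 0 < MJ ∧ 0 < D ∧ 0 < a ∧ a ≤ 1 ∧ 0 < b ∧ 0 < c ∧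
        P.CostBound T (P.level T Γ α) mJ MJ ∧
        ∀ d : ℝ, 0 < d → P.ErrorBound T (P.level T Γ α) rx rl D d ∧
          ∃ αb : ℝ, 0 < αb ∧ αb < α ∧ P.DescentBound T dt Γ α rx rl a b c d αb) ∧
      -- for all such constants, the bound on `d` implies exponential decay and stability
      (∀ mJ MJ D a b c d αb : ℝ, 0 < mJ → 0 < MJ → 0 < D → 0 < a → a ≤ 1 → 0 < b → 0 < c →
        0 < d → 0 < αb → αb < α →
        P.CostBound T (P.level T Γ α) mJ MJ →
        P.ErrorBound T (P.level T Γ α) rx rl D d →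
        P.DescentBound T dt Γ α rx rl a b c d αb →
        d < √mJ / (2 * c * D) * (√(b ^ 2 + 4 * a * c) - b) →
        ∃ pJ : ℝ, pJ = (1 - a) + b * D * d / √mJ + c * D ^ 2 * d ^ 2 / mJ ∧ 0 < pJ ∧ pJ < 1 ∧
          P.ExponentialDecay T dt Γ α rx rl d αb pJ (D * d / √mJ)) := by
  obtain ⟨R, C, Tmax, hTmax, hH⟩ := P.exists_shortHorizon hP ρ hrx hrl hL
  refine ⟨Tmax, hTmax, fun T hT hTm dt hdt hdtT Γ β α hα hW hCLF hρ hJ2 _ hlaw => ?_⟩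
  have H := hH T hT hTm
  have hC := H.C_pos
  have hα0 : 0 < α := by
    have := hP.ml_pos
    have := hP.mV_pos
    have := hCLF.1
    rw [hα]
    positivity
  refine ⟨⟨1 / 2, by norm_num, by norm_num, H.convergesLinearly hρ hW.complete hlaw⟩, ?_, ?_⟩
  · obtain ⟨mJ, MJ, hmJ, hMJ, hJ⟩ := H.exists_costBound hP hW hρ
    have hE : ∀ d : ℝ, 0 < d → P.ErrorBound T (P.level T Γ α) rx rl (12 * C * T * L) d :=
      fun d hd => H.errorBound hρ hW.complete hlaw hd
    have hD : 0 < 12 * C * T * L := by positivity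
    obtain ⟨a, b, c, ha, ha1, hb, hc, hdesc⟩ := H.exists_descentBound hP hα0 hW hCLF hρ hJ2 hmJ hMJ
      hD hJ hE hdt hdtT
    exact ⟨mJ, MJ, _, a, b, c, hmJ, hMJ, hD, ha, ha1, hb, hc, hJ, fun d hd => ⟨hE d hd, hdesc d hd⟩⟩
  · intro mJ MJ D a b c d αb hmJ hMJ hD ha ha1 hb hc hd hαb hαbα hJ hE hDesc hdlt
    obtain ⟨hp0, hp1⟩ := AgentNetwork.decayRate_bounds hmJ hD ha1 hb hc hd hdlt rfl
    exact ⟨_, rfl, hp0, hp1, H.exponentialDecay hP hW hρ hJ2 hmJ hMJ hD hb hc hd hαb hαbα hdt hdtT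
      hJ hE hDesc rfl hp0 hp1⟩
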